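/- Let $p$ be a prime and $n\ge 1$. Let $X$ and $Y$ be integral, regular, locally noetherian $\mathbb F_p$-schemes (for example, integral regular excellent $\mathbb F_p$-schemes), and let $f:X\to Y$ be an étale morphism; it is automatically dominant, and we write $\varphi:K(Y)\hookrightarrow K(X)$ for the induced extension of function fields. Let $D$ be an $\mathbb R$-divisor on $Y$, i.e. a locally finite formal sum of prime divisors with real coefficients, and let $f^*D$ be its pullback ($D$ is $\mathbb R$-Cartier since $Y$ is regular; local equations of prime divisors are pulled back). For an $\mathbb R$-divisor $E$ on an integral regular locally noetherian $\mathbb F_p$-scheme $Z$, let $W_n\mathcal O_Z(E)$ be the subsheaf of $W_n\mathcal O_Z$-modules of the constant sheaf $W_n(K(Z))$ whose sections over a non-empty open subset $U$ are $$\Gamma(U,W_n\mathcal O_Z(E))=\{(\varphi_0,\dots,\varphi_{n-1})\in W_n(K(Z)) \mid (\operatorname{div}(\varphi_i)+p^iE)|_U\ge 0 \text{ for all } 0\le i\le n-1\},$$ where $\varphi_i=0$ is always allowed. Let $W_nf:W_nX\to W_nY$ be the morphism induced by $f$ on the Witt schemes $W_nX=(X,W_n\mathcal O_X)$ and $W_nY=(Y,W_n\mathcal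 O_Y)$. Then the ring homomorphism $W_n(\varphi):W_n(K(Y))\to W_n(K(X))$ restricts to a (necessarily unique) homomorphism of $W_n\mathcal O_Y$-modules $W_n\mathcal O_Y(D)\to (W_nf)_*W_n\mathcal O_X(f^*D)$, and the homomorphism of $W_n\mathcal O_X$-modules adjoint to it, $$(W_nf)^*(W_n\mathcal O_Y(D))\longrightarrow W_n\mathcal O_X(f^*D),$$ is an isomorphism. -/

import Mathlib

open CategoryTheory AlgebraicGeometry TopologicalSpace Opposite Order

universe u

namespace WittDivisorial

noncomputable section

section Algebra

variable {p : ℕ} [hp : Fact p.Prime]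

theorem ghost_aux {R : Type*} [CommRing R] (a : R) (w : WittVector p R) (n : ℕ) :
    WittVector.ghostComponent n (WittVector.mk p fun i => a ^ p ^ i * w.coeff i) =
      a ^ p ^ n * WittVector.ghostComponent n w := by
  rw [WittVector.ghostComponent_apply, WittVector.ghostComponent_apply, aeval_wittPolynomial,
    aeval_wittPolynomial, Finset.mul_sum]
  refine Finset.sum_congr rfl fun i hi => ?_
  have hi' : i ≤ n := Nat.lt_succ_iff.mp (Finset.mem_range.mp hi)
  have : p ^ n = p ^ i * p ^ (n - i) := by rw [← pow_add, Nat.add_sub_cancel' hi']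
  rw [WittVector.coeff_mk, mul_pow, ← pow_mul, ← this]
  ring

theorem teichmuller_mul {R : Type u} [CommRing R] (a : R) (w : WittVector p R) :
    WittVector.teichmuller p a * w = WittVector.mk p fun i => a ^ p ^ i * w.coeff i := by
  have h1 : ∀ (a : MvPolynomial R ℚ) (w : WittVector p (MvPolynomial R ℚ)),
      WittVector.teichmuller p a * w = WittVector.mk p fun i => a ^ p ^ i * w.coeff i := by
    intro a w
    apply (WittVector.ghostMap.bijective_of_invertible p (MvPolynomial R ℚ)).1
    ext1 n
    rw [map_mul]
    simp only [Pi.mul_apply, WittVector.ghostMap_apply, ghost_aux,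
      WittVector.ghostComponent_teichmuller]
  have h2 : ∀ (a : MvPolynomial R ℤ) (w : WittVector p (MvPolynomial R ℤ)),
      WittVector.teichmuller p a * w = WittVector.mk p fun i => a ^ p ^ i * w.coeff i := by
    intro a w
    refine WittVector.map_injective (MvPolynomial.map (Int.castRingHom ℚ))
      (MvPolynomial.map_injective _ Int.cast_injective) ?_
    rw [map_mul, WittVector.map_teichmuller, h1]
    ext i
    simp [WittVector.map_coeff]
  obtain ⟨a, rfl⟩ := MvPolynomial.counit_surjective R a
  obtain ⟨w, rfl⟩ := WittVector.map_surjective _ (MvPolynomial.counit_surjective R) w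
  rw [← WittVector.map_teichmuller, ← map_mul, h2]
  ext i
  simp [WittVector.map_coeff]

/-- The ring homomorphism `W_n(R) → W_n(S)` induced by `g : R → S`; it applies `g` to each
Witt coordinate. -/
def truncMap (n : ℕ) {R S : Type*} [CommRing R] [CommRing S] (g : R →+* S) :
    TruncatedWittVector p n R →+* TruncatedWittVector p n S :=
  have key : ∀ w : WittVector p R,
      TruncatedWittVector.mk p (fun i => g ((WittVector.truncate n w).coeff i)) =
        WittVector.truncate n (WittVector.map g w) := by
    intro w
    ext i
    simp [WittVector.map_coeff]
  { toFun := fun x => TruncatedWittVector.mk p fun i => g (x.coeff i)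
    map_one' := by
      rw [← map_one (WittVector.truncate n), key, map_one, map_one]
    map_zero' := by
      rw [← map_zero (WittVector.truncate n), key, map_zero, map_zero]
    map_mul' := fun x y => by
      obtain ⟨x, rfl⟩ := WittVector.truncate_surjective p n R x
      obtain ⟨y, rfl⟩ := WittVector.truncate_surjective p n R y
      rw [← map_mul, key, key, key, map_mul, map_mul]
    map_add' := fun x y => by
      obtain ⟨x, rfl⟩ := WittVector.truncate_surjective p n R x
      obtain ⟨y, rfl⟩ := WittVector.truncate_surjective p n R y
      rw [← map_add, key, key, key, map_add, map_add] }

@[simp]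
theorem truncMap_coeff {n : ℕ} {R S : Type*} [CommRing R] [CommRing S] (g : R →+* S)
    (x : TruncatedWittVector p n R) (i : Fin n) :
    (truncMap n g x).coeff i = g (x.coeff i) := rfl

variable {K : Type u} [CommRing K]

/-- The subring of `K[T]` of polynomials whose coefficient of `T ^ k` lies in `A k`, for a
multiplicative filtration `A`. -/
def reesSubring (A : ℕ → AddSubgroup K) (h1 : 1 ∈ A 0)
    (hm : ∀ k l a b, a ∈ A k → b ∈ A l → a * b ∈ A (k + l)) : Subring (Polynomial K) where
  carrier := {f | ∀ k, f.coeff k ∈ A k}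
  zero_mem' := fun k => by simp
  one_mem' := fun k => by
    rw [Polynomial.coeff_one]
    split_ifs with h
    · exact h ▸ h1
    · exact (A k).zero_mem
  add_mem' := fun {f g} hf hg k => by
    rw [Polynomial.coeff_add]; exact (A k).add_mem (hf k) (hg k)
  neg_mem' := fun {f} hf k => by
    rw [Polynomial.coeff_neg]; exact (A k).neg_mem (hf k)
  mul_mem' := fun {f g} hf hg k => by
    rw [Polynomial.coeff_mul]
    refine (A k).sum_mem fun ij hij => ?_
    rw [← Finset.HasAntidiagonal.mem_antidiagonal.mp hij]
    exact hm _ _ _ _ (hf _) (hg _)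

theorem coeff_mem_iff (A : ℕ → AddSubgroup K) (h1 : 1 ∈ A 0)
    (hm : ∀ k l a b, a ∈ A k → b ∈ A l → a * b ∈ A (k + l))
    (w : WittVector p K) :
    (∀ i, w.coeff i ∈ A (p ^ i)) ↔ ∃ v : WittVector p (reesSubring A h1 hm),
      WittVector.map (reesSubring A h1 hm).subtype v =
        WittVector.teichmuller p Polynomial.X * WittVector.map Polynomial.C w := by
  rw [teichmuller_mul]
  constructor
  · intro h
    refine ⟨WittVector.mk p fun i => ⟨Polynomial.X ^ p ^ i * Polynomial.C (w.coeff i), ?_⟩, ?_⟩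
    · intro k
      rw [mul_comm, Polynomial.coeff_C_mul_X_pow]
      split_ifs with hk
      · exact hk ▸ h i
      · exact (A k).zero_mem
    · ext i : 1
      simp [WittVector.map_coeff]
  · rintro ⟨v, hv⟩ i
    have h2 := congrArg (fun z => (WittVector.coeff z i).coeff (p ^ i)) hv
    simp only [WittVector.map_coeff, WittVector.coeff_mk] at h2
    rw [mul_comm, Polynomial.coeff_C_mul_X_pow, if_pos rfl] at h2
    rw [← h2]
    exact (v.coeff i).2 (p ^ i)

theorem coeff_add_mem (A : ℕ → AddSubgroup K) (h1 : 1 ∈ A 0)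
    (hm : ∀ k l a b, a ∈ A k → b ∈ A l → a * b ∈ A (k + l))
    (w w' : WittVector p K) (hw : ∀ i, w.coeff i ∈ A (p ^ i))
    (hw' : ∀ i, w'.coeff i ∈ A (p ^ i)) : ∀ i, (w + w').coeff i ∈ A (p ^ i) := by
  rw [coeff_mem_iff A h1 hm] at hw hw' ⊢
  obtain ⟨v, hv⟩ := hw
  obtain ⟨v', hv'⟩ := hw'
  exact ⟨v + v', by rw [map_add, map_add, mul_add, hv, hv']⟩

theorem coeff_mul_mem (A : ℕ → AddSubgroup K) (h1 : 1 ∈ A 0)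
    (hm : ∀ k l a b, a ∈ A k → b ∈ A l → a * b ∈ A (k + l))
    (a w : WittVector p K) (ha : ∀ i, a.coeff i ∈ A 0)
    (hw : ∀ i, w.coeff i ∈ A (p ^ i)) : ∀ i, (a * w).coeff i ∈ A (p ^ i) := by
  rw [coeff_mem_iff A h1 hm] at hw ⊢
  obtain ⟨v, hv⟩ := hw
  have h2 : ∀ i, Polynomial.C (a.coeff i) ∈ reesSubring A h1 hm := by
    intro i k
    rw [Polynomial.coeff_C]
    split_ifs with hk
    · exact hk ▸ ha i
    · exact (A k).zero_mem
  refine ⟨(WittVector.mk p fun i => ⟨_, h2 i⟩) * v, ?_⟩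
  have h3 : WittVector.map (reesSubring A h1 hm).subtype (WittVector.mk p fun i => ⟨_, h2 i⟩) =
      WittVector.map Polynomial.C a := by
    ext i : 1
    simp [WittVector.map_coeff]
  rw [map_mul, map_mul, hv, h3]
  ring

theorem trunc_coeff_add_mem (A : ℕ → AddSubgroup K) (h1 : 1 ∈ A 0)
    (hm : ∀ k l a b, a ∈ A k → b ∈ A l → a * b ∈ A (k + l))
    {n : ℕ} (w w' : TruncatedWittVector p n K)
    (hw : ∀ i : Fin n, w.coeff i ∈ A (p ^ (i : ℕ))) (hw' : ∀ i : Fin n, w'.coeff i ∈ A (p ^ (i : ℕ))) :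
    ∀ i : Fin n, (w + w').coeff i ∈ A (p ^ (i : ℕ)) := by
  have hout : ∀ w : TruncatedWittVector p n K, (∀ i : Fin n, w.coeff i ∈ A (p ^ (i : ℕ))) →
      ∀ i, w.out.coeff i ∈ A (p ^ i) := by
    intro w hw i
    simp only [TruncatedWittVector.out]
    split_ifs with h
    · exact hw ⟨i, h⟩
    · exact (A _).zero_mem
  intro i
  have := coeff_add_mem A h1 hm _ _ (hout w hw) (hout w' hw') i
  rw [← WittVector.coeff_truncate (n := n)] at this
  have e : ∀ w : TruncatedWittVector p n K, WittVector.truncate n w.out = w :=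
    TruncatedWittVector.truncateFun_out
  rwa [map_add, e, e] at this

theorem trunc_coeff_mul_mem (A : ℕ → AddSubgroup K) (h1 : 1 ∈ A 0)
    (hm : ∀ k l a b, a ∈ A k → b ∈ A l → a * b ∈ A (k + l))
    {n : ℕ} (a w : TruncatedWittVector p n K)
    (ha : ∀ i, a.coeff i ∈ A 0) (hw : ∀ i : Fin n, w.coeff i ∈ A (p ^ (i : ℕ))) :
    ∀ i : Fin n, (a * w).coeff i ∈ A (p ^ (i : ℕ)) := by
  have hout : ∀ w : TruncatedWittVector p n K, (∀ i : Fin n, w.coeff i ∈ A (p ^ (i : ℕ))) →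
      ∀ i, w.out.coeff i ∈ A (p ^ i) := by
    intro w hw i
    simp only [TruncatedWittVector.out]
    split_ifs with h
    · exact hw ⟨i, h⟩
    · exact (A _).zero_mem
  have hout' : ∀ i, a.out.coeff i ∈ A 0 := by
    intro i
    simp only [TruncatedWittVector.out]
    split_ifs with h
    · exact ha ⟨i, h⟩
    · exact (A _).zero_mem
  intro i
  have := coeff_mul_mem A h1 hm _ _ hout' (hout w hw) i
  rw [← WittVector.coeff_truncate (n := n)] at this
  have e : ∀ w : TruncatedWittVector p n K, WittVector.truncate n w.out = w :=
    TruncatedWittVector.truncateFun_out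
  rwa [map_mul, e, e] at this

end Algebra

section WittScheme

variable (p : ℕ) [hp : Fact p.Prime] (n : ℕ)

/-- The functor `R ↦ W_n(R)`. -/
def wittFunctor : CommRingCat.{u} ⥤ RingCat.{u} where
  obj R := RingCat.of (TruncatedWittVector p n R)
  map g := RingCat.ofHom (truncMap n g.hom)
  map_id _ := RingCat.hom_ext (RingHom.ext fun _ => rfl)
  map_comp _ _ := RingCat.hom_ext (RingHom.ext fun _ => rfl)

variable (X : Scheme.{u})

theorem wittPresheaf_isSheaf : TopCat.Presheaf.IsSheaf (X.presheaf ⋙ wittFunctor p n) := by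
  rw [TopCat.Presheaf.isSheaf_iff_isSheafUniqueGluing]
  intro ι U sf hsf
  have hsf' : ∀ (k : Fin n), TopCat.Presheaf.IsCompatible X.presheaf U
      (fun i => TruncatedWittVector.coeff (p := p) k (sf i)) := by
    intro k i j
    exact congrArg (TruncatedWittVector.coeff (p := p) k) (hsf i j)
  choose s hs hu using fun k => X.sheaf.existsUnique_gluing U _ (hsf' k)
  refine ⟨TruncatedWittVector.mk p s, ?_, ?_⟩
  · intro i
    exact TruncatedWittVector.ext fun k => hs k i
  · intro t ht
    exact TruncatedWittVector.ext fun k =>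
      hu k (TruncatedWittVector.coeff (p := p) k t) fun i => congrArg (TruncatedWittVector.coeff (p := p) k) (ht i)

/-- The structure sheaf `W_n 𝒪_X` of the Witt scheme `W_n X`: the sheaf of rings
`U ↦ W_n(Γ(U, 𝒪_X))` on the topological space of `X`. For an `𝔽_p`-scheme `X`, the scheme `W_n X`
is the ringed space consisting of the space underlying `X` and this sheaf of rings; modules over
it depend only on this ringed space. -/
def wittSheaf : Sheaf (Opens.grothendieckTopology X) RingCat.{u} :=
  ⟨X.presheaf ⋙ wittFunctor p n, wittPresheaf_isSheaf p n X⟩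

variable {X} {Y : Scheme.{u}} (f : X ⟶ Y)

/-- The morphism `W_n f : W_n X ⟶ W_n Y` on structure sheaves: the morphism
`W_n 𝒪_Y ⟶ f_* W_n 𝒪_X` induced by `f`. -/
def wittHom : wittSheaf p n Y ⟶
    ((Opens.map f.base).sheafPushforwardContinuous _ _ _).obj (wittSheaf p n X) where
  hom := Functor.whiskerRight f.c (wittFunctor p n)

end WittScheme

section Divisors

/-- A scheme is regular if all its local rings are regular. -/
class RegularScheme (X : Scheme.{u}) : Prop where
  regular_stalk (x : X) : IsRegularLocalRing (X.presheaf.stalk x)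

/-- `ℝ`-divisors: locally finite formal sums of prime divisors with real coefficients.
A prime divisor is represented by its generic point, a point of codimension one. -/
structure RDivisor (X : Scheme.{u}) where
  cycle : AlgebraicCycle X ℝ
  codim_one (x : X) : cycle x ≠ 0 → coheight x = 1

variable {X : Scheme.{u}} [AlgebraicGeometry.IsIntegral X] [IsLocallyNoetherian X] [RegularScheme X]

theorem isDVR_stalk (x : X) (hx : coheight x = 1) :
    IsDiscreteValuationRing (X.presheaf.stalk x) := by
  have hr := RegularScheme.regular_stalk x
  have hd : ringKrullDim (X.presheaf.stalk x) = 1 := by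
    rw [ringKrullDim_stalk_eq_coheight, hx]; rfl
  have hs := hr.spanFinrank_maximalIdeal
  rw [hd] at hs
  have hs' : (IsLocalRing.maximalIdeal (X.presheaf.stalk x)).spanFinrank = 1 := by exact_mod_cast hs
  have hf : ¬ IsField (X.presheaf.stalk x) := by
    intro h
    rw [ringKrullDim_eq_zero_of_isField h] at hd
    exact absurd hd (by norm_num)
  exact ((IsDiscreteValuationRing.TFAE _ hf).out 4 0).mp
    ((Submodule.spanFinrank_eq_one_iff _).mp hs').1

/-- The rational functions `r` satisfying `div(r) + k D ≥ 0` at the point `x`, that is, `r = 0`,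
or `ord_x(r) + k D(x) ≥ 0` if `x` is the generic point of a prime divisor. -/
def boundAt (D : RDivisor X) (x : X) (k : ℕ) : AddSubgroup X.functionField where
  carrier := {r | r ≠ 0 → coheight x = 1 → 0 ≤ (Scheme.ord r x : ℝ) + k * D.cycle x}
  zero_mem' := fun h => absurd rfl h
  add_mem' := by
    intro r s hr hs h hx
    have := isDVR_stalk x hx
    by_cases hr0 : r = 0
    · subst hr0
      rw [zero_add] at h ⊢
      exact hs h hx
    by_cases hs0 : s = 0
    · subst hs0
      rw [add_zero] at h ⊢
      exact hr h hx
    have h1 := Scheme.ord_add (x := x) h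
    rcases min_le_iff.mp h1 with h2 | h2
    · have h3 : (Scheme.ord r x : ℝ) ≤ Scheme.ord (r + s) x := by exact_mod_cast h2
      linarith [hr hr0 hx]
    · have h3 : (Scheme.ord s x : ℝ) ≤ Scheme.ord (r + s) x := by exact_mod_cast h2
      linarith [hs hs0 hx]
  neg_mem' := by
    intro r hr h hx
    have hr0 : r ≠ 0 := fun e => h (by rw [e, neg_zero])
    have : Nonempty (⊤ : X.Opens) := ⟨⟨x, trivial⟩⟩
    have h1 : Scheme.ord (-r) x = Scheme.ord r x := by
      have e : -r = X.germToFunctionField ⊤ (-1) * r := by simp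
      rw [e, Scheme.ord_mul (by simp) hr0, Scheme.ord_of_isUnit (U := ⊤) isUnit_one.neg (Opens.mem_top x), zero_add]
    rw [h1]
    exact hr hr0 hx

theorem one_mem_boundAt (D : RDivisor X) (x : X) : 1 ∈ boundAt D x 0 := by
  intro _ _
  have : Nonempty (⊤ : X.Opens) := ⟨⟨x, trivial⟩⟩
  have e : (1 : X.functionField) = X.germToFunctionField ⊤ 1 := by simp
  rw [e, Scheme.ord_of_isUnit (U := ⊤) isUnit_one (Opens.mem_top x)]
  simp

theorem mul_mem_boundAt (D : RDivisor X) (x : X) (k l : ℕ) (a b : X.functionField)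
    (ha : a ∈ boundAt D x k) (hb : b ∈ boundAt D x l) : a * b ∈ boundAt D x (k + l) := by
  intro h hx
  have h1 := ha (left_ne_zero_of_mul h) hx
  have h2 := hb (right_ne_zero_of_mul h) hx
  rw [Scheme.ord_mul (left_ne_zero_of_mul h) (right_ne_zero_of_mul h)]
  push_cast
  linarith

theorem algebraMap_mem_boundAt (D : RDivisor X) (x : X) (a : X.presheaf.stalk x) :
    algebraMap _ X.functionField a ∈ boundAt D x 0 := by
  intro h hx
  have : Ring.KrullDimLE 1 (X.presheaf.stalk x) := krullDimLE_of_coheight_le hx.le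
  have ha : a ≠ 0 := fun e => h (by rw [e, map_zero])
  have h1 : (0 : ℤ) ≤ Scheme.ord (algebraMap _ X.functionField a) x := by
    rw [Scheme.le_ord_iff hx h]
    exact Ring.ordFrac_ge_one_of_ne_zero ha
  have h2 : (0 : ℝ) ≤ Scheme.ord (algebraMap _ X.functionField a) x := by exact_mod_cast h1
  simpa using h2
end Divisors

section WittDivisorialSheaf

variable (p : ℕ) [hp : Fact p.Prime] (n : ℕ)
variable {X : Scheme.{u}} [AlgebraicGeometry.IsIntegral X] [IsLocallyNoetherian X] [RegularScheme X]

/-- The sections over `U` of the Witt divisorial sheaf `W_n 𝒪_X(D)`, as a subgroup of the group of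
functions `U → W_n(K(X))`: the locally constant functions `φ = (φ_0, …, φ_{n-1})`
(the sections of the constant sheaf `W_n(K(X))`) such that
`(div(φ_i) + p ^ i D)|_U ≥ 0` for all `i`. -/
def wittDivSections (D : RDivisor X) (U : X.Opens) :
    AddSubgroup (U → TruncatedWittVector p n X.functionField) where
  carrier := {s | IsLocallyConstant s ∧
    ∀ (x : U) (i : Fin n), (s x).coeff i ∈ boundAt D x.1 (p ^ (i : ℕ))}
  zero_mem' := ⟨IsLocallyConstant.const _, fun x i => by
    simp only [Pi.zero_apply, TruncatedWittVector.coeff_zero]; exact AddSubgroup.zero_mem _⟩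
  add_mem' := fun {s t} hs ht => ⟨hs.1.add ht.1, fun x =>
    trunc_coeff_add_mem (boundAt D x.1) (one_mem_boundAt D x.1) (mul_mem_boundAt D x.1) _ _
      (hs.2 x) (ht.2 x)⟩
  neg_mem' := fun {s} hs => ⟨hs.1.neg, fun x => by
    rw [Pi.neg_apply]
    have h := trunc_coeff_mul_mem (boundAt D x.1) (one_mem_boundAt D x.1) (mul_mem_boundAt D x.1)
      (truncMap n (algebraMap (X.presheaf.stalk x.1) X.functionField) (-1)) (s x)
      (fun i => algebraMap_mem_boundAt D x.1 _) (hs.2 x)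
    rwa [map_neg, map_one, neg_one_mul] at h⟩

/-- The ring homomorphism `W_n(Γ(U, 𝒪_X)) → W_n(K(X))`, for `x ∈ U`. -/
def wittToFunctionField {U : X.Opens} (x : U) :
    TruncatedWittVector p n Γ(X, U) →+* TruncatedWittVector p n X.functionField :=
  truncMap n ((algebraMap (X.presheaf.stalk x.1) X.functionField).comp
    (X.presheaf.germ U x.1 x.2).hom)

theorem wittToFunctionField_eq {U : X.Opens} (x y : U) :
    wittToFunctionField p n x = wittToFunctionField p n y := by
  have : Nonempty U := ⟨x⟩
  ext a i
  change algebraMap _ _ (X.presheaf.germ U x.1 x.2 (a.coeff i)) =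
    algebraMap _ _ (X.presheaf.germ U y.1 y.2 (a.coeff i))
  rw [Scheme.algebraMap_germ_eq_germToFunctionField, Scheme.algebraMap_germ_eq_germToFunctionField]

instance (D : RDivisor X) (U : X.Opens) :
    Module (TruncatedWittVector p n Γ(X, U)) (wittDivSections p n D U) where
  smul a s := ⟨fun x => wittToFunctionField p n x a * s.1 x, by
    refine ⟨?_, fun x => ?_⟩
    · have : IsLocallyConstant fun x : U => wittToFunctionField p n x a :=
        IsLocallyConstant.of_constant _ fun x y => by rw [wittToFunctionField_eq p n x y]
      exact this.mul s.2.1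
    · exact trunc_coeff_mul_mem (boundAt D x.1) (one_mem_boundAt D x.1) (mul_mem_boundAt D x.1)
        _ _ (fun i => algebraMap_mem_boundAt D x.1 _) (s.2.2 x)⟩
  one_smul s := Subtype.ext (funext fun x =>
    show wittToFunctionField p n x 1 * s.1 x = s.1 x by rw [map_one, one_mul])
  mul_smul a b s := Subtype.ext (funext fun x =>
    show wittToFunctionField p n x (a * b) * s.1 x =
      wittToFunctionField p n x a * (wittToFunctionField p n x b * s.1 x) by
      rw [map_mul, mul_assoc])
  smul_zero a := Subtype.ext (funext fun x =>
    show wittToFunctionField p n x a * 0 = 0 by rw [mul_zero])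
  smul_add a s t := Subtype.ext (funext fun x =>
    show wittToFunctionField p n x a * (s.1 x + t.1 x) =
      wittToFunctionField p n x a * s.1 x + wittToFunctionField p n x a * t.1 x by rw [mul_add])
  add_smul a b s := Subtype.ext (funext fun x =>
    show wittToFunctionField p n x (a + b) * s.1 x =
      wittToFunctionField p n x a * s.1 x + wittToFunctionField p n x b * s.1 x by
      rw [map_add, add_mul])
  zero_smul s := Subtype.ext (funext fun x =>
    show wittToFunctionField p n x 0 * s.1 x = 0 by rw [map_zero, zero_mul])

/-- Restriction of sections of `W_n 𝒪_X(D)`. -/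
def wittDivRestrict (D : RDivisor X) {U V : X.Opens} (h : V ≤ U) :
    wittDivSections p n D U →+ wittDivSections p n D V where
  toFun s := ⟨fun x => s.1 ⟨x.1, h x.2⟩,
    s.2.1.comp_continuous (continuous_inclusion h), fun x i => s.2.2 ⟨x.1, h x.2⟩ i⟩
  map_zero' := rfl
  map_add' _ _ := rfl

/-- The abelian presheaf underlying `W_n 𝒪_X(D)`. -/
def wittDivAbPresheaf (D : RDivisor X) : TopCat.Presheaf AddCommGrpCat.{u} X where
  obj U := AddCommGrpCat.of (wittDivSections p n D U.unop)
  map g := AddCommGrpCat.ofHom (wittDivRestrict p n D g.unop.le)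

theorem wittDivAbPresheaf_isSheaf (D : RDivisor X) : (wittDivAbPresheaf p n D).IsSheaf := by
  rw [TopCat.Presheaf.isSheaf_iff_isSheaf_comp' (forget AddCommGrpCat)]
  let P : TopCat.LocalPredicate fun _ : X => TruncatedWittVector p n X.functionField :=
    { pred := fun {U} s => s ∈ wittDivSections p n D U
      res := fun {U V} i s hs => (wittDivRestrict p n D i.le ⟨s, hs⟩).2
      locality := fun {U} s h => by
        refine ⟨?_, fun x i => ?_⟩
        · rw [IsLocallyConstant.iff_exists_open]
          intro x
          obtain ⟨V, hxV, i, hV, -⟩ := h x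
          obtain ⟨W, hW, hxW, hc⟩ := (IsLocallyConstant.iff_exists_open _).mp hV ⟨x.1, hxV⟩
          refine ⟨Subtype.val ⁻¹' (Subtype.val '' W), ?_, ⟨_, hxW, rfl⟩, ?_⟩
          · exact (V.isOpen.isOpenMap_subtype_val W hW).preimage continuous_subtype_val
          · rintro ⟨y, hy⟩ ⟨z, hz, rfl⟩
            exact hc z hz
        · obtain ⟨V, hxV, i', -, hV⟩ := h x
          exact hV ⟨x.1, hxV⟩ i }
  exact TopCat.subpresheafToTypes.isSheaf P

instance (D : RDivisor X) (U : (Opens X)ᵒᵖ) :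
    Module ((wittSheaf p n X).obj.obj U) ((wittDivAbPresheaf p n D).obj U) :=
  inferInstanceAs (Module (TruncatedWittVector p n Γ(X, U.unop)) (wittDivSections p n D U.unop))

/-- The Witt divisorial sheaf `W_n 𝒪_X(D)`, as a sheaf of `W_n 𝒪_X`-modules. -/
def wittDivSheaf (D : RDivisor X) : SheafOfModules.{u} (wittSheaf p n X) where
  val := PresheafOfModules.ofPresheaf (wittDivAbPresheaf p n D) (by
    intro U V g a s
    refine Subtype.ext (funext fun x => ?_)
    refine congrArg (· * s.1 ⟨x.1, g.unop.le x.2⟩) ?_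
    refine TruncatedWittVector.ext fun i => congrArg (algebraMap _ X.functionField) ?_
    exact (X.presheaf.germ_res_apply g.unop x.1 x.2 _).symm)
  isSheaf := wittDivAbPresheaf_isSheaf p n D

end WittDivisorialSheaf

section Pullback

variable {X Y : Scheme.{u}} [AlgebraicGeometry.IsIntegral X] [AlgebraicGeometry.IsIntegral Y]

instance (f : X ⟶ Y) [Etale f] : IsDominant f where
  denseRange := by
    have h : IsOpen (Set.range f) := f.isOpenMap.isOpen_range
    exact h.dense (Set.range_nonempty f)

theorem map_genericPoint (f : X ⟶ Y) [IsDominant f] : f (genericPoint X) = genericPoint Y := by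
  have h := (genericPoint_spec X).image f.continuous
  rw [Set.image_univ, f.denseRange.closure_range] at h
  exact h.eq (genericPoint_spec Y)

/-- The extension of function fields `K(Y) → K(X)` induced by a dominant morphism `f : X ⟶ Y`. -/
def functionFieldMap (f : X ⟶ Y) [IsDominant f] : Y.functionField →+* X.functionField :=
  (Y.presheaf.stalkSpecializes (specializes_of_eq (map_genericPoint f)) ≫
    f.stalkMap (genericPoint X)).hom

open scoped Classical in
/-- Let `η` be the generic point of a prime divisor `E` of `Y`. If `f(x) ∈ E`, then this is the
length of `𝒪_{X,x} / I_E 𝒪_{X,x}`, where `I_E ⊆ 𝒪_{Y,f(x)}` is the prime ideal of `E`. If `Y` is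
regular, then `I_E = (g)` for a local equation `g` of `E` at `f(x)`, so that for `x` of codimension
one this number is the order of vanishing `ord_x(f^* g)`, i.e. the coefficient of
`f^* E` at `x`. It is `0` if `f(x) ∉ E`. -/
def pullbackMult (f : X ⟶ Y) (x : X) (η : Y) : ℕ :=
  if h : η ⤳ f x then
    (Module.length (X.presheaf.stalk x) (X.presheaf.stalk x ⧸
      ((IsLocalRing.maximalIdeal (Y.presheaf.stalk η)).comap
        (Y.presheaf.stalkSpecializes h).hom).map (f.stalkMap x).hom)).toNat
  else 0

/-- If `g` is a local equation at `f(x)` of the prime divisor with generic point `η`, then its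
multiplicity in the pullback is the order of vanishing of `f^* g` in `𝒪_{X,x}`. -/
theorem pullbackMult_eq_ord (f : X ⟶ Y) (x : X) (η : Y) (h : η ⤳ f x)
    (g : Y.presheaf.stalk (f x))
    (hg : (IsLocalRing.maximalIdeal (Y.presheaf.stalk η)).comap
      (Y.presheaf.stalkSpecializes h).hom = Ideal.span {g}) :
    pullbackMult f x η = (Ring.ord (X.presheaf.stalk x) (f.stalkMap x g)).toNat := by
  rw [pullbackMult, dif_pos h, hg, Ideal.map_span, Set.image_singleton]
  rfl

open scoped Classical in
/-- The coefficient at `x` of the pullback `f^* D = ∑ D(η) f^* E_η`, where `E_η` is the closure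
of `η`. -/
def pullbackCoeff (f : X ⟶ Y) (D : RDivisor Y) (x : X) : ℝ :=
  if coheight x = 1 then ∑ᶠ η : Y, D.cycle η * pullbackMult f x η else 0

theorem exists_of_pullbackCoeff_ne_zero (f : X ⟶ Y) (D : RDivisor Y) (x : X)
    (h : pullbackCoeff f D x ≠ 0) : coheight x = 1 ∧ ∃ η, D.cycle η ≠ 0 ∧ η ⤳ f x := by
  unfold pullbackCoeff at h
  split_ifs at h with h1
  · refine ⟨h1, ?_⟩
    obtain ⟨η, hη⟩ : ∃ η, D.cycle η * pullbackMult f x η ≠ 0 := by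
      by_contra! h0
      exact h (by simp [h0])
    refine ⟨η, left_ne_zero_of_mul hη, ?_⟩
    by_contra hs
    exact hη (by simp [pullbackMult, hs])
  · exact absurd rfl h

theorem eq_of_specializes_of_coheight {x g : X} (hx : coheight x = 1) (hg : g ⤳ x)
    (hne : g ≠ genericPoint X) : x = g := by
  by_contra hxg
  have hlt : x < g := by
    refine lt_of_le_not_ge (Scheme.le_iff_specializes.mpr hg) fun h => hxg ?_
    exact (Specializes.antisymm (Scheme.le_iff_specializes.mp h) hg).eq
  have h1 := coheight_add_one_le hlt
  rw [hx] at h1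
  have h2 : coheight g = 0 := by
    by_contra h0
    have h3 : 1 ≤ coheight g := Order.one_le_iff_ne_zero.mpr h0
    have h4 : (1 : ℕ∞) + 1 ≤ 1 := (add_le_add_left h3 1).trans h1
    exact absurd h4 (by decide)
  rw [coheight_eq_zero] at h2
  have h3 : g ≤ genericPoint X :=
    Scheme.le_iff_specializes.mpr ((genericPoint_spec X).specializes trivial)
  exact hne (Specializes.antisymm (Scheme.le_iff_specializes.mp (h2 h3))
    (Scheme.le_iff_specializes.mp h3)).eq

theorem coheight_genericPoint : coheight (genericPoint X) = 0 := by
  rw [coheight_eq_zero]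
  intro y _
  exact Scheme.le_iff_specializes.mpr ((genericPoint_spec X).specializes trivial)

theorem pullbackCoeff_locallyFinite [IsLocallyNoetherian X] (f : X ⟶ Y) [IsDominant f]
    (D : RDivisor Y) (z : X) :
    ∃ t ∈ nhds z, (t ∩ Function.support (pullbackCoeff f D)).Finite := by
  obtain ⟨t, ht, hfin⟩ := D.cycle.supportLocallyFiniteWithinDomain' (f z) trivial
  obtain ⟨V, hVt, hV, hzV⟩ := mem_nhds_iff.mp ht
  obtain ⟨_, ⟨U, hU, rfl⟩, hzU, hUV⟩ := X.isBasis_affineOpens.exists_subset_of_mem_open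
    (show z ∈ f ⁻¹' V from hzV) (hV.preimage f.continuous)
  have : NoetherianSpace U := by
    have : IsNoetherianRing Γ(X, U) := IsLocallyNoetherian.component_noetherian ⟨U, hU⟩
    exact noetherianSpace_of_isAffineOpen U hU
  let C : Set Y := ⋃ η ∈ t ∩ Function.support D.cycle.toFun, closure {η}
  have hC : IsClosed C := hfin.isClosed_biUnion fun _ _ => isClosed_closure
  let Z : Set U := {x | f x.1 ∈ C}
  have hZ : IsClosed Z := hC.preimage (f.continuous.comp continuous_subtype_val)
  have hgen : ∀ g : X, f g ∈ C → g ≠ genericPoint X := by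
    rintro g hg rfl
    rw [map_genericPoint] at hg
    obtain ⟨η, hη, hη'⟩ := Set.mem_iUnion₂.mp hg
    have h1 : η ⤳ genericPoint Y := specializes_iff_mem_closure.mpr hη'
    have h2 : η = genericPoint Y :=
      (Specializes.antisymm h1 ((genericPoint_spec Y).specializes trivial)).eq
    have h3 := D.codim_one η hη.2
    rw [h2, coheight_genericPoint] at h3
    exact absurd h3 (by decide)
  obtain ⟨S, hSf, hSc, hSi, hS⟩ := NoetherianSpace.exists_finite_set_isClosed_irreducible hZ
  have hq : QuasiSober U := inferInstanceAs (QuasiSober (Scheme.Opens.toScheme U))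
  refine ⟨U, U.isOpen.mem_nhds hzU, ?_⟩
  classical
  let gen : Set U → X := fun T => if h : IsIrreducible T then (h.genericPoint).1 else z
  refine (hSf.image gen).subset ?_
  rintro x ⟨hxU, hx⟩
  obtain ⟨hx1, η, hη, hηx⟩ := exists_of_pullbackCoeff_ne_zero f D x hx
  have hηV : η ∈ V := hηx.mem_open hV (hUV hxU)
  have hxZ : (⟨x, hxU⟩ : U) ∈ Z :=
    Set.mem_iUnion₂.mpr ⟨η, ⟨hVt hηV, hη⟩, specializes_iff_mem_closure.mp hηx⟩
  rw [hS] at hxZ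
  obtain ⟨T, hT, hxT⟩ := Set.mem_sUnion.mp hxZ
  refine ⟨T, hT, ?_⟩
  have hTi := hSi T hT
  have hg : IsGenericPoint hTi.genericPoint T := by
    have := hTi.isGenericPoint_genericPoint_closure
    rwa [(hSc T hT).closure_eq] at this
  have hgx : hTi.genericPoint.1 ⤳ x := (hg.specializes hxT).map continuous_subtype_val
  have hgZ : hTi.genericPoint ∈ Z := by
    rw [hS]
    exact Set.mem_sUnion.mpr ⟨T, hT, hg.mem⟩
  have := eq_of_specializes_of_coheight hx1 hgx (hgen _ hgZ)
  simp only [gen, dif_pos hTi]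
  exact this.symm

/-- The pullback `f^* D` of an `ℝ`-divisor `D` on a regular scheme `Y` (where every `ℝ`-divisor is
`ℝ`-Cartier) under a dominant morphism `f : X ⟶ Y`. -/
def RDivisor.pullback [IsLocallyNoetherian X] (f : X ⟶ Y) [IsDominant f] (D : RDivisor Y) :
    RDivisor X where
  cycle :=
    { toFun := pullbackCoeff f D
      supportWithinDomain' := Set.subset_univ _
      supportLocallyFiniteWithinDomain' := fun z _ => pullbackCoeff_locallyFinite f D z }
  codim_one x h := (exists_of_pullbackCoeff_ne_zero f D x h).1

end Pullback

section NaturalMap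
variable (p : ℕ) [hp : Fact p.Prime] (n : ℕ)

section
variable {X Y : Scheme.{u}} (f : X ⟶ Y)

theorem presheafPushforward_isRightAdjoint : (PresheafOfModules.pushforward.{u} (F := Opens.map f.base)
    (R := (wittSheaf p n X).obj) (S := (wittSheaf p n Y).obj)
    (wittHom p n f).hom).IsRightAdjoint :=
  PresheafOfModules.instIsRightAdjointPushforward _

/-- The functor `(W_n f)_*` from `W_n 𝒪_X`-modules to `W_n 𝒪_Y`-modules. -/
abbrev wittPushforward :
    SheafOfModules.{u} (wittSheaf p n X) ⥤ SheafOfModules.{u} (wittSheaf p n Y) :=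
  SheafOfModules.pushforward.{u} (wittHom p n f)

instance : (SheafOfModules.pushforward.{u} (wittHom p n f)).IsRightAdjoint :=
  haveI := presheafPushforward_isRightAdjoint p n f
  (SheafOfModules.PullbackConstruction.adjunction.{u} (wittHom p n f)).isRightAdjoint

/-- The functor `(W_n f)^*` from `W_n 𝒪_Y`-modules to `W_n 𝒪_X`-modules. -/
abbrev wittPullback :
    SheafOfModules.{u} (wittSheaf p n Y) ⥤ SheafOfModules.{u} (wittSheaf p n X) :=
  SheafOfModules.pullback.{u} (wittHom p n f)

/-- The adjunction `(W_n f)^* ⊣ (W_n f)_*`. -/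
abbrev wittAdjunction : wittPullback.{u} p n f ⊣ wittPushforward.{u} p n f :=
  SheafOfModules.pullbackPushforwardAdjunction.{u} (wittHom p n f)

end

variable {X Y : Scheme.{u}} [AlgebraicGeometry.IsIntegral X] [AlgebraicGeometry.IsIntegral Y] [IsLocallyNoetherian X]
  [IsLocallyNoetherian Y] [RegularScheme X] [RegularScheme Y]

/-- A morphism of `W_n 𝒪_Y`-modules `α : W_n 𝒪_Y(D) ⟶ (W_n f)_* W_n 𝒪_X(E)` is compatible with the
ring homomorphism `W_n(K(Y)) → W_n(K(X))` if, for every open `V ⊆ Y` and every section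
`s` over `V`, the section `α(s)` over `f⁻¹(V)` takes the value `W_n(φ)(s(f(x)))` at every point `x`,
where `φ : K(Y) → K(X)`. There is at most one such `α`, see `IsNaturalMap.unique`. -/
def IsNaturalMap (f : X ⟶ Y) [IsDominant f] (D : RDivisor Y) (E : RDivisor X)
    (α : wittDivSheaf p n D ⟶ (wittPushforward p n f).obj (wittDivSheaf p n E)) : Prop :=
  ∀ (V : Y.Opens) (s : wittDivSections p n D V) (x : (f ⁻¹ᵁ V : X.Opens)),
    (show wittDivSections p n E (f ⁻¹ᵁ V) from (α.val.app (op V)).hom s).1 x =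
      truncMap n (functionFieldMap f) (s.1 ⟨f x.1, x.2⟩)

theorem IsNaturalMap.unique {f : X ⟶ Y} [IsDominant f] {D : RDivisor Y} {E : RDivisor X}
    {α β : wittDivSheaf p n D ⟶ (wittPushforward p n f).obj (wittDivSheaf p n E)}
    (hα : IsNaturalMap p n f D E α) (hβ : IsNaturalMap p n f D E β) : α = β := by
  refine SheafOfModules.hom_ext (PresheafOfModules.hom_ext fun V => ?_)
  refine ModuleCat.hom_ext (LinearMap.ext fun s => ?_)
  exact Subtype.ext (funext fun x => (hα V.unop s x).trans (hβ V.unop s x).symm)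

end NaturalMap

end

end WittDivisorial

/-! By Yoneda the adjoint map is an isomorphism once it has the right universal property: for every
sheaf `N` of modules over the Witt structure sheaf of `X`, each map from `W_n 𝒪_Y(D)` to the direct
image of `N` factors uniquely through the natural map. This is local. For affine opens with
coordinate rings `A → B`, where `B` is étale over the noetherian ring `A`, sections are Witt vectors
whose `i`-th coordinate lies in the module `M i` (over `A`) or `N i` (over `B`) of rational
functions with poles bounded by `p ^ i D` or `p ^ i f^* D`.

Two facts about coordinates are needed. First, `N i` is the base change of `M i`
(`exists_isBaseChange_divSubmodule`). Étale maps have ramification index one, so rounding down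
commutes with pullback. Regular noetherian domains are Krull domains, so an integral divisor is a
minimum of finitely many principal ones, and its module is a colon `{x | x J ⊆ A}` with `J` finite.
That is a kernel, and flat base change preserves it. Second, the relative Frobenius of an étale
algebra is an isomorphism (`FrobTwist.isPushout`). Hence `N j` is still the base change of `M j`
when scalars act through their `p ^ j`-th powers (`FrobTwist.isBaseChange_map`). This is exactly how
Teichmüller representatives act on the `j`-th Witt coordinate.

Filter Witt vectors by the vanishing of the first `j` coordinates; on graded pieces the extension
problem is the second fact. `WittRep.exists_lift` assembles the pieces without forming a tensor
product over `W_n(A)`. Given `α : S → T` and a semilinear `β : S → P`, it takes the `W_n(B)`-span of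
all `(α s, β s)` in `T × P` and shows that this span is the graph of a linear map. It projects onto
`T` by `WittRep.mem_span_image_fil`. An element over `0` is pushed down through every filtration
step by `WittRep.mem_graphSpan_succ`, so it vanishes. Uniqueness on charts then lets the local
extensions glue. -/

section RegularLocal

/-! ### Regular local rings are domains; regular noetherian domains are determined in height one. -/

open IsLocalRing

variable {R : Type u} [CommRing R]

/-- Since `x` is nonzero in the cotangent space, it belongs to a minimal system of generators of the
maximal ideal. Modulo `x` one generator disappears while the dimension drops by at most one, so the
quotient is again regular. -/
theorem IsRegularLocalRing.quotient_span_singleton [IsRegularLocalRing R] {x : R}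
    (hx : x ∈ maximalIdeal R) (hx2 : x ∉ maximalIdeal R ^ 2) :
    ∃ _ : IsRegularLocalRing (R ⧸ Ideal.span {x}),
      (maximalIdeal (R ⧸ Ideal.span {x})).spanFinrank < (maximalIdeal R).spanFinrank := by
  classical
  have hne : Ideal.span {x} ≠ ⊤ := fun h =>
    (maximalIdeal.isMaximal R).ne_top (top_le_iff.mp (h ▸ (Ideal.span_singleton_le_iff_mem _).mpr hx))
  have : Nontrivial (R ⧸ Ideal.span {x}) := Ideal.Quotient.nontrivial_iff.mpr hne
  have hloc : IsLocalRing (R ⧸ Ideal.span {x}) :=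
    IsLocalRing.of_surjective' (Ideal.Quotient.mk _) Ideal.Quotient.mk_surjective
  let v : CotangentSpace R := (maximalIdeal R).toCotangent ⟨x, hx⟩
  have hv : v ≠ 0 := fun h => hx2 ((Ideal.toCotangent_eq_zero _ _).mp h)
  have hli : LinearIndepOn (ResidueField R) id {v} := LinearIndepOn.singleton hv
  let b := Module.Basis.extend hli
  let T := hli.extend (Set.subset_univ _)
  have hvT : v ∈ T := hli.subset_extend _ rfl
  have : Finite T := Module.Finite.finite_basis b
  have hTfin : T.Finite := Set.toFinite T
  have hTcard : T.ncard = (maximalIdeal R).spanFinrank := by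
    rw [IsLocalRing.spanFinrank_maximalIdeal_eq_finrank_cotangentSpace,
      Module.finrank_eq_nat_card_basis b]
    rfl
  -- A set-theoretic section of the projection to the cotangent space, adjusted so that the class of
  -- `x` lifts to `x` itself. By Nakayama the lifts of a basis generate the maximal ideal.
  let σ : CotangentSpace R → maximalIdeal R := Function.update
    (Function.surjInv (maximalIdeal R).toCotangent_surjective) v ⟨x, hx⟩
  have hσ : ∀ w, (maximalIdeal R).toCotangent (σ w) = w := by
    intro w
    by_cases hw : w = v
    · subst hw; simp [σ, v]
    · simp only [σ, Function.update_of_ne hw]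
      exact Function.surjInv_eq _ _
  have hspan : Submodule.span R (σ '' T) = ⊤ := by
    rw [← CotangentSpace.span_image_eq_top_iff, ← Set.image_comp]
    have : ((maximalIdeal R).toCotangent ∘ σ) = id := funext hσ
    have hb := b.span_eq
    rw [Module.Basis.range_extend] at hb
    rw [this, Set.image_id]
    exact hb
  have hm : maximalIdeal R = Ideal.span ((fun w => (σ w : R)) '' T) := by
    have := congrArg (Submodule.map (maximalIdeal R).subtype) hspan
    rw [Submodule.map_span, Submodule.map_top, Submodule.range_subtype, ← Set.image_comp] at this
    exact this.symm
  let π := Ideal.Quotient.mk (Ideal.span {x})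
  have hm' : maximalIdeal (R ⧸ Ideal.span {x}) =
      Ideal.span ((fun w => π (σ w : R)) '' (T \ {v})) := by
    have h1 : maximalIdeal (R ⧸ Ideal.span {x}) = (maximalIdeal R).map π :=
      (IsLocalRing.map_maximalIdeal_of_surjective π Ideal.Quotient.mk_surjective).symm
    rw [h1, congrArg (Ideal.map π) hm, Ideal.map_span, ← Set.image_comp]
    refine le_antisymm ?_ (Ideal.span_mono (Set.image_mono Set.sdiff_subset))
    rw [Ideal.span_le]
    rintro _ ⟨w, hw, rfl⟩
    by_cases hwv : w = v
    · have : π (σ w : R) = 0 := by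
        rw [Ideal.Quotient.eq_zero_iff_mem, hwv]
        simp [σ]
      simp [this]
    · exact Ideal.subset_span ⟨w, ⟨hw, hwv⟩, rfl⟩
  have hle : (maximalIdeal (R ⧸ Ideal.span {x})).spanFinrank + 1 ≤ (maximalIdeal R).spanFinrank := by
    rw [← hTcard, ← Set.ncard_sdiff_singleton_add_one hvT hTfin, hm']
    exact Nat.add_le_add_right ((Submodule.spanFinrank_span_le_ncard_of_finite
      ((hTfin.sdiff).image _)).trans (Set.ncard_image_le hTfin.sdiff)) 1
  have hdim : ringKrullDim R ≤ ringKrullDim (R ⧸ Ideal.span {x}) + 1 := by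
    rw [← maximalIdeal_height_eq_ringKrullDim]
    exact Ideal.height_le_ringKrullDim_quotient_add_one hx
  refine ⟨IsRegularLocalRing.of_spanFinrank_maximalIdeal_le _ ?_, hle⟩
  have hr := (isRegularLocalRing_iff R).mp ‹_›
  rw [← hr] at hdim
  have h1 : (((maximalIdeal (R ⧸ Ideal.span {x})).spanFinrank : ℕ) : WithBot ℕ∞) + 1 ≤
      ringKrullDim (R ⧸ Ideal.span {x}) + 1 := le_trans (by exact_mod_cast hle) hdim
  exact ENat.WithBot.add_le_add_one_right_iff.mp h1

theorem IsRegularLocalRing.isField_of_le_sq [IsRegularLocalRing R]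
    (h : maximalIdeal R ≤ maximalIdeal R ^ 2) : maximalIdeal R = ⊥ := by
  refine Submodule.eq_bot_of_le_smul_of_le_jacobson_bot (maximalIdeal R) _
    (IsNoetherian.noetherian _) ?_ (IsLocalRing.jacobson_eq_maximalIdeal _ bot_ne_top).ge
  rwa [smul_eq_mul, ← pow_two]

/-- Induction on the embedding dimension. Choose `x` in the maximal ideal `m`, outside `m ^ 2` and
outside every minimal prime. By induction `(x)` is prime, so it contains a minimal prime `Q`. As `x
∉ Q`, every element of `Q` is `x` times an element of `Q`, and Nakayama gives `Q = 0`. -/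
theorem IsRegularLocalRing.isDomain (R : Type u) [CommRing R] [IsRegularLocalRing R] :
    IsDomain R := by
  induction hn : (maximalIdeal R).spanFinrank using Nat.strong_induction_on generalizing R with
  | _ n ih =>
  by_cases hbot : maximalIdeal R = ⊥
  · exact ((isField_iff_maximalIdeal_eq).mpr hbot).isDomain
  have hex : ∃ x ∈ maximalIdeal R, x ∉ maximalIdeal R ^ 2 ∧ ∀ Q ∈ minimalPrimes R, x ∉ Q := by
    by_contra! H
    classical
    have hfin := minimalPrimes.finite_of_isNoetherianRing R
    -- Prime avoidance tolerates two ideals that are not prime; both exceptional slots are filled by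
    -- the square of the maximal ideal.
    have h1 := (Ideal.subset_union_prime (s := insert (maximalIdeal R ^ 2) hfin.toFinset)
      (f := id) (I := maximalIdeal R) (maximalIdeal R ^ 2) (maximalIdeal R ^ 2) (by
        intro i hi hne _
        rcases Finset.mem_insert.mp hi with h | h
        · exact absurd h hne
        · exact ((Set.Finite.mem_toFinset _).mp h).1.1)).mp (by
        intro x hx
        simp only [Finset.coe_insert, Set.Finite.coe_toFinset, id, Set.mem_iUnion]
        by_cases h2 : x ∈ maximalIdeal R ^ 2
        · exact ⟨_, Set.mem_insert _ _, h2⟩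
        · obtain ⟨Q, hQ, hxQ⟩ := H x hx h2
          exact ⟨Q, Set.mem_insert_of_mem _ hQ, hxQ⟩)
    obtain ⟨I, hI, hle⟩ := h1
    rcases Finset.mem_insert.mp hI with rfl | h
    · exact hbot (isField_of_le_sq hle)
    · have hQ := (Set.Finite.mem_toFinset _).mp h
      have hQp : I.IsPrime := hQ.1.1
      have hmin : maximalIdeal R ∈ minimalPrimes R := by
        rwa [le_antisymm hle (le_maximalIdeal hQp.ne_top)]
      have h0 : (maximalIdeal R).height = 0 := by
        exact Ideal.height_eq_zero_iff.mpr hmin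
      have h2 := (isRegularLocalRing_iff R).mp ‹_›
      rw [← maximalIdeal_height_eq_ringKrullDim, h0] at h2
      have h3 : (maximalIdeal R).spanFinrank = 0 := by exact_mod_cast h2
      exact hbot ((Submodule.spanFinrank_eq_zero_iff_eq_bot (IsNoetherian.noetherian _)).mp h3)
  obtain ⟨x, hx, hx2, hxQ⟩ := hex
  obtain ⟨hreg, hlt⟩ := IsRegularLocalRing.quotient_span_singleton hx hx2
  have hdom := ih _ (hn ▸ hlt) (R ⧸ Ideal.span {x}) rfl
  have hprime : (Ideal.span {x}).IsPrime := (Ideal.Quotient.isDomain_iff_prime _).mp hdom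
  obtain ⟨Q, hQ, hQx⟩ := Ideal.exists_minimalPrimes_le (I := ⊥) (J := Ideal.span {x}) bot_le
  have hQp : Q.IsPrime := hQ.1.1
  have hQ0 : Q = ⊥ := by
    refine Submodule.eq_bot_of_le_smul_of_le_jacobson_bot (maximalIdeal R) _
      (IsNoetherian.noetherian _) ?_ (IsLocalRing.jacobson_eq_maximalIdeal _ bot_ne_top).ge
    intro y hy
    obtain ⟨z, rfl⟩ := Ideal.mem_span_singleton.mp (hQx hy)
    exact Submodule.smul_mem_smul hx ((hQp.mem_or_mem hy).resolve_left (hxQ Q hQ))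
  subst hQ0
  exact IsDomain.of_bot_isPrime R

/-- In a regular local ring, the maximal ideal is associated to a principal ideal only if it is
principal. -/
theorem IsRegularLocalRing.maximalIdeal_isPrincipal_of_dvd [IsRegularLocalRing R] {a b : R}
    (h : ∀ z ∈ maximalIdeal R, a ∣ z * b) (hab : ¬ a ∣ b) :
    (maximalIdeal R).IsPrincipal := by
  have hdomR := IsRegularLocalRing.isDomain R
  by_cases hle : maximalIdeal R ≤ maximalIdeal R ^ 2
  · rw [isField_of_le_sq hle]; infer_instance
  obtain ⟨x, hx, hx2⟩ := SetLike.not_le_iff_exists.mp hle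
  obtain ⟨hreg, -⟩ := IsRegularLocalRing.quotient_span_singleton hx hx2
  have hdom := IsRegularLocalRing.isDomain (R ⧸ Ideal.span {x})
  have hprime : (Ideal.span {x}).IsPrime := (Ideal.Quotient.isDomain_iff_prime _).mp hdom
  have hx0 : x ≠ 0 := by rintro rfl; exact hx2 (zero_mem _)
  have ha : a ≠ 0 := by
    rintro rfl
    have := h x hx
    rw [zero_dvd_iff] at this hab
    exact (mul_ne_zero hx0 hab) this
  -- Write `x b = a c`. If `x` divided `c`, then `a` would divide `b`. For `y` in the maximal ideal,
  -- cancelling `a` gives `y c ∈ (x)`, and primality of `(x)` forces `y ∈ (x)`.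
  obtain ⟨c, hc⟩ := h x hx
  have hcx : c ∉ Ideal.span {x} := by
    intro hc'
    obtain ⟨c', rfl⟩ := Ideal.mem_span_singleton.mp hc'
    exact hab ⟨c', mul_left_cancel₀ hx0 (by rw [hc]; ring)⟩
  refine ⟨x, le_antisymm (fun y hy => ?_) ((Ideal.span_singleton_le_iff_mem _).mpr hx)⟩
  obtain ⟨d, hd⟩ := h y hy
  have h1 : y * c ∈ Ideal.span {x} := by
    refine Ideal.mem_span_singleton.mpr ⟨d, mul_left_cancel₀ ha ?_⟩
    calc a * (y * c) = y * (a * c) := by ring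
      _ = x * (y * b) := by rw [← hc]; ring
      _ = a * (x * d) := by rw [hd]; ring
  exact (hprime.mem_or_mem h1).resolve_right hcx

/-- A noetherian domain with regular local rings is the intersection of its localizations at
primes of height one. -/
theorem mem_range_algebraMap_of_height_one {A K : Type u} [CommRing A] [IsDomain A]
    [IsNoetherianRing A] [Field K] [Algebra A K] [IsFractionRing A K]
    (hreg : ∀ (P : Ideal A) [P.IsPrime], IsRegularLocalRing (Localization.AtPrime P)) (r : K)
    (h : ∀ (P : Ideal A), P.IsPrime → P.height = 1 → ∃ s ∉ P, ∃ a,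
      r * algebraMap A K s = algebraMap A K a) :
    r ∈ Set.range (algebraMap A K) := by
  obtain ⟨b, a, ha, rfl⟩ := IsFractionRing.div_surjective (A := A) r
  have ha0 : a ≠ 0 := nonZeroDivisors.ne_zero ha
  have haK : algebraMap A K a ≠ 0 := by simpa using ha0
  have key : ∀ s e : A, algebraMap A K b / algebraMap A K a * algebraMap A K s =
      algebraMap A K e ↔ s * b = a * e := by
    intro s e
    rw [div_mul_eq_mul_div, div_eq_iff haK, ← map_mul, ← map_mul,
      (IsFractionRing.injective A K).eq_iff, mul_comm b, mul_comm e]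
  simp only [key] at h
  by_contra hr
  have hab : ¬ a ∣ b := by
    rintro ⟨e, rfl⟩
    exact hr ⟨e, by rw [map_mul, mul_div_cancel_left₀ _ haK]⟩
  -- The ideal of denominators of `b / a`. If `b / a` is not in `A`, then `A ⧸ I` is nonzero and has
  -- an associated prime `P`.
  let I : Ideal A := Submodule.comap (LinearMap.mulRight A b) (Ideal.span {a})
  have hI : ∀ y, y ∈ I ↔ a ∣ y * b := fun y => Ideal.mem_span_singleton
  have hI1 : (1 : A ⧸ I) ≠ 0 := by
    rw [← map_one (Ideal.Quotient.mk I), Ne, Ideal.Quotient.eq_zero_iff_mem, hI, one_mul]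
    exact hab
  obtain ⟨P, hP, -⟩ := exists_le_isAssociatedPrime_of_isNoetherianRing A (1 : A ⧸ I) hI1
  obtain ⟨hPp, m, hPm⟩ := isAssociatedPrime_iff.mp hP
  obtain ⟨c, rfl⟩ := Ideal.Quotient.mk_surjective m
  have hPc : ∀ y, y ∈ P ↔ a ∣ y * (c * b) := by
    intro y
    rw [hPm, Submodule.mem_colon_singleton, Submodule.mem_bot, Algebra.smul_def,
      Ideal.Quotient.algebraMap_eq, ← map_mul, Ideal.Quotient.eq_zero_iff_mem, hI, mul_assoc]
  let R := Localization.AtPrime P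
  have := hreg P
  -- At `P` the maximal ideal is a colon of principal ideals, hence principal, so `P` has height
  -- one. The hypothesis then provides a denominator outside `P`, which contradicts the choice of
  -- `P`.
  have hprin : (maximalIdeal R).IsPrincipal := by
    refine IsRegularLocalRing.maximalIdeal_isPrincipal_of_dvd (a := algebraMap A R a)
      (b := algebraMap A R (c * b)) (fun z hz => ?_) ?_
    · obtain ⟨y, s, rfl⟩ := IsLocalization.exists_mk'_eq P.primeCompl z
      have hy : y ∈ P := (IsLocalization.AtPrime.mk'_mem_maximal_iff R P y s).mp hz
      obtain ⟨e, he⟩ := (hPc y).mp hy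
      refine ⟨IsLocalization.mk' R e s, ?_⟩
      rw [mul_comm, IsLocalization.mul_mk'_eq_mk'_of_mul, IsLocalization.mul_mk'_eq_mk'_of_mul,
        mul_comm (c * b), he]
    · rintro ⟨z, hz⟩
      obtain ⟨y, s, rfl⟩ := IsLocalization.exists_mk'_eq P.primeCompl z
      rw [IsLocalization.mul_mk'_eq_mk'_of_mul, IsLocalization.eq_mk'_iff_mul_eq, ← map_mul,
        (IsLocalization.injective R P.primeCompl_le_nonZeroDivisors).eq_iff] at hz
      exact s.2 ((hPc s).mpr ⟨y, by rw [mul_comm, hz]⟩)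
  have hP0 : P ≠ ⊥ := by
    rintro rfl
    have := (hPc a).mpr (dvd_mul_right _ _)
    exact ha0 (by simpa using this)
  have hht : P.height = 1 := by
    refine le_antisymm ?_ (Order.one_le_iff_ne_zero.mpr fun h0 => hP0 ?_)
    · rw [← IsLocalization.AtPrime.under_maximalIdeal R P, IsLocalization.height_under P.primeCompl]
      exact Ideal.height_le_one_of_isPrincipal_of_mem_minimalPrimes (maximalIdeal R) _
        (by rw [Ideal.minimalPrimes_eq_subsingleton_self]; rfl)
    · rw [Ideal.height_eq_zero_iff, IsDomain.minimalPrimes_eq_singleton_bot] at h0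
      exact h0
  obtain ⟨s, hs, e, he⟩ := h P hPp hht
  exact hs ((hPc s).mpr ⟨c * e, by rw [mul_left_comm, he]; ring⟩)

end RegularLocal

/-! ### The relative Frobenius of an étale algebra is an isomorphism. -/

section RelativeFrobenius

open TensorProduct

/-- An unramified algebra of finite type in which `q`-th powers come from the base ring is a
quotient of the base ring. -/
theorem Algebra.FormallyUnramified.surjective_of_pow_mem_range {C D : Type*} [CommRing C]
    [CommRing D] [Algebra C D] [Algebra.FiniteType C D] [Algebra.FormallyUnramified C D]
    {p : ℕ} [hp : Fact p.Prime] [CharP D p] (j : ℕ)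
    (h : ∀ d : D, ∃ c : C, algebraMap C D c = d ^ p ^ j) :
    Function.Surjective (algebraMap C D) := by
  have hpos : 0 < p ^ j := pow_pos hp.out.pos j
  have hint : Algebra.IsIntegral C D := ⟨fun d => by
    obtain ⟨c, hc⟩ := h d
    exact IsIntegral.of_pow hpos (hc ▸ isIntegral_algebraMap)⟩
  have hfin : Module.Finite C D := Algebra.IsIntegral.finite
  -- The kernel of multiplication is generated by the differences of `1 ⊗ d` and `d ⊗ 1`. Their `p ^
  -- j`-th powers vanish because `d ^ p ^ j` comes from `C`.
  have hnil : ∀ x ∈ KaehlerDifferential.ideal C D, IsNilpotent x := by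
    intro x hx
    rw [← KaehlerDifferential.span_range_eq_ideal] at hx
    refine mem_nilradical.mp ((Ideal.span_le.mpr ?_ : _ ≤ nilradical _) hx)
    rintro _ ⟨d, rfl⟩
    obtain ⟨c, hc⟩ := h d
    refine mem_nilradical.mpr ⟨p ^ j, ?_⟩
    rcases subsingleton_or_nontrivial (D ⊗[C] D) with h1 | h1
    · exact Subsingleton.elim _ _
    · have : CharP (D ⊗[C] D) p := (CharP.charP_iff_prime_eq_zero hp.out).mpr (by
        rw [← map_natCast (Algebra.TensorProduct.includeLeft : D →ₐ[C] D ⊗[C] D), CharP.cast_eq_zero,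
          map_zero])
      rw [sub_pow_char_pow, Algebra.TensorProduct.tmul_pow, Algebra.TensorProduct.tmul_pow, one_pow,
        ← hc, sub_eq_zero, Algebra.algebraMap_eq_smul_one, TensorProduct.tmul_smul,
        TensorProduct.smul_tmul']
  -- The element `t` witnesses unramifiedness: multiplication sends it to `1`, and it annihilates
  -- the kernel of multiplication. Here `1 - t` is nilpotent, so `t` is a unit and that kernel is
  -- zero. Thus `C → D` is a finite epimorphism, hence surjective.
  let t := Algebra.FormallyUnramified.elem C D
  have ht : IsUnit t := by
    have h1 : 1 - t ∈ KaehlerDifferential.ideal C D := by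
      rw [RingHom.mem_ker, map_sub, map_one]
      exact sub_eq_zero.mpr (Algebra.FormallyUnramified.lmul_elem (R := C) (S := D)).symm
    simpa using (hnil _ h1).isUnit_one_sub
  refine Algebra.isEpi_iff_surjective_algebraMap_of_finite.mp
    ((Algebra.isEpi_iff_forall_one_tmul_eq C D).mpr fun d => ?_)
  exact ht.mul_left_injective (Algebra.FormallyUnramified.one_tmul_mul_elem (R := C) (S := D) d)

/-- A homomorphism of étale algebras of finite type over a noetherian ring is bijective if it is
surjective and its kernel consists of nilpotent elements. -/
theorem Algebra.Etale.injective_of_surjective_of_isNilpotent {R C D : Type*} [CommRing R]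
    [CommRing C] [CommRing D] [IsNoetherianRing R] [Algebra R C] [Algebra R D] [Algebra.Etale R C]
    [Algebra.Etale R D] (φ : C →ₐ[R] D) (hs : Function.Surjective φ)
    (hn : ∀ c, φ c = 0 → IsNilpotent c) : Function.Injective φ := by
  have : IsNoetherianRing C := Algebra.FiniteType.isNoetherianRing R C
  have hk : IsNilpotent (RingHom.ker (φ : C →+* D)) := by
    rw [Ideal.FG.isNilpotent_iff_le_nilradical (IsNoetherian.noetherian _)]
    exact fun c hc => mem_nilradical.mpr (hn c hc)
  -- Formal smoothness of `D` gives a section of `φ`. The composite `s ∘ φ` agrees with the identity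
  -- modulo the nilpotent kernel, so formal unramifiedness of `C` makes them equal.
  let s : D →ₐ[R] C := Algebra.FormallySmooth.liftOfSurjective (AlgHom.id R D) φ hs hk
  have h1 : s.comp φ = AlgHom.id R C := by
    refine Algebra.FormallyUnramified.ext' (φ : C →+* D) hk _ _ fun x => ?_
    exact Algebra.FormallySmooth.liftOfSurjective_apply (AlgHom.id R D) φ hs hk (φ x)
  exact Function.LeftInverse.injective (g := s) fun x => DFunLike.congr_fun h1 x

/-- An abelian group with scalar multiplication twisted by the `j`-th iterate of the Frobenius. -/
def FrobTwist (_p _j : ℕ) (M : Type*) := M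

namespace FrobTwist

variable (p j : ℕ)

instance (M : Type*) [AddCommGroup M] : AddCommGroup (FrobTwist p j M) := inferInstanceAs (AddCommGroup M)

instance (R : Type*) [CommRing R] : CommRing (FrobTwist p j R) := inferInstanceAs (CommRing R)

instance (R M : Type*) [CommRing R] [AddCommGroup M] [Module R M] :
    Module (FrobTwist p j R) (FrobTwist p j M) := inferInstanceAs (Module R M)

instance (R S : Type*) [CommRing R] [CommRing S] [Algebra R S] :
    Algebra (FrobTwist p j R) (FrobTwist p j S) := inferInstanceAs (Algebra R S)

variable [hp : Fact p.Prime]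

/-- The low priority favours the untwisted action whenever the scalars are themselves a `FrobTwist`
ring. -/
instance (priority := low) module (R M : Type*) [CommRing R] [CharP R p] [AddCommGroup M] [Module R M] :
    Module R (FrobTwist p j M) :=
  show Module R M from Module.compHom M (iterateFrobenius R p j)

/-- The identity map to the twisted group. -/
def of (M : Type*) [AddCommGroup M] : M ≃+ FrobTwist p j M := AddEquiv.refl M

theorem smul_of {R M : Type*} [CommRing R] [CharP R p] [AddCommGroup M] [Module R M] (r : R)
    (m : M) : r • of p j M m = of p j M (r ^ p ^ j • m) := rfl

instance algebra (R S : Type*) [CommRing R] [CharP R p] [CommRing S] [Algebra R S] :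
    Algebra R (FrobTwist p j S) where
  algebraMap := (algebraMap R S).comp (iterateFrobenius R p j)
  commutes' _ _ := mul_comm (G := S) _ _
  smul_def' r x := Algebra.smul_def (A := S) (r ^ p ^ j) x

instance (R S : Type*) [CommRing R] [CharP R p] [CommRing S] [Algebra R S] (M : Type*)
    [AddCommGroup M] [Module R M] [Module S M] [IsScalarTower R S M] :
    IsScalarTower R (FrobTwist p j S) (FrobTwist p j M) :=
  ⟨fun r s m => smul_assoc (N := S) (α := M) (r ^ p ^ j) s m⟩

instance (R S : Type*) [CommRing R] [CharP R p] [CommRing S] [CharP S p] [Algebra R S] (M : Type*)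
    [AddCommGroup M] [Module R M] [Module S M] [IsScalarTower R S M] :
    IsScalarTower R S (FrobTwist p j M) :=
  ⟨fun r s m => by
    change (r • s) ^ p ^ j • (show M from m) = r ^ p ^ j • s ^ p ^ j • (show M from m)
    rw [smul_pow, smul_assoc]⟩

instance (R S : Type*) [CommRing R] [CharP R p] [CommRing S] [Algebra R S] :
    IsScalarTower R (FrobTwist p j R) (FrobTwist p j S) :=
  IsScalarTower.of_algebraMap_eq fun _ => rfl

instance (R S : Type*) [CommRing R] [CharP R p] [CommRing S] [CharP S p] [Algebra R S] :
    IsScalarTower R S (FrobTwist p j S) :=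
  IsScalarTower.of_algebraMap_eq fun r => map_pow (algebraMap R S) r (p ^ j)

/-- The comparison map `φ` from the tensor product is unramified of finite type, and its image
contains all `p ^ j`-th powers, so it is surjective. Its kernel is nilpotent by `hfp`. A surjection
of étale algebras with nilpotent kernel is bijective. -/
theorem isPushout {A B : Type*} [CommRing A] [CommRing B] [IsNoetherianRing A] [CharP A p]
    [CharP B p] [Algebra A B] [Algebra.Etale A B] :
    Algebra.IsPushout A (FrobTwist p j A) B (FrobTwist p j B) := by
  have hN : IsNoetherianRing (FrobTwist p j A) := inferInstanceAs (IsNoetherianRing A)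
  have hE : Algebra.Etale (FrobTwist p j A) (FrobTwist p j B) := inferInstanceAs (Algebra.Etale A B)
  let φ : FrobTwist p j A ⊗[A] B →ₐ[FrobTwist p j A] FrobTwist p j B :=
    Algebra.TensorProduct.lift (Algebra.ofId _ _) (IsScalarTower.toAlgHom A B _)
      fun _ _ => Commute.all _ _
  have hφ : ∀ (a : FrobTwist p j A) (b : B), φ (a ⊗ₜ b) =
      algebraMap (FrobTwist p j A) (FrobTwist p j B) a * algebraMap B (FrobTwist p j B) b :=
    fun a b => Algebra.TensorProduct.lift_tmul ..
  -- The power `x ^ p ^ j` depends only on `φ x`, because Frobenius factors through the relative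
  -- Frobenius. In particular it vanishes on the kernel of `φ`.
  have hfp : ∀ x : FrobTwist p j A ⊗[A] B, x ^ p ^ j =
      Algebra.TensorProduct.includeRight (R := A) (A := FrobTwist p j A) ((show B from φ x)) := by
    intro x
    rcases subsingleton_or_nontrivial (FrobTwist p j A ⊗[A] B) with h1 | h1
    · exact Subsingleton.elim _ _
    have : CharP (FrobTwist p j A ⊗[A] B) p := (CharP.charP_iff_prime_eq_zero hp.out).mpr (by
        rw [← map_natCast (algebraMap A (FrobTwist p j A ⊗[A] B)), CharP.cast_eq_zero, map_zero])
    induction x using TensorProduct.induction_on with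
    | zero =>
      rw [map_zero, zero_pow (pow_pos hp.out.pos j).ne']
      exact (map_zero _).symm
    | add x y hx hy =>
      rw [add_pow_char_pow, hx, hy, map_add]
      exact (map_add (Algebra.TensorProduct.includeRight (R := A) (A := FrobTwist p j A) (B := B))
        _ _).symm
    | tmul a b =>
      have h2 : (show B from φ (a ⊗ₜ b)) = (show A from a) • b ^ p ^ j := by
        rw [hφ, Algebra.smul_def]; rfl
      have h3 : (show A from a) • (1 : FrobTwist p j A) = a ^ p ^ j := by
        rw [Algebra.smul_def, mul_one]; rfl
      rw [h2, Algebra.TensorProduct.includeRight_apply, TensorProduct.tmul_smul,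
        TensorProduct.smul_tmul', h3, Algebra.TensorProduct.tmul_pow]
  have hs : Function.Surjective φ := by
    algebraize [φ.toRingHom]
    have : IsScalarTower (FrobTwist p j A) (FrobTwist p j A ⊗[A] B) (FrobTwist p j B) :=
      IsScalarTower.of_algebraMap_eq fun x => (φ.commutes x).symm
    have : Algebra.FormallyUnramified (FrobTwist p j A ⊗[A] B) (FrobTwist p j B) :=
      Algebra.FormallyUnramified.of_restrictScalars (FrobTwist p j A) _ _
    have : Algebra.FiniteType (FrobTwist p j A ⊗[A] B) (FrobTwist p j B) :=
      Algebra.FiniteType.of_restrictScalars_finiteType (FrobTwist p j A) _ _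
    have : CharP (FrobTwist p j B) p := inferInstanceAs (CharP B p)
    refine Algebra.FormallyUnramified.surjective_of_pow_mem_range (p := p) j fun d => ?_
    refine ⟨1 ⊗ₜ (show B from d), ?_⟩
    change φ _ = _
    rw [hφ, map_one, one_mul]
    rfl
  have hi : Function.Injective φ := by
    refine Algebra.Etale.injective_of_surjective_of_isNilpotent φ hs fun c hc => ⟨p ^ j, ?_⟩
    rw [hfp, hc]
    exact map_zero _
  refine ⟨IsBaseChange.of_equiv (AlgEquiv.ofBijective φ ⟨hi, hs⟩).toLinearEquiv fun b => ?_⟩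
  change φ _ = _
  rw [hφ, map_one, one_mul]
  rfl

variable {A B M N : Type*} [CommRing A] [CommRing B] [CharP A p]
  [CharP B p] [Algebra A B] [AddCommGroup M] [Module A M] [AddCommGroup N]
  [Module A N] [Module B N] [IsScalarTower A B N]

/-- A linear map, viewed as a map of twisted modules. -/
def map (f : M →ₗ[A] N) : FrobTwist p j M →ₗ[A] FrobTwist p j N where
  toFun := f
  map_add' := f.map_add
  map_smul' a m := f.map_smul (a ^ p ^ j) m

/-- The twisted `N` is the base change of the twisted `M` from twisted `A` to twisted `B`. The
pushout square replaces this base change by the one from `A` to `B`. -/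
theorem isBaseChange_map [IsNoetherianRing A] [Algebra.Etale A B] {f : M →ₗ[A] N}
    (hf : IsBaseChange B f) :
    IsBaseChange B (FrobTwist.map p j f) := by
  have := FrobTwist.isPushout (A := A) (B := B) p j
  have hpush : Algebra.IsPushout A B (FrobTwist p j A) (FrobTwist p j B) := this.symm
  let g : FrobTwist p j M →ₗ[FrobTwist p j A] FrobTwist p j N := f
  have : IsScalarTower (FrobTwist p j A) (FrobTwist p j B) (FrobTwist p j N) :=
    inferInstanceAs (IsScalarTower A B N)
  have hg : IsBaseChange (FrobTwist p j B) g := hf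
  have : IsScalarTower B (FrobTwist p j B) (FrobTwist p j N) := inferInstance
  refine IsBaseChange.of_equiv ((Algebra.IsPushout.cancelBaseChange A B (FrobTwist p j A)
    (FrobTwist p j B) (FrobTwist p j M)).symm ≪≫ₗ hg.equiv.restrictScalars B) fun m => ?_
  rw [LinearEquiv.trans_apply, Algebra.IsPushout.cancelBaseChange_symm_tmul, map_one]
  exact (hg.equiv_tmul 1 m).trans (one_smul _ _)

end FrobTwist
end RelativeFrobenius

/-! ### Divisorial modules as colons, their flat base change, and Krull domains. -/

section Divisorial

/-- The `A`-submodule of `K` of all `x` with `x y ∈ A` for all `y` in `J`. -/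
def integralColon (A : Type*) {K : Type*} [CommRing A] [CommRing K] [Algebra A K] (J : Set K) :
    Submodule A K where
  carrier := {x | ∀ y ∈ J, x * y ∈ LinearMap.range (Algebra.linearMap A K)}
  zero_mem' y _ := by rw [zero_mul]; exact zero_mem _
  add_mem' hx hx' y hy := by rw [add_mul]; exact add_mem (hx y hy) (hx' y hy)
  smul_mem' a x hx y hy := by rw [smul_mul_assoc]; exact Submodule.smul_mem _ _ (hx y hy)

/-- The colon is the kernel of `K → ∏ K ⧸ A`, `x ↦ (x y)_y`, over the finite set `J`. Base change
turns `K ⧸ A` into `L ⧸ B` by right exactness, commutes with the finite product, and preserves the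
kernel by flatness. -/
theorem isBaseChange_integralColon {A B K L : Type*} [CommRing A] [CommRing B] [CommRing K]
    [CommRing L] [Algebra A B] [Algebra A K] [Algebra B L] [Algebra K L] [Algebra A L]
    [IsScalarTower A B L] [IsScalarTower A K L] [Module.Flat A B] [FaithfulSMul B L]
    [FaithfulSMul A K] [hpush : Algebra.IsPushout A B K L] {J : Set K} (hJ : J.Finite)
    (h : integralColon A J →ₗ[A] integralColon B (algebraMap K L '' J))
    (hh : ∀ x, (h x : L) = algebraMap K L x) : IsBaseChange B h := by
  have : Finite J := hJ
  let i : K →ₗ[A] L := (IsScalarTower.toAlgHom A K L).toLinearMap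
  have hi : IsBaseChange B i := hpush.out
  let A' := LinearMap.range (Algebra.linearMap A K)
  let B' := LinearMap.range (Algebra.linearMap B L)
  have hcomp : A' ≤ (B'.restrictScalars A).comap i := by
    rintro _ ⟨a, rfl⟩
    exact ⟨algebraMap A B a, by
      simp [i, ← IsScalarTower.algebraMap_apply]⟩
  let iq : (K ⧸ A') →ₗ[A] (L ⧸ B') := Submodule.mapQ A' (B'.restrictScalars A) i hcomp
  have hiq : IsBaseChange B iq := by
    refine IsBaseChange.of_right_exact B (Algebra.linearMap A B) i iq
      (f := Algebra.linearMap A K) (g := A'.mkQ) (f' := Algebra.linearMap B L) (g' := B'.mkQ)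
      ?_ ?_ (IsBaseChange.linearMap A B) hi ?_ A'.mkQ_surjective ?_ B'.mkQ_surjective
    · ext; simp [i]
    · rfl
    · exact LinearMap.exact_iff.mpr (by simp [A'])
    · exact LinearMap.exact_iff.mpr (by simp [B'])
  let g : K →ₗ[A] (J → K ⧸ A') := LinearMap.pi fun y => A'.mkQ ∘ₗ LinearMap.mulRight A (y : K)
  let g' : L →ₗ[B] (J → L ⧸ B') :=
    LinearMap.pi fun y => B'.mkQ ∘ₗ LinearMap.mulRight B (algebraMap K L y)
  refine IsBaseChange.of_left_exact B h i (iq.compLeft J) (f := (integralColon A J).subtype)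
    (g := g) (f' := (integralColon B _).subtype) (g' := g') ?_ ?_ hi (hiq.finitePow J) ?_
    (Submodule.injective_subtype _) ?_ (Submodule.injective_subtype _)
  · ext x; exact (hh x).symm
  · ext x y
    change Submodule.Quotient.mk (algebraMap K L (x * y)) =
      Submodule.Quotient.mk (algebraMap K L x * algebraMap K L y)
    rw [map_mul]
  · refine LinearMap.exact_iff.mpr ?_
    rw [Submodule.range_subtype]
    ext x
    simp only [LinearMap.mem_ker, funext_iff, g, LinearMap.pi_apply, LinearMap.comp_apply,
      Submodule.mkQ_apply, Pi.zero_apply, Submodule.Quotient.mk_eq_zero, LinearMap.mulRight_apply,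
      Subtype.forall]
    rfl
  · refine LinearMap.exact_iff.mpr ?_
    rw [Submodule.range_subtype]
    ext x
    simp only [LinearMap.mem_ker, funext_iff, g', LinearMap.pi_apply, LinearMap.comp_apply,
      Submodule.mkQ_apply, Pi.zero_apply, Submodule.Quotient.mk_eq_zero, LinearMap.mulRight_apply,
      Subtype.forall]
    exact (Set.forall_mem_image (f := algebraMap K L) (s := J)
      (p := fun y => x * y ∈ LinearMap.range (Algebra.linearMap B L))).symm

/-- A family of additive valuations exhibiting `A` as a Krull domain with fraction field `K`. -/
structure KrullFamily (A : Type*) {K P : Type*} [CommRing A] [Field K] [Algebra A K]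
    (v : P → K → ℤ) : Prop where
  map_mul (η : P) {x y : K} : x ≠ 0 → y ≠ 0 → v η (x * y) = v η x + v η y
  nonneg (η : P) {a : A} : algebraMap A K a ≠ 0 → 0 ≤ v η (algebraMap A K a)
  mem_range {x : K} : x ≠ 0 → (∀ η, 0 ≤ v η x) → x ∈ Set.range (algebraMap A K)
  finite_support {x : K} : x ≠ 0 → {η | v η x ≠ 0}.Finite
  exists_separating {η η' : P} : η ≠ η' →
    ∃ a : A, algebraMap A K a ≠ 0 ∧ v η (algebraMap A K a) = 0 ∧ 0 < v η' (algebraMap A K a)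
  surjective (η : P) (m : ℤ) : ∃ x : K, x ≠ 0 ∧ v η x = m

namespace KrullFamily

variable {A K P : Type*} [CommRing A] [Field K] [Algebra A K] {v : P → K → ℤ}

theorem map_one (h : KrullFamily A v) (η : P) : v η 1 = 0 := by
  have := h.map_mul η (one_ne_zero (α := K)) one_ne_zero
  rw [mul_one] at this
  omega

theorem map_pow (h : KrullFamily A v) (η : P) {x : K} (hx : x ≠ 0) (n : ℕ) :
    v η (x ^ n) = n * v η x := by
  induction n with
  | zero => simp [h.map_one]
  | succ n ih =>
    rw [pow_succ, h.map_mul η (pow_ne_zero n hx) hx, ih]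
    push_cast
    ring

/-- A product of powers of separating elements, one factor for each member of `F`. Values of
elements of `A` are nonnegative, so extra factors never spoil a bound. -/
theorem exists_vanishing (h : KrullFamily A v) (η : P) (F : Finset P) (hF : η ∉ F) (N : P → ℕ) :
    ∃ a : A, algebraMap A K a ≠ 0 ∧ v η (algebraMap A K a) = 0 ∧
      ∀ η' ∈ F, (N η' : ℤ) ≤ v η' (algebraMap A K a) := by
  classical
  induction F using Finset.induction_on with
  | empty => exact ⟨1, by simp, by simp [h.map_one], by simp⟩
  | insert η₁ F _ ih =>
    rw [Finset.mem_insert, not_or] at hF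
    obtain ⟨a, ha, ha0, haF⟩ := ih hF.2
    obtain ⟨b, hb, hb0, hb1⟩ := h.exists_separating hF.1
    have hbn : algebraMap A K (b ^ N η₁) ≠ 0 := by rw [_root_.map_pow]; exact pow_ne_zero _ hb
    refine ⟨b ^ N η₁ * a, ?_, ?_, fun η' hη' => ?_⟩
    · rw [_root_.map_mul]; exact mul_ne_zero hbn ha
    · rw [_root_.map_mul, h.map_mul η hbn ha, ha0, _root_.map_pow, h.map_pow η hb, hb0]
      simp
    · rw [_root_.map_mul, h.map_mul η' hbn ha]
      rcases Finset.mem_insert.mp hη' with rfl | h'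
      · have h1 := h.nonneg η' ha
        rw [_root_.map_pow, h.map_pow η' hb]
        nlinarith
      · have h1 := h.nonneg η' hbn
        linarith [haF η' h']

theorem exists_eq_of_le (h : KrullFamily A v) (e : P → ℤ) (he : (Function.support e).Finite)
    (η : P) : ∃ y : K, y ≠ 0 ∧ v η y = e η ∧ ∀ η', e η' ≤ v η' y := by
  classical
  obtain ⟨z, hz, hze⟩ := h.surjective η (e η)
  -- Only finitely many places can violate `e ≤ v z`. Multiplying by an element that vanishes there
  -- to order at least the positive part of `e - v z`, and has value zero at `η`, repairs all of
  -- them.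
  let F := (he.union (h.finite_support hz)).toFinset.erase η
  obtain ⟨a, ha, ha0, haF⟩ := h.exists_vanishing η F (Finset.notMem_erase _ _)
    fun η' => (e η' - v η' z).toNat
  refine ⟨z * algebraMap A K a, mul_ne_zero hz ha, ?_, fun η' => ?_⟩
  · rw [h.map_mul η hz ha, hze, ha0, add_zero]
  · rw [h.map_mul η' hz ha]
    have h1 := h.nonneg η' ha
    by_cases hη : η' = η
    · subst hη; omega
    by_cases hF : η' ∈ F
    · have := haF η' hF
      omega
    · have h2 : ¬ (e η' ≠ 0 ∨ v η' z ≠ 0) := fun h3 => hF (by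
        simpa [F, hη] using h3)
      omega

/-- Divisors on a Krull domain are minima of finitely many principal divisors. -/
theorem exists_finite (h : KrullFamily A v) (e : P → ℤ) (he : (Function.support e).Finite) :
    ∃ J : Set K, J.Finite ∧ (∀ y ∈ J, y ≠ 0 ∧ ∀ η, e η ≤ v η y) ∧ ∀ η, ∃ y ∈ J, v η y = e η := by
  choose y hy0 hye hyle using h.exists_eq_of_le e he
  rcases isEmpty_or_nonempty P with hP | ⟨⟨η₀⟩⟩
  · exact ⟨∅, Set.finite_empty, by simp, fun η => hP.elim η⟩
  -- Outside `F` both `e` and the values of `y η₀` are zero, so the single element `y η₀` attains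
  -- the minimum at all the remaining places.
  let F := insert η₀ (Function.support e ∪ {η | v η (y η₀) ≠ 0})
  have hF : F.Finite := (he.union (h.finite_support (hy0 η₀))).insert _
  refine ⟨y '' F, hF.image _, ?_, fun η => ?_⟩
  · rintro _ ⟨η, -, rfl⟩
    exact ⟨hy0 η, hyle η⟩
  · by_cases hη : η ∈ F
    · exact ⟨y η, ⟨η, hη, rfl⟩, hye η⟩
    · refine ⟨y η₀, ⟨η₀, Set.mem_insert _ _, rfl⟩, ?_⟩
      simp only [F, Set.mem_insert_iff, Set.mem_union, Function.mem_support, Set.mem_ofPred_eq,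
        not_or, not_not] at hη
      rw [hη.2.1, hη.2.2]

/-- The description of the functions with poles bounded by `e` as a colon submodule. -/
theorem mem_integralColon_iff {B L Q : Type*} [CommRing B] [Field L] [Algebra B L] {w : Q → L → ℤ}
    (hmul : ∀ ξ x y, x ≠ 0 → y ≠ 0 → w ξ (x * y) = w ξ x + w ξ y)
    (hnonneg : ∀ ξ (b : B), algebraMap B L b ≠ 0 → 0 ≤ w ξ (algebraMap B L b))
    (hrange : ∀ x ≠ 0, (∀ ξ, 0 ≤ w ξ x) → x ∈ Set.range (algebraMap B L))
    {e : Q → ℤ} {J : Set L} (hJ : ∀ y ∈ J, y ≠ 0 ∧ ∀ ξ, e ξ ≤ w ξ y)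
    (hJe : ∀ ξ, ∃ y ∈ J, w ξ y = e ξ) (x : L) :
    x ∈ integralColon B J ↔ (x ≠ 0 → ∀ ξ, 0 ≤ w ξ x + e ξ) := by
  constructor
  · intro hx hx0 ξ
    obtain ⟨y, hy, hye⟩ := hJe ξ
    obtain ⟨b, hb⟩ := hx y hy
    have h1 : algebraMap B L b = x * y := hb
    have h2 := hnonneg ξ b (h1 ▸ mul_ne_zero hx0 (hJ y hy).1)
    rwa [h1, hmul ξ x y hx0 (hJ y hy).1, hye] at h2
  · intro hx y hy
    by_cases hx0 : x = 0
    · subst hx0; rw [zero_mul]; exact zero_mem _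
    · refine hrange _ (mul_ne_zero hx0 (hJ y hy).1) fun ξ => ?_
      rw [hmul ξ x y hx0 (hJ y hy).1]
      linarith [hx hx0 ξ, (hJ y hy).2 ξ]

end KrullFamily

end Divisorial

namespace WittDivisorial

noncomputable section

/-! ### The filtration of truncated Witt vectors by vanishing leading coordinates. -/

section WittFiltration

variable {p : ℕ} [hp : Fact p.Prime] {n : ℕ} {R : Type*} [CommRing R]

/-- Coordinatewise vanishing says nothing visible about sums. As the image of an iterated
Verschiebung, which is additive, the filtration is seen to consist of subgroups. -/
theorem forall_coeff_eq_zero_iff (j : ℕ) (x : TruncatedWittVector p n R) :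
    (∀ i : Fin n, (i : ℕ) < j → x.coeff i = 0) ↔
      ∃ w : WittVector p R, WittVector.truncate n (WittVector.verschiebung^[j] w) = x := by
  constructor
  · intro h
    have h1 : ∀ i < j, x.out.coeff i = 0 := by
      intro i hi
      simp only [TruncatedWittVector.out]
      split_ifs with hin
      · exact h ⟨i, hin⟩ hi
      · rfl
    exact ⟨_, by
      rw [← WittVector.eq_iterate_verschiebung h1]; exact TruncatedWittVector.truncateFun_out x⟩
  · rintro ⟨w, rfl⟩ i hi
    rw [WittVector.coeff_truncate]
    exact WittVector.iterate_verschiebung_coeff_eq_zero w hi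

theorem iterate_verschiebung_add (j : ℕ) (w w' : WittVector p R) :
    WittVector.verschiebung^[j] (w + w') =
      WittVector.verschiebung^[j] w + WittVector.verschiebung^[j] w' :=
  iterate_map_add _ _ _ _

/-- The subgroup of truncated Witt vectors whose first `j` coordinates vanish. -/
def truncFil (p : ℕ) [Fact p.Prime] (n : ℕ) (R : Type*) [CommRing R] (j : ℕ) :
    AddSubgroup (TruncatedWittVector p n R) where
  carrier := {x | ∀ i : Fin n, (i : ℕ) < j → x.coeff i = 0}
  zero_mem' i _ := TruncatedWittVector.coeff_zero p n R i
  add_mem' {x y} hx hy := by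
    obtain ⟨w, rfl⟩ := (forall_coeff_eq_zero_iff j x).mp hx
    obtain ⟨w', rfl⟩ := (forall_coeff_eq_zero_iff j y).mp hy
    refine (forall_coeff_eq_zero_iff j _).mpr ⟨w + w', ?_⟩
    rw [iterate_verschiebung_add, map_add]
  neg_mem' {x} hx := by
    obtain ⟨w, rfl⟩ := (forall_coeff_eq_zero_iff j x).mp hx
    refine (forall_coeff_eq_zero_iff j _).mpr ⟨-w, ?_⟩
    rw [iterate_map_neg, map_neg]

theorem mem_truncFil_iff {j : ℕ} {x : TruncatedWittVector p n R} :
    x ∈ truncFil p n R j ↔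
      ∃ w : WittVector p R, WittVector.truncate n (WittVector.verschiebung^[j] w) = x :=
  forall_coeff_eq_zero_iff j x

theorem coeff_truncate_verschiebung (j : Fin n) (w : WittVector p R) :
    (WittVector.truncate n (WittVector.verschiebung^[(j : ℕ)] w)).coeff j = w.coeff 0 := by
  rw [WittVector.coeff_truncate]
  have := WittVector.iterate_verschiebung_coeff w j 0
  rwa [zero_add] at this

/-- After removing the iterated Verschiebung this is additivity of the zeroth Witt coordinate. The
correction terms only affect later coordinates. -/
theorem coeff_add_of_mem_truncFil {j : Fin n} {x y : TruncatedWittVector p n R}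
    (hx : x ∈ truncFil p n R j) (hy : y ∈ truncFil p n R j) :
    (x + y).coeff j = x.coeff j + y.coeff j := by
  obtain ⟨w, rfl⟩ := mem_truncFil_iff.mp hx
  obtain ⟨w', rfl⟩ := mem_truncFil_iff.mp hy
  rw [← map_add, ← iterate_verschiebung_add, coeff_truncate_verschiebung,
    coeff_truncate_verschiebung, coeff_truncate_verschiebung]
  exact map_add WittVector.constantCoeff w w'

/-- The leading coordinate of the elements of the `j`-th filtration step. -/
def truncFilLead (p : ℕ) [Fact p.Prime] {n : ℕ} (R : Type*) [CommRing R] (j : Fin n) :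
    truncFil p n R j →+ R where
  toFun x := x.1.coeff j
  map_zero' := TruncatedWittVector.coeff_zero p n R j
  map_add' x y := coeff_add_of_mem_truncFil x.2 y.2

theorem coeff_neg_of_mem_truncFil {j : Fin n} {x : TruncatedWittVector p n R}
    (hx : x ∈ truncFil p n R j) : (-x).coeff j = -x.coeff j := by
  have h := coeff_add_of_mem_truncFil hx (neg_mem hx)
  rw [add_neg_cancel, TruncatedWittVector.coeff_zero] at h
  exact (neg_eq_of_add_eq_zero_right h.symm).symm

theorem mem_truncFil_succ {j : Fin n} {x : TruncatedWittVector p n R} :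
    x ∈ truncFil p n R (j + 1) ↔ x ∈ truncFil p n R j ∧ x.coeff j = 0 := by
  constructor
  · intro h
    exact ⟨fun i hi => h i (Nat.lt_succ_of_lt hi), h j (Nat.lt_succ_self _)⟩
  · rintro ⟨h1, h2⟩ i hi
    rcases Nat.lt_succ_iff_lt_or_eq.mp hi with h | h
    · exact h1 i h
    · rw [show i = j from Fin.ext h]; exact h2

theorem sub_mem_truncFil_succ {j : Fin n} {x y : TruncatedWittVector p n R}
    (hx : x ∈ truncFil p n R j) (hy : y ∈ truncFil p n R j) (h : x.coeff j = y.coeff j) :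
    x - y ∈ truncFil p n R (j + 1) :=
  mem_truncFil_succ.mpr ⟨sub_mem hx hy, by
    have := map_sub (truncFilLead p R j) ⟨x, hx⟩ ⟨y, hy⟩
    change (x - y).coeff j = x.coeff j - y.coeff j at this
    rw [this, h, sub_self]⟩

/-- In characteristic `p` one has `V^i x * V^j y = V^(i+j) (F^j x * F^i y)`. -/
theorem mul_mem_truncFil [CharP R p] {i j : ℕ} {x y : TruncatedWittVector p n R}
    (hx : x ∈ truncFil p n R i) (hy : y ∈ truncFil p n R j) : x * y ∈ truncFil p n R (i + j) := by
  obtain ⟨w, rfl⟩ := mem_truncFil_iff.mp hx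
  obtain ⟨w', rfl⟩ := mem_truncFil_iff.mp hy
  exact mem_truncFil_iff.mpr ⟨_, by
    rw [← map_mul, WittVector.iterate_verschiebung_mul]⟩

/-- The truncated Teichmüller representative. -/
def truncTeich (p : ℕ) [Fact p.Prime] (n : ℕ) {R : Type*} [CommRing R] :
    R →* TruncatedWittVector p n R :=
  ((WittVector.truncate n : WittVector p R →+* TruncatedWittVector p n R) :
    WittVector p R →* TruncatedWittVector p n R).comp (WittVector.teichmuller p)

theorem coeff_truncTeich_mul {R : Type u} [CommRing R] (b : R) (x : TruncatedWittVector p n R)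
    (i : Fin n) : (truncTeich p n b * x).coeff i = b ^ p ^ (i : ℕ) * x.coeff i := by
  obtain ⟨w, rfl⟩ := WittVector.truncate_surjective p n R x
  change (WittVector.truncate n (WittVector.teichmuller p b) * _).coeff i = _
  rw [← map_mul, teichmuller_mul, WittVector.coeff_truncate, WittVector.coeff_truncate,
    WittVector.coeff_mk]

theorem truncate_mem_truncFil_one {w : WittVector p R} (h : w.coeff 0 = 0) :
    WittVector.truncate n w ∈ truncFil p n R 1 := by
  intro i hi
  rw [WittVector.coeff_truncate, Nat.lt_one_iff.mp hi, h]

theorem truncTeich_add_sub_mem (b c : R) :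
    truncTeich p n (b + c) - (truncTeich p n b + truncTeich p n c) ∈ truncFil p n R 1 := by
  change WittVector.truncate n (WittVector.teichmuller p (b + c)) -
    (WittVector.truncate n (WittVector.teichmuller p b) +
      WittVector.truncate n (WittVector.teichmuller p c)) ∈ _
  rw [← map_add, ← map_sub]
  refine truncate_mem_truncFil_one ?_
  rw [← WittVector.constantCoeff_apply, map_sub, map_add WittVector.constantCoeff]
  simp [WittVector.constantCoeff_apply]

theorem exists_sub_truncTeich_mem (x : TruncatedWittVector p n R) :
    ∃ b : R, x - truncTeich p n b ∈ truncFil p n R 1 := by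
  obtain ⟨w, rfl⟩ := WittVector.truncate_surjective p n R x
  refine ⟨w.coeff 0, ?_⟩
  change _ - WittVector.truncate n (WittVector.teichmuller p (w.coeff 0)) ∈ _
  rw [← map_sub]
  refine truncate_mem_truncFil_one ?_
  rw [← WittVector.constantCoeff_apply, map_sub]
  simp [WittVector.constantCoeff_apply]

theorem truncMap_truncTeich {S : Type*} [CommRing S] (g : R →+* S) (b : R) :
    truncMap n g (truncTeich p n b) = truncTeich p n (g b) := by
  change truncMap n g (WittVector.truncate n (WittVector.teichmuller p b)) =
    WittVector.truncate n (WittVector.teichmuller p (g b))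
  rw [← WittVector.map_teichmuller]
  ext i
  rw [truncMap_coeff, WittVector.coeff_truncate, WittVector.coeff_truncate, WittVector.map_coeff]

theorem truncMap_mem_truncFil {S : Type*} [CommRing S] (g : R →+* S) {j : ℕ}
    {x : TruncatedWittVector p n R} (hx : x ∈ truncFil p n R j) :
    truncMap n g x ∈ truncFil p n S j := fun i hi => by
  rw [truncMap_coeff, hx i hi, map_zero]

/-- The truncated Witt vector whose only non-zero coordinate is the `j`-th one. -/
def truncSingle (p : ℕ) {n : ℕ} {R : Type*} [CommRing R] (j : Fin n) (a : R) :
    TruncatedWittVector p n R :=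
  TruncatedWittVector.mk p (Pi.single j a)

theorem truncSingle_mem_truncFil (j : Fin n) (a : R) : truncSingle p j a ∈ truncFil p n R j :=
  fun i hi => by
    rw [truncSingle, TruncatedWittVector.coeff_mk,
      Pi.single_eq_of_ne (fun h => (h ▸ hi).ne rfl)]

omit hp in
@[simp]
theorem coeff_truncSingle_self (j : Fin n) (a : R) : (truncSingle p j a).coeff j = a := by
  rw [truncSingle, TruncatedWittVector.coeff_mk, Pi.single_eq_same]

theorem truncTeich_mul_truncSingle {R : Type u} [CommRing R] (j : Fin n) (a b : R) :
    truncTeich p n b * truncSingle p j a = truncSingle p j (b ^ p ^ (j : ℕ) * a) := by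
  ext i
  rw [coeff_truncTeich_mul, truncSingle, truncSingle, TruncatedWittVector.coeff_mk,
    TruncatedWittVector.coeff_mk]
  by_cases h : i = j
  · subst h; rw [Pi.single_eq_same, Pi.single_eq_same]
  · rw [Pi.single_eq_of_ne h, Pi.single_eq_of_ne h, mul_zero]

theorem truncMap_truncSingle {S : Type*} [CommRing S] (g : R →+* S) (j : Fin n) (a : R) :
    truncMap n g (truncSingle p j a) = truncSingle p j (g a) := by
  ext i
  rw [truncMap_coeff, truncSingle, truncSingle, TruncatedWittVector.coeff_mk,
    TruncatedWittVector.coeff_mk]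
  by_cases h : i = j
  · subst h; rw [Pi.single_eq_same, Pi.single_eq_same]
  · rw [Pi.single_eq_of_ne h, Pi.single_eq_of_ne h, map_zero]

end WittFiltration

/-! ### Generation of Witt modules over `W_n(B)` by elements defined over `W_n(A)`. -/

section WittBaseChange

open TensorProduct

/-- A realization of a `W_n(A)`-module `S` as the group of truncated Witt vectors over `K` whose
`i`-th coordinate lies in `M i`. -/
structure WittRep (p : ℕ) [Fact p.Prime] (n : ℕ) (A : Type*) {K : Type*} (S : Type*) [CommRing A]
    [CommRing K] [Algebra A K] [AddCommGroup S] [Module (TruncatedWittVector p n A) S]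
    (M : Fin n → Submodule A K) where
  /-- The underlying embedding into `W_n(K)`. -/
  val : S →+ TruncatedWittVector p n K
  injective : Function.Injective val
  val_smul (a : TruncatedWittVector p n A) (s : S) :
    val (a • s) = truncMap n (algebraMap A K) a * val s
  coeff_mem (s : S) (i : Fin n) : (val s).coeff i ∈ M i
  surjective (w : TruncatedWittVector p n K) : (∀ i, w.coeff i ∈ M i) → ∃ s, val s = w

variable {p : ℕ} [hp : Fact p.Prime] {n : ℕ}

namespace WittRep

variable {A K : Type u} {S : Type*} [CommRing A] [CommRing K] [Algebra A K] [AddCommGroup S]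
  [Module (TruncatedWittVector p n A) S] {M : Fin n → Submodule A K} (r : WittRep p n A S M)

/-- The module `W_n(A)`, realized in itself. -/
def self (p : ℕ) [Fact p.Prime] (n : ℕ) (A : Type*) [CommRing A] :
    WittRep p n A (TruncatedWittVector p n A) fun _ => (⊤ : Submodule A A) where
  val := AddMonoidHom.id _
  injective := Function.injective_id
  val_smul _ _ := rfl
  coeff_mem _ _ := trivial
  surjective w _ := ⟨w, rfl⟩

theorem smul_mem_fil [CharP K p] {i j : ℕ} {a : TruncatedWittVector p n A} {s : S}
    (ha : a ∈ truncFil p n A i) (hs : r.val s ∈ truncFil p n K j) :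
    r.val (a • s) ∈ truncFil p n K (i + j) := by
  rw [r.val_smul]
  exact mul_mem_truncFil (truncMap_mem_truncFil _ ha) hs

theorem coeff_val_truncTeich_smul (b : A) (s : S) (i : Fin n) :
    (r.val (truncTeich p n b • s)).coeff i = algebraMap A K b ^ p ^ (i : ℕ) * (r.val s).coeff i := by
  rw [r.val_smul, truncMap_truncTeich, coeff_truncTeich_mul]

/-- The element with a single non-zero coordinate. -/
def single (j : Fin n) (m : M j) : S :=
  (r.surjective (truncSingle p j m) fun i => by
    rw [truncSingle, TruncatedWittVector.coeff_mk]
    by_cases h : i = j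
    · subst h; rw [Pi.single_eq_same]; exact m.2
    · rw [Pi.single_eq_of_ne h]; exact zero_mem _).choose

theorem val_single (j : Fin n) (m : M j) : r.val (r.single j m) = truncSingle p j (m : K) :=
  Exists.choose_spec (p := fun s => r.val s = truncSingle p j (m : K)) _

theorem truncTeich_smul_single (j : Fin n) (a : A) (m : M j) :
    truncTeich p n a • r.single j m = r.single j (a ^ p ^ (j : ℕ) • m) := by
  refine r.injective ?_
  rw [r.val_smul, val_single, val_single, truncMap_truncTeich, truncTeich_mul_truncSingle,
    Submodule.coe_smul, Algebra.smul_def, map_pow]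

end WittRep

variable {A B K L : Type u} {S T : Type*} [CommRing A] [CommRing B] [CommRing K] [CommRing L]
  [Algebra A K] [Algebra B L] [Algebra K L] [AddCommGroup S] [AddCommGroup T]
  [Module (TruncatedWittVector p n A) S] [Module (TruncatedWittVector p n B) T]
  {M : Fin n → Submodule A K} {N : Fin n → Submodule B L}

/-- Induction towards `j = n`. The multiple of a single-coordinate vector `m` by the Teichmüller
representative of `b` has leading coordinate `b ^ p ^ j * m`. By `hgen` sums of these match the
leading coordinate of `x`, and the difference lies one filtration step further. -/
theorem WittRep.mem_span_image_fil (r : WittRep p n A S M) (t : WittRep p n B T N) (α : S →+ T)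
    (hα : ∀ s, t.val (α s) = truncMap n (algebraMap K L) (r.val s))
    (hgen : ∀ j : Fin n, ∀ y ∈ N j, y ∈ AddSubgroup.closure
      {y | ∃ (b : B) (m : M j), y = algebraMap B L b ^ p ^ (j : ℕ) * algebraMap K L m})
    (j : ℕ) {x : T} (hx : t.val x ∈ truncFil p n L j) :
    x ∈ Submodule.span (TruncatedWittVector p n B) (α '' {s | r.val s ∈ truncFil p n K j}) := by
  by_cases hj : n ≤ j
  · have : x = 0 := t.injective (by
      rw [map_zero]
      ext i
      rw [hx i (i.2.trans_le hj), TruncatedWittVector.coeff_zero])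
    rw [this]; exact zero_mem _
  · push Not at hj
    have key : ∀ y ∈ AddSubgroup.closure
        {y | ∃ (b : B) (m : M ⟨j, hj⟩), y = algebraMap B L b ^ p ^ j * algebraMap K L m},
        ∃ z ∈ Submodule.span (TruncatedWittVector p n B) (α '' {s | r.val s ∈ truncFil p n K j}),
          t.val z ∈ truncFil p n L j ∧ (t.val z).coeff ⟨j, hj⟩ = y := by
      intro y hy
      induction hy using AddSubgroup.closure_induction with
      | mem y hy =>
        obtain ⟨b, m, rfl⟩ := hy
        refine ⟨truncTeich p n b • α (r.single ⟨j, hj⟩ m), Submodule.smul_mem _ _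
          (Submodule.subset_span ⟨_, ?_, rfl⟩), fun i hi => ?_, ?_⟩
        · rw [Set.mem_ofPred_eq, r.val_single]
          exact truncSingle_mem_truncFil ⟨j, hj⟩ (m : K)
        · rw [t.coeff_val_truncTeich_smul, hα, r.val_single, truncMap_truncSingle,
            truncSingle_mem_truncFil (⟨j, hj⟩ : Fin n) _ i hi, mul_zero]
        · rw [t.coeff_val_truncTeich_smul, hα, r.val_single, truncMap_truncSingle,
            coeff_truncSingle_self]
      | zero => exact ⟨0, zero_mem _, by rw [map_zero]; exact zero_mem _, by
          rw [map_zero, TruncatedWittVector.coeff_zero]⟩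
      | add y y' _ _ h h' =>
        obtain ⟨z, hz, hzf, rfl⟩ := h
        obtain ⟨z', hz', hzf', rfl⟩ := h'
        refine ⟨z + z', add_mem hz hz', by rw [map_add]; exact add_mem hzf hzf', ?_⟩
        rw [map_add, coeff_add_of_mem_truncFil (j := ⟨j, hj⟩) hzf hzf']
      | neg y _ h =>
        obtain ⟨z, hz, hzf, rfl⟩ := h
        refine ⟨-z, neg_mem hz, by rw [map_neg]; exact neg_mem hzf, ?_⟩
        rw [map_neg, coeff_neg_of_mem_truncFil (j := ⟨j, hj⟩) hzf]
    obtain ⟨z, hz, hzf, hzx⟩ := key _ (hgen ⟨j, hj⟩ _ (t.coeff_mem x ⟨j, hj⟩))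
    have h1 : t.val (x - z) ∈ truncFil p n L (j + 1) := by
      rw [map_sub]
      exact sub_mem_truncFil_succ (j := ⟨j, hj⟩) hx hzf hzx.symm
    have h2 := WittRep.mem_span_image_fil r t α hα hgen (j + 1) h1
    rw [← sub_add_cancel x z]
    refine add_mem (Submodule.span_mono (Set.image_mono fun s hs i hi => ?_) h2) hz
    exact hs i (Nat.lt_succ_of_lt hi)
termination_by n - j

variable [Algebra A B] [Algebra A L] [IsScalarTower A B L]

/-- Supplies the generation hypothesis of `WittRep.mem_span_image_fil`: it is surjectivity of the
base change map for the twisted modules, which sends `b ⊗ m` to `b ^ p ^ j • h m`. -/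
theorem closure_of_isBaseChange {M : Submodule A K} {N : Submodule B L} [CharP A p] [CharP B p]
    [IsNoetherianRing A] [Algebra.Etale A B] {h : M →ₗ[A] N} (hh : IsBaseChange B h)
    (hval : ∀ x, (h x : L) = algebraMap K L x) (j : ℕ) {y : L} (hy : y ∈ N) :
    y ∈ AddSubgroup.closure
      {y | ∃ (b : B) (m : M), y = algebraMap B L b ^ p ^ j * algebraMap K L m} := by
  have h1 := FrobTwist.isBaseChange_map p j hh
  have h2 := h1.equiv.surjective (FrobTwist.of p j _ ⟨y, hy⟩)
  obtain ⟨z, hz⟩ := h2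
  have key : ∀ z, (((FrobTwist.of p j N).symm (h1.equiv z) : N) : L) ∈ AddSubgroup.closure
      {y | ∃ (b : B) (m : M), y = algebraMap B L b ^ p ^ j * algebraMap K L m} := by
    intro z
    induction z using TensorProduct.induction_on with
    | zero => rw [map_zero, map_zero]; exact zero_mem _
    | add x y hx hy => rw [map_add, map_add]; exact add_mem hx hy
    | tmul b m =>
      obtain ⟨m, rfl⟩ := (FrobTwist.of p j M).surjective m
      refine AddSubgroup.subset_closure ⟨b, m, ?_⟩
      rw [h1.equiv_tmul]
      change ((b ^ p ^ j • h m : N) : L) = _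
      rw [Submodule.coe_smul, hval, Algebra.smul_def, map_pow]
  have := key z
  rw [hz, AddEquiv.symm_apply_apply] at this
  exact this

/-- The same argument for `W_n(A)` as a module over itself. It lets multiplication by elements of
`W_n(B)` with zero first coordinate be replaced by scalars from `W_n(A)`, with which semilinear maps
commute. -/
theorem truncFil_one_le_span [CharP A p] [CharP B p] [IsNoetherianRing A] [Algebra.Etale A B]
    {w : TruncatedWittVector p n B} (hw : w ∈ truncFil p n B 1) :
    w ∈ Ideal.span (truncMap n (algebraMap A B) '' (truncFil p n A 1 : Set _)) := by
  refine WittRep.mem_span_image_fil (WittRep.self p n A) (WittRep.self p n B)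
    (truncMap n (algebraMap A B)).toAddMonoidHom (fun _ => rfl) (fun j y _ => ?_) 1 hw
  have h1 := FrobTwist.isBaseChange_map p (j : ℕ) (IsBaseChange.linearMap A B)
  obtain ⟨z, hz⟩ := h1.equiv.surjective (FrobTwist.of p j _ y)
  have key : ∀ z, ((FrobTwist.of p j B).symm (h1.equiv z) : B) ∈ AddSubgroup.closure
      {y | ∃ (b : B) (m : (⊤ : Submodule A A)),
        y = algebraMap B B b ^ p ^ (j : ℕ) * algebraMap A B m} := by
    intro z
    induction z using TensorProduct.induction_on with
    | zero => rw [map_zero, map_zero]; exact zero_mem _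
    | add x y hx hy => rw [map_add, map_add]; exact add_mem hx hy
    | tmul b m =>
      refine AddSubgroup.subset_closure ⟨b, ⟨(FrobTwist.of p j A).symm m, trivial⟩, ?_⟩
      rw [h1.equiv_tmul]
      rfl
  have := key z
  rw [hz, AddEquiv.symm_apply_apply] at this
  exact this

end WittBaseChange

/-! ### Extension of semilinear maps by spanning their graphs. -/

section WittLift

open TensorProduct

variable {p : ℕ} [hp : Fact p.Prime] {n : ℕ}
  {A B K L : Type u} {S T P : Type*} [CommRing A] [CommRing B] [CommRing K] [CommRing L]
  [Algebra A B] [Algebra A K] [Algebra B L] [Algebra K L] [Algebra A L] [IsScalarTower A B L]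
  [AddCommGroup S] [AddCommGroup T] [AddCommGroup P]
  [Module (TruncatedWittVector p n A) S] [Module (TruncatedWittVector p n B) T]
  [Module (TruncatedWittVector p n B) P]
  {M : Fin n → Submodule A K} {N : Fin n → Submodule B L}

namespace WittRep

theorem map_smul_of_val (r : WittRep p n A S M) (t : WittRep p n B T N) [IsScalarTower A K L]
    (α : S →+ T) (hα : ∀ s, t.val (α s) = truncMap n (algebraMap K L) (r.val s))
    (a : TruncatedWittVector p n A) (s : S) :
    α (a • s) = truncMap n (algebraMap A B) a • α s := by
  refine t.injective ?_
  rw [t.val_smul, hα, hα, r.val_smul, map_mul]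
  congr 1
  ext i
  rw [truncMap_coeff, truncMap_coeff, truncMap_coeff, truncMap_coeff,
    ← IsScalarTower.algebraMap_apply A K L, ← IsScalarTower.algebraMap_apply A B L]

/-- The span of the part of the graph of `β` lying over the `j`-th filtration step. -/
def graphSpan (r : WittRep p n A S M) (α : S →+ T) (β : S →+ P) (j : ℕ) :
    Submodule (TruncatedWittVector p n B) (T × P) :=
  Submodule.span _ ((fun s => (α s, β s)) '' {s | r.val s ∈ truncFil p n K j})

variable (r : WittRep p n A S M) (α : S →+ T) (β : S →+ P)

variable (B) in
omit [Algebra A B] in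
theorem mem_graphSpan {j : ℕ} {s : S} (hs : r.val s ∈ truncFil p n K j) :
    ((α s, β s) : T × P) ∈ graphSpan (B := B) r α β j :=
  Submodule.subset_span ⟨s, hs, rfl⟩

/-- By `truncFil_one_le_span` it suffices to multiply by scalars from `W_n(A)` with zero first
coordinate. These can be moved inside `α` and `β`, where they raise the filtration degree. -/
theorem smul_mem_graphSpan_succ [CharP K p] [CharP A p] [CharP B p] [IsNoetherianRing A]
    [Algebra.Etale A B]
    (hα : ∀ (a : TruncatedWittVector p n A) s, α (a • s) = truncMap n (algebraMap A B) a • α s)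
    (hβ : ∀ (a : TruncatedWittVector p n A) s, β (a • s) = truncMap n (algebraMap A B) a • β s)
    {w : TruncatedWittVector p n B} (hw : w ∈ truncFil p n B 1) {j : ℕ} {x : T × P}
    (hx : x ∈ graphSpan (B := B) r α β j) : w • x ∈ graphSpan (B := B) r α β (j + 1) := by
  have h1 := truncFil_one_le_span (A := A) hw
  have h2 : ∀ a ∈ truncFil p n A 1, ∀ y ∈ graphSpan (B := B) r α β j,
      truncMap n (algebraMap A B) a • y ∈ graphSpan (B := B) r α β (j + 1) := by
    intro a ha y hy
    induction hy using Submodule.span_induction with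
    | mem y hy =>
      obtain ⟨s, hs, rfl⟩ := hy
      have h3 := r.smul_mem_fil ha hs
      rw [add_comm] at h3
      have h4 := r.mem_graphSpan B α β h3
      rw [hα, hβ] at h4
      exact h4
    | zero => rw [smul_zero]; exact zero_mem _
    | add y z _ _ hy hz => rw [smul_add]; exact add_mem hy hz
    | smul w y _ hy => rw [smul_comm]; exact Submodule.smul_mem _ _ hy
  clear hw
  induction h1 using Submodule.span_induction with
  | mem w hw =>
    obtain ⟨a, ha, rfl⟩ := hw
    exact h2 a ha x hx
  | zero => rw [zero_smul]; exact zero_mem _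
  | add y z _ _ hy hz => rw [add_smul]; exact add_mem hy hz
  | smul w y _ hy => rw [smul_eq_mul, mul_smul]; exact Submodule.smul_mem _ _ hy

omit [Algebra K L] in
-- Modulo the next graph span, the prescribed value is biadditive in `b` and `m` and balanced for
-- the twisted `A`-action. It therefore factors through the tensor product, which the twisted base
-- change identifies with `N j`.
theorem exists_graphSpan_map [CharP K p] [CharP A p] [CharP B p] [IsNoetherianRing A] [Algebra.Etale A B]
    (hα : ∀ (a : TruncatedWittVector p n A) s, α (a • s) = truncMap n (algebraMap A B) a • α s)
    (hβ : ∀ (a : TruncatedWittVector p n A) s, β (a • s) = truncMap n (algebraMap A B) a • β s)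
    {j : Fin n} {h : M j →ₗ[A] N j} (hh : IsBaseChange B h) :
    ∃ Θ : N j →+ (T × P) ⧸ graphSpan (B := B) r α β (j + 1),
      ∀ (b : B) (m : M j), Θ (b ^ p ^ (j : ℕ) • h m) =
        Submodule.Quotient.mk (truncTeich p n b • (α (r.single j m), β (r.single j m))) := by
  have h1 := FrobTwist.isBaseChange_map p (j : ℕ) hh
  have hsingle : ∀ m, r.val (r.single j m) ∈ truncFil p n K j := fun m => by
    rw [r.val_single]; exact truncSingle_mem_truncFil _ _
  let θ₀ : B → M j → (T × P) ⧸ graphSpan (B := B) r α β (j + 1) := fun b m =>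
    Submodule.Quotient.mk (truncTeich p n b • (α (r.single j m), β (r.single j m)))
  have hadd₁ : ∀ b b' m, θ₀ (b + b') m = θ₀ b m + θ₀ b' m := by
    intro b b' m
    simp only [θ₀]
    rw [← Submodule.Quotient.mk_add, Submodule.Quotient.eq, ← add_smul, ← sub_smul]
    exact r.smul_mem_graphSpan_succ α β hα hβ (truncTeich_add_sub_mem b b')
      (r.mem_graphSpan B α β (hsingle m))
  have hadd₂ : ∀ b m m', θ₀ b (m + m') = θ₀ b m + θ₀ b m' := by
    intro b m m'
    simp only [θ₀]
    rw [← Submodule.Quotient.mk_add, Submodule.Quotient.eq, ← smul_add, ← smul_sub]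
    refine Submodule.smul_mem _ _ ?_
    have h2 := r.mem_graphSpan B α β (j := j + 1)
      (s := r.single j (m + m') - (r.single j m + r.single j m')) (by
        rw [map_sub]
        refine sub_mem_truncFil_succ (hsingle _) ?_ ?_
        · rw [map_add]; exact add_mem (hsingle _) (hsingle _)
        · rw [map_add, coeff_add_of_mem_truncFil (hsingle _) (hsingle _), val_single, val_single,
            val_single, coeff_truncSingle_self, coeff_truncSingle_self, coeff_truncSingle_self,
            Submodule.coe_add])
    rw [map_sub, map_sub, map_add, map_add] at h2
    exact h2
  let θ : B →+ FrobTwist p j (M j) →+ (T × P) ⧸ graphSpan (B := B) r α β (j + 1) :=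
    AddMonoidHom.mk' (fun b => AddMonoidHom.mk' (θ₀ b) (hadd₂ b)) fun b b' =>
      AddMonoidHom.ext fun m => hadd₁ b b' m
  -- The Teichmüller representative of `a` multiplies the `j`-th coordinate by `a ^ p ^ j`, so
  -- balancing holds exactly for the Frobenius-twisted action.
  have hbal : ∀ (a : A) (b : B) (m : FrobTwist p j (M j)), θ (a • b) m = θ b (a • m) := by
    intro a b m
    obtain ⟨m, rfl⟩ := (FrobTwist.of p j (M j)).surjective m
    rw [FrobTwist.smul_of]
    change θ₀ (a • b) m = θ₀ b (a ^ p ^ (j : ℕ) • m)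
    simp only [θ₀]
    rw [← truncTeich_smul_single, hα, hβ, ← Prod.smul_mk, smul_smul, truncMap_truncTeich,
      ← map_mul, Algebra.smul_def, mul_comm b]
  let Θ := (TensorProduct.liftAddHom (R := A) θ hbal).comp
    (h1.equiv.symm.toAddEquiv.toAddMonoidHom.comp (FrobTwist.of p j (N j)).toAddMonoidHom)
  refine ⟨Θ, fun b m => ?_⟩
  have h3 : h1.equiv.symm (FrobTwist.of p j (N j) (b ^ p ^ (j : ℕ) • h m)) =
      b ⊗ₜ FrobTwist.of p j (M j) m := by
    rw [LinearEquiv.symm_apply_eq, h1.equiv_tmul]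
    rfl
  change TensorProduct.liftAddHom θ hbal (h1.equiv.symm (FrobTwist.of p j (N j) _)) = _
  rw [h3]
  rfl

/-- On the `j`-th graph span, the class modulo the next one is the image under `Θ` of the leading
coordinate of the first component. A vanishing leading coordinate thus moves the element one step
down. -/
theorem mem_graphSpan_succ (t : WittRep p n B T N) [CharP K p] [CharP A p] [CharP B p]
    [CharP L p] [IsNoetherianRing A] [Algebra.Etale A B]
    (hval : ∀ s, t.val (α s) = truncMap n (algebraMap K L) (r.val s))
    (hα : ∀ (a : TruncatedWittVector p n A) s, α (a • s) = truncMap n (algebraMap A B) a • α s)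
    (hβ : ∀ (a : TruncatedWittVector p n A) s, β (a • s) = truncMap n (algebraMap A B) a • β s)
    {j : Fin n} {h : M j →ₗ[A] N j} (hh : IsBaseChange B h)
    (hhval : ∀ x, (h x : L) = algebraMap K L x) {x : T × P}
    (hx : x ∈ graphSpan (B := B) r α β j) (hx0 : (t.val x.1).coeff j = 0) :
    x ∈ graphSpan (B := B) r α β (j + 1) := by
  obtain ⟨Θ, hΘ⟩ := exists_graphSpan_map r α β hα hβ hh
  -- Vanishing of the leading coordinate is not inherited by the generators; the formula for the
  -- class is, so induction over the span is applied to it.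
  suffices h1 : t.val x.1 ∈ truncFil p n L j ∧
      (Submodule.Quotient.mk x : (T × P) ⧸ graphSpan (B := B) r α β (j + 1)) =
      Θ ⟨(t.val x.1).coeff j, t.coeff_mem _ _⟩ by
    have h2 : (⟨(t.val x.1).coeff j, t.coeff_mem _ _⟩ : N j) = 0 := Subtype.ext hx0
    rw [h2, map_zero] at h1
    exact (Submodule.Quotient.mk_eq_zero _).mp h1.2
  clear hx0
  induction hx using Submodule.closure_induction with
  | zero =>
    refine ⟨by rw [Prod.fst_zero, map_zero]; exact zero_mem _, ?_⟩
    rw [Submodule.Quotient.mk_zero, ← map_zero Θ]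
    refine congrArg Θ (Subtype.ext ?_)
    change (0 : L) = (t.val (0 : T)).coeff j
    rw [map_zero, TruncatedWittVector.coeff_zero]
  | add x y _ _ hx hy =>
    refine ⟨by rw [Prod.fst_add, map_add]; exact add_mem hx.1 hy.1, ?_⟩
    rw [Submodule.Quotient.mk_add, hx.2, hy.2, ← map_add Θ]
    refine congrArg Θ (Subtype.ext ?_)
    change (t.val x.1).coeff j + (t.val y.1).coeff j = (t.val (x.1 + y.1)).coeff j
    rw [map_add, coeff_add_of_mem_truncFil hx.1 hy.1]
  | smul_mem w x hx =>
    obtain ⟨s, hs, rfl⟩ := hx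
    have hs' : t.val (α s) ∈ truncFil p n L j := by
      rw [hval]; exact truncMap_mem_truncFil _ hs
    obtain ⟨b, hb⟩ := exists_sub_truncTeich_mem w
    let m : M j := ⟨(r.val s).coeff j, r.coeff_mem s j⟩
    have h2 : r.val (r.single j m) ∈ truncFil p n K j := by
      rw [r.val_single]; exact truncSingle_mem_truncFil _ _
    have h3 : r.val (s - r.single j m) ∈ truncFil p n K (j + 1) := by
      rw [map_sub]
      refine sub_mem_truncFil_succ hs h2 ?_
      rw [r.val_single, coeff_truncSingle_self]
    have h4 : t.val (w • α s) ∈ truncFil p n L j := by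
      have := t.smul_mem_fil (i := 0) (a := w) (fun i hi => absurd hi (Nat.not_lt_zero _)) hs'
      rwa [zero_add] at this
    refine ⟨h4, ?_⟩
    -- Modulo the next graph span, `w` may be replaced by the Teichmüller representative of its
    -- first coordinate, and `s` by the vector carrying only its leading coordinate.
    have h5 : (Submodule.Quotient.mk (w • (α s, β s)) :
        (T × P) ⧸ graphSpan (B := B) r α β (j + 1)) =
        Submodule.Quotient.mk (truncTeich p n b • (α (r.single j m), β (r.single j m))) := by
      rw [Submodule.Quotient.eq]
      have e : w • (α s, β s) - truncTeich p n b • (α (r.single j m), β (r.single j m)) =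
          (w - truncTeich p n b) • (α s, β s) +
            truncTeich p n b • (α (s - r.single j m), β (s - r.single j m)) := by
        rw [map_sub, map_sub, ← Prod.mk_sub_mk, smul_sub, sub_smul]
        abel
      rw [e]
      exact add_mem (r.smul_mem_graphSpan_succ α β hα hβ hb (r.mem_graphSpan B α β hs))
        (Submodule.smul_mem _ _ (r.mem_graphSpan B α β h3))
    change Submodule.Quotient.mk (w • (α s, β s)) = _
    rw [h5, ← hΘ]
    refine congrArg Θ (Subtype.ext ?_)
    change ((b ^ p ^ (j : ℕ) • h m : N j) : L) = (t.val (w • α s)).coeff j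
    have h6 : t.val ((w - truncTeich p n b) • α s) ∈ truncFil p n L (j + 1) := by
      have := t.smul_mem_fil hb hs'
      rwa [add_comm] at this
    have h7 : (t.val (truncTeich p n b • α s)) ∈ truncFil p n L j := by
      have := t.smul_mem_fil (i := 0) (a := truncTeich p n b)
        (fun i hi => absurd hi (Nat.not_lt_zero _)) hs'
      rwa [zero_add] at this
    have h8 : (w - truncTeich p n b) • α s + truncTeich p n b • α s = w • α s := by
      rw [← add_smul, sub_add_cancel]
    rw [← h8, map_add, coeff_add_of_mem_truncFil (mem_truncFil_succ.mp h6).1 h7,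
      (mem_truncFil_succ.mp h6).2, zero_add, t.coeff_val_truncTeich_smul, hval, truncMap_coeff,
      Submodule.coe_smul, hhval, Algebra.smul_def, map_pow]

/-- Every semilinear map out of the Witt vectors with coordinates in the submodules `M j` extends
uniquely to the Witt vectors with coordinates in their base changes `N j`. -/
theorem exists_lift (t : WittRep p n B T N) [CharP K p] [CharP A p] [CharP B p]
    [CharP L p] [IsNoetherianRing A] [Algebra.Etale A B] [IsScalarTower A K L]
    (hval : ∀ s, t.val (α s) = truncMap n (algebraMap K L) (r.val s))
    (hβ : ∀ (a : TruncatedWittVector p n A) s, β (a • s) = truncMap n (algebraMap A B) a • β s)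
    (h : ∀ j, M j →ₗ[A] N j) (hh : ∀ j, IsBaseChange B (h j))
    (hhval : ∀ j x, (h j x : L) = algebraMap K L x) :
    Submodule.span (TruncatedWittVector p n B) (Set.range α) = ⊤ ∧
    ∃ γ : T →ₗ[TruncatedWittVector p n B] P, ∀ s, γ (α s) = β s := by
  have hα := r.map_smul_of_val t α hval
  have hfil0 : ∀ {R : Type u} [CommRing R] (x : TruncatedWittVector p n R),
      x ∈ truncFil p n R 0 := fun x i hi => absurd hi (Nat.not_lt_zero _)
  have hspan : Submodule.span (TruncatedWittVector p n B) (Set.range α) = ⊤ := by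
    refine eq_top_iff.mpr fun x _ => ?_
    refine Submodule.span_mono (Set.image_subset_range α _)
      (r.mem_span_image_fil t α hval (fun j y hy => ?_) 0 (hfil0 (t.val x)))
    exact closure_of_isBaseChange (hh j) (hhval j) j hy
  refine ⟨hspan, ?_⟩
  -- The span is the graph of a function: with first component zero, every leading coordinate
  -- vanishes, so the element descends to the `n`-th graph span, which is zero.
  have h0 : ∀ x ∈ graphSpan (B := B) r α β 0, x.1 = 0 → x = 0 := by
    intro x hx hx0
    have h1 : ∀ j ≤ n, x ∈ graphSpan (B := B) r α β j := by
      intro j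
      induction j with
      | zero => exact fun _ => hx
      | succ j ih =>
        intro hj
        refine r.mem_graphSpan_succ α β t hval hα hβ (j := ⟨j, hj⟩) (hh _) (hhval _)
          (ih (Nat.le_of_succ_le hj)) ?_
        rw [hx0, map_zero, TruncatedWittVector.coeff_zero]
    have h2 := h1 n le_rfl
    have h3 : graphSpan (B := B) r α β n = ⊥ := by
      rw [graphSpan, Submodule.span_eq_bot]
      rintro _ ⟨s, hs, rfl⟩
      have : s = 0 := r.injective (by
        rw [map_zero]
        ext i
        rw [hs i i.2, TruncatedWittVector.coeff_zero])
      change (α s, β s) = 0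
      rw [this, map_zero, map_zero]
      rfl
    rwa [h3, Submodule.mem_bot] at h2
  let π : graphSpan (B := B) r α β 0 →ₗ[TruncatedWittVector p n B] T :=
    (LinearMap.fst _ T P).comp (Submodule.subtype _)
  have hπ : Function.Bijective π := by
    refine ⟨(injective_iff_map_eq_zero π).mpr fun x hx => Subtype.ext (h0 x x.2 hx), ?_⟩
    rw [← LinearMap.range_eq_top, eq_top_iff, ← hspan, Submodule.span_le]
    rintro _ ⟨s, rfl⟩
    exact ⟨⟨_, r.mem_graphSpan B α β (hfil0 _)⟩, rfl⟩
  let e := LinearEquiv.ofBijective π hπ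
  refine ⟨(LinearMap.snd _ T P).comp ((Submodule.subtype _).comp e.symm.toLinearMap), fun s => ?_⟩
  have : e.symm (α s) = ⟨_, r.mem_graphSpan B α β (hfil0 (r.val s))⟩ := by
    rw [LinearEquiv.symm_apply_eq]; rfl
  change ((e.symm (α s)).1).2 = _
  rw [this]

end WittRep

end WittLift

/-! ### Orders of vanishing at points of codimension one. -/

section OrdAtPoints

variable {X : Scheme.{u}} [AlgebraicGeometry.IsIntegral X] [IsLocallyNoetherian X] [RegularScheme X]

/-- Orders are computed through the normal form of a unit times a power of a uniformizer, both on
one scheme and along an étale map. -/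
theorem ord_unit_smul_zpow {x : X} (hx : coheight x = 1) {ϖ : X.presheaf.stalk x}
    (hϖ : Irreducible ϖ) (u : (X.presheaf.stalk x)ˣ) (m : ℤ) :
    Scheme.ord (u • algebraMap (X.presheaf.stalk x) X.functionField ϖ ^ m) x = m := by
  have := isDVR_stalk x hx
  have h0 : algebraMap (X.presheaf.stalk x) X.functionField ϖ ≠ 0 := by
    simpa using hϖ.ne_zero
  have hne : u • algebraMap (X.presheaf.stalk x) X.functionField ϖ ^ m ≠ 0 :=
    smul_ne_zero u.ne_zero (zpow_ne_zero m h0)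
  rw [Scheme.ord_eq_iff hx hne]
  have h1 : Ring.ordFrac (X.presheaf.stalk x)
      (u • algebraMap (X.presheaf.stalk x) X.functionField ϖ ^ m) = WithZero.exp m := by
    rw [Units.smul_def, Algebra.smul_def, map_mul, map_zpow₀, Ring.ordFrac_irreducible hϖ,
      Ring.ordFrac_of_isUnit u.isUnit, one_mul, ← WithZero.exp_zsmul, zsmul_one, Int.cast_id]
  exact h1

theorem exists_eq_unit_smul_zpow {x : X} (hx : coheight x = 1) {ϖ : X.presheaf.stalk x}
    (hϖ : Irreducible ϖ) {r : X.functionField} (hr : r ≠ 0) :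
    ∃ u : (X.presheaf.stalk x)ˣ,
      r = u • algebraMap (X.presheaf.stalk x) X.functionField ϖ ^ (Scheme.ord r x) := by
  have := isDVR_stalk x hx
  obtain ⟨m, u, h⟩ := IsDiscreteValuationRing.exists_units_eq_smul_zpow_of_irreducible
    (K := X.functionField) hϖ hr
  refine ⟨u, ?_⟩
  rw [h, ord_unit_smul_zpow hx hϖ]

theorem exists_ord_eq {x : X} (hx : coheight x = 1) (m : ℤ) :
    ∃ r : X.functionField, r ≠ 0 ∧ Scheme.ord r x = m := by
  have := isDVR_stalk x hx
  obtain ⟨ϖ, hϖ⟩ := IsDiscreteValuationRing.exists_irreducible (X.presheaf.stalk x)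
  have h0 : algebraMap (X.presheaf.stalk x) X.functionField ϖ ≠ 0 := by
    simpa using hϖ.ne_zero
  exact ⟨_, smul_ne_zero (1 : (X.presheaf.stalk x)ˣ).ne_zero (zpow_ne_zero m h0),
    ord_unit_smul_zpow hx hϖ 1 m⟩

omit [RegularScheme X] in
theorem ord_algebraMap_nonneg {x : X} (hx : coheight x = 1) {a : X.presheaf.stalk x} (ha : a ≠ 0) :
    0 ≤ Scheme.ord (algebraMap _ X.functionField a) x := by
  have : Ring.KrullDimLE 1 (X.presheaf.stalk x) := krullDimLE_of_coheight_le hx.le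
  rw [Scheme.le_ord_iff hx (by simpa using ha)]
  exact Ring.ordFrac_ge_one_of_ne_zero ha

theorem mem_range_algebraMap_of_ord_nonneg {x : X} (hx : coheight x = 1) {r : X.functionField}
    (h : r ≠ 0 → 0 ≤ Scheme.ord r x) :
    r ∈ Set.range (algebraMap (X.presheaf.stalk x) X.functionField) := by
  by_cases hr : r = 0
  · exact ⟨0, by rw [hr, map_zero]⟩
  have := isDVR_stalk x hx
  obtain ⟨ϖ, hϖ⟩ := IsDiscreteValuationRing.exists_irreducible (X.presheaf.stalk x)
  obtain ⟨u, hu⟩ := exists_eq_unit_smul_zpow hx hϖ hr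
  obtain ⟨m, hm⟩ := Int.eq_ofNat_of_zero_le (h hr)
  refine ⟨u * ϖ ^ m, ?_⟩
  rw [hu, hm, Units.smul_def, Algebra.smul_def, map_mul, map_pow, zpow_natCast]

theorem isUnit_of_ord_eq_zero {x : X} (hx : coheight x = 1) {a : X.presheaf.stalk x} (ha : a ≠ 0)
    (h : Scheme.ord (algebraMap _ X.functionField a) x = 0) : IsUnit a := by
  have := isDVR_stalk x hx
  obtain ⟨ϖ, hϖ⟩ := IsDiscreteValuationRing.exists_irreducible (X.presheaf.stalk x)
  obtain ⟨u, hu⟩ := exists_eq_unit_smul_zpow hx hϖ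
    (r := algebraMap _ X.functionField a) (by simpa using ha)
  rw [h, zpow_zero, Units.smul_def, Algebra.smul_def, mul_one] at hu
  rw [IsFractionRing.injective (X.presheaf.stalk x) X.functionField hu]
  exact u.isUnit

theorem ord_algebraMap_of_isUnit {x : X} (hx : coheight x = 1) {a : X.presheaf.stalk x}
    (ha : IsUnit a) : Scheme.ord (algebraMap _ X.functionField a) x = 0 := by
  have := isDVR_stalk x hx
  obtain ⟨ϖ, hϖ⟩ := IsDiscreteValuationRing.exists_irreducible (X.presheaf.stalk x)
  have := ord_unit_smul_zpow hx hϖ ha.unit 0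
  rwa [zpow_zero, Units.smul_def, Algebra.smul_def, mul_one] at this

end OrdAtPoints

/-! ### Affine opens of regular schemes are spectra of Krull domains. -/

section AffineKrull

variable {X : Scheme.{u}} [AlgebraicGeometry.IsIntegral X] [IsLocallyNoetherian X]

omit [AlgebraicGeometry.IsIntegral X] [IsLocallyNoetherian X] in
theorem mem_primeIdealOf {U : X.Opens} (hU : IsAffineOpen U) (x : U) (a : Γ(X, U)) :
    a ∈ (hU.primeIdealOf x).asIdeal ↔ x.1 ∉ X.basicOpen a := by
  rw [hU.primeIdealOf_eq_map_closedPoint, Scheme.mem_basicOpen X a x.1 x.2]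
  exact Iff.rfl

omit [AlgebraicGeometry.IsIntegral X] [IsLocallyNoetherian X] in
theorem height_primeIdealOf {U : X.Opens} (hU : IsAffineOpen U) (x : U) :
    (hU.primeIdealOf x).asIdeal.height = coheight x.1 := by
  let := TopCat.Presheaf.algebra_section_stalk X.presheaf x
  have := hU.isLocalization_stalk x
  have h := IsLocalization.AtPrime.ringKrullDim_eq_height (hU.primeIdealOf x).asIdeal
    (X.presheaf.stalk x.1)
  rw [ringKrullDim_stalk_eq_coheight] at h
  exact (WithBot.coe_injective h).symm

omit [AlgebraicGeometry.IsIntegral X] [IsLocallyNoetherian X] in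
theorem exists_primeIdealOf_eq {U : X.Opens} (hU : IsAffineOpen U) (P : Ideal Γ(X, U))
    [hP : P.IsPrime] : ∃ x : U, (hU.primeIdealOf x).asIdeal = P := by
  obtain ⟨x, hx⟩ := hU.isoSpec.hom.homeomorph.surjective ⟨P, hP⟩
  exact ⟨x, congrArg PrimeSpectrum.asIdeal hx⟩

/-- A codimension-one point where `a ≠ 0` vanishes is a minimal prime over `(a)`: a strictly smaller
prime has height zero in a domain, hence is zero and does not contain `a`. A noetherian ring has
only finitely many such minimal primes. -/
theorem finite_coheight_one_not_mem_basicOpen {U : X.Opens} (hU : IsAffineOpen U) [Nonempty U]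
    {a : Γ(X, U)} (ha : a ≠ 0) :
    {x : X | x ∈ U ∧ coheight x = 1 ∧ x ∉ X.basicOpen a}.Finite := by
  have : IsNoetherianRing Γ(X, U) := IsLocallyNoetherian.component_noetherian ⟨U, hU⟩
  have hfin := (Ideal.finite_minimalPrimes_of_isNoetherianRing Γ(X, U) (Ideal.span {a}))
  have hinj : Function.Injective fun x : U => (hU.primeIdealOf x).asIdeal := by
    intro x y h
    exact Subtype.ext (by
      rw [← hU.fromSpec_primeIdealOf x, ← hU.fromSpec_primeIdealOf y, PrimeSpectrum.ext h])
  refine ((hfin.preimage hinj.injOn).image Subtype.val).subset ?_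
  rintro x ⟨hxU, hx1, hxa⟩
  refine ⟨⟨x, hxU⟩, ?_, rfl⟩
  have hmem : a ∈ (hU.primeIdealOf ⟨x, hxU⟩).asIdeal := (mem_primeIdealOf hU ⟨x, hxU⟩ a).mpr hxa
  obtain ⟨q, hq, hqle⟩ := Ideal.exists_minimalPrimes_le
    ((Ideal.span_singleton_le_iff_mem (I := (hU.primeIdealOf ⟨x, hxU⟩).asIdeal)).mpr hmem)
  have hqp : q.IsPrime := hq.1.1
  rcases hqle.eq_or_lt with h | h
  · rw [h] at hq; exact hq
  · exfalso
    have h1 : q.height < 1 := by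
      have h2 := height_primeIdealOf hU ⟨x, hxU⟩
      have h3 := Ideal.height_strict_mono_of_isPrime_of_isPrime h
      rwa [h2, hx1] at h3
    rw [Order.lt_one_iff, Ideal.height_eq_zero_iff_eq_bot] at h1
    have h2 : a ∈ q := hq.1.2 (Ideal.mem_span_singleton_self a)
    rw [h1] at h2
    exact ha h2

/-- The points of codimension one of an open subset. -/
abbrev PrimeDivisorsOn (U : X.Opens) : Type u := {x : X // x ∈ U ∧ coheight x = 1}

variable [RegularScheme X]

omit [IsLocallyNoetherian X] [RegularScheme X] in
theorem algebraMap_eq_algebraMap_germ {U : X.Opens} [Nonempty U] {x : X} (hx : x ∈ U)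
    (a : Γ(X, U)) : algebraMap Γ(X, U) X.functionField a =
      algebraMap (X.presheaf.stalk x) X.functionField (X.presheaf.germ U x hx a) :=
  (Scheme.algebraMap_germ_eq_germToFunctionField X hx a).symm

theorem ord_algebraMap_eq_zero_iff {U : X.Opens} [Nonempty U] {x : X} (hx : coheight x = 1)
    (hxU : x ∈ U) {a : Γ(X, U)} (ha : a ≠ 0) :
    Scheme.ord (algebraMap Γ(X, U) X.functionField a) x = 0 ↔ x ∈ X.basicOpen a := by
  have ha' : X.presheaf.germ U x hxU a ≠ 0 := fun h0 =>
    ha (germ_injective_of_isIntegral X x hxU (by rw [h0, map_zero]))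
  rw [algebraMap_eq_algebraMap_germ hxU, Scheme.mem_basicOpen X a x hxU]
  exact ⟨isUnit_of_ord_eq_zero hx ha', ord_algebraMap_of_isUnit hx⟩

omit [AlgebraicGeometry.IsIntegral X] [IsLocallyNoetherian X] in
theorem isRegularLocalRing_localization {U : X.Opens} (hU : IsAffineOpen U) (P : Ideal Γ(X, U))
    [hP : P.IsPrime] : IsRegularLocalRing (Localization.AtPrime P) := by
  obtain ⟨x, rfl⟩ := exists_primeIdealOf_eq hU P
  let := TopCat.Presheaf.algebra_section_stalk X.presheaf x
  have := hU.isLocalization_stalk x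
  have := RegularScheme.regular_stalk x.1
  exact IsRegularLocalRing.of_ringEquiv (IsLocalization.algEquiv
    (hU.primeIdealOf x).asIdeal.primeCompl (X.presheaf.stalk x.1)
    (Localization.AtPrime (hU.primeIdealOf x).asIdeal)).toRingEquiv

/-- Nonnegative order puts `r` in each codimension-one stalk, which is the localization at a
height-one prime. `mem_range_algebraMap_of_height_one` then applies. -/
theorem mem_range_algebraMap_of_forall_ord_nonneg {U : X.Opens} (hU : IsAffineOpen U) [Nonempty U]
    {r : X.functionField} (h : r ≠ 0 → ∀ x ∈ U, coheight x = 1 → 0 ≤ Scheme.ord r x) :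
    r ∈ Set.range (algebraMap Γ(X, U) X.functionField) := by
  have : IsNoetherianRing Γ(X, U) := IsLocallyNoetherian.component_noetherian ⟨U, hU⟩
  have := functionField_isFractionRing_of_isAffineOpen X U hU
  refine mem_range_algebraMap_of_height_one
    (fun P hP => isRegularLocalRing_localization hU P) r fun P hP hP1 => ?_
  obtain ⟨x, rfl⟩ := exists_primeIdealOf_eq hU P
  rw [height_primeIdealOf] at hP1
  obtain ⟨c, rfl⟩ := mem_range_algebraMap_of_ord_nonneg hP1 fun hr => h hr x.1 x.2 hP1
  let := TopCat.Presheaf.algebra_section_stalk X.presheaf x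
  have := hU.isLocalization_stalk x
  obtain ⟨⟨a, s⟩, hs⟩ := IsLocalization.surj (hU.primeIdealOf x).asIdeal.primeCompl c
  refine ⟨s, s.2, a, ?_⟩
  rw [algebraMap_eq_algebraMap_germ x.2, algebraMap_eq_algebraMap_germ x.2, ← map_mul]
  exact congrArg _ hs

theorem krullFamily {U : X.Opens} (hU : IsAffineOpen U) [Nonempty U] :
    KrullFamily Γ(X, U) fun (x : PrimeDivisorsOn U) (r : X.functionField) =>
      Scheme.ord r x.1 where
  map_mul η _ _ hx hy := Scheme.ord_mul hx hy
  nonneg η a ha := by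
    rw [algebraMap_eq_algebraMap_germ η.2.1] at ha ⊢
    exact ord_algebraMap_nonneg η.2.2 fun h0 => ha (by rw [h0, map_zero])
  mem_range hr h := mem_range_algebraMap_of_forall_ord_nonneg hU fun _ x hx hx1 => h ⟨x, hx, hx1⟩
  finite_support {r} hr := by
    have := functionField_isFractionRing_of_isAffineOpen X U hU
    obtain ⟨a, b, hb, rfl⟩ := IsFractionRing.div_surjective (A := Γ(X, U)) r
    have hb0 : b ≠ 0 := nonZeroDivisors.ne_zero hb
    have ha0 : a ≠ 0 := by rintro rfl; exact hr (by rw [map_zero, zero_div])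
    have hinj := IsFractionRing.injective Γ(X, U) X.functionField
    have hb1 : algebraMap Γ(X, U) X.functionField b ≠ 0 :=
      (map_ne_zero_iff _ hinj).mpr hb0
    refine (((finite_coheight_one_not_mem_basicOpen hU ha0).union
      (finite_coheight_one_not_mem_basicOpen hU hb0)).preimage
        Subtype.val_injective.injOn).subset fun x hx => ?_
    by_contra hn
    simp only [Set.mem_preimage, Set.mem_union, Set.mem_ofPred_eq, x.2.1, x.2.2, true_and,
      not_or, not_not] at hn
    have h1 : Scheme.ord (algebraMap Γ(X, U) X.functionField a) x.1 =
        Scheme.ord (algebraMap Γ(X, U) X.functionField a / algebraMap Γ(X, U) X.functionField b)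
          x.1 + Scheme.ord (algebraMap Γ(X, U) X.functionField b) x.1 := by
      rw [← Scheme.ord_mul hr hb1, div_mul_cancel₀ _ hb1]
    rw [(ord_algebraMap_eq_zero_iff x.2.2 x.2.1 ha0).mpr hn.1,
      (ord_algebraMap_eq_zero_iff x.2.2 x.2.1 hb0).mpr hn.2, add_zero] at h1
    exact hx h1.symm
  exists_separating {η η'} hne := by
    by_contra! hcon
    have := functionField_isFractionRing_of_isAffineOpen X U hU
    have hinj := IsFractionRing.injective Γ(X, U) X.functionField
    -- If no function is a unit at `η` and vanishes at `η'`, every basic open neighbourhood of `η`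
    -- contains `η'`. Two points of codimension one related by specialization coincide.
    have hsp : η'.1 ⤳ η.1 := by
      rw [specializes_iff_forall_open]
      intro V hV hηV
      obtain ⟨a, haV, hηa⟩ := hU.exists_basicOpen_le (V := ⟨V, hV⟩) ⟨η.1, hηV⟩ η.2.1
      refine haV ?_
      have ha0 : a ≠ 0 := by
        rintro rfl
        simp at hηa
      rw [← ord_algebraMap_eq_zero_iff η'.2.2 η'.2.1 ha0]
      refine le_antisymm (hcon a ((map_ne_zero_iff _ hinj).mpr ha0)
        ((ord_algebraMap_eq_zero_iff η.2.2 η.2.1 ha0).mpr hηa)) ?_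
      rw [algebraMap_eq_algebraMap_germ η'.2.1]
      refine ord_algebraMap_nonneg η'.2.2 fun h0 => ha0 ?_
      exact germ_injective_of_isIntegral X η'.1 η'.2.1 (by rw [h0, map_zero])
    refine hne (Subtype.ext (eq_of_specializes_of_coheight η.2.2 hsp fun h => ?_))
    have h1 := η'.2.2
    rw [h, coheight_genericPoint] at h1
    exact absurd h1 (by decide)
  surjective η m := exists_ord_eq η.2.2 m

end AffineKrull

/-- The extension `L / K` is unramified and essentially of finite type, hence finite, so `B` is
algebraic over `A`. Inverting the nonzero elements of `A` therefore already turns `B` into its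
fraction field. -/
theorem Algebra.IsPushout.of_etale_of_isFractionRing (A B K L : Type*) [CommRing A] [CommRing B]
    [Field K] [Field L] [Algebra A B] [Algebra A K] [Algebra B L] [Algebra K L] [Algebra A L]
    [IsScalarTower A B L] [IsScalarTower A K L] [IsFractionRing A K] [IsFractionRing B L]
    [Algebra.Etale A B] : Algebra.IsPushout A B K L := by
  have hAL : Function.Injective (algebraMap A L) := by
    rw [IsScalarTower.algebraMap_eq A K L]
    exact (algebraMap K L).injective.comp (IsFractionRing.injective A K)
  have hAB : Function.Injective (algebraMap A B) := by
    rw [IsScalarTower.algebraMap_eq A B L] at hAL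
    exact Function.Injective.of_comp hAL
  have : FaithfulSMul A B := (faithfulSMul_iff_algebraMap_injective A B).mpr hAB
  have : IsDomain A := (IsFractionRing.injective A K).isDomain
  have : IsDomain B := (IsFractionRing.injective B L).isDomain
  have : Algebra.FormallyUnramified B L := .of_isLocalization (nonZeroDivisors B)
  have : Algebra.EssFiniteType B L := .of_isLocalization L (nonZeroDivisors B)
  have : Algebra.FormallyUnramified A L := .comp A B L
  have : Algebra.EssFiniteType A L := .comp A B L
  have : Algebra.FormallyUnramified K L := .of_restrictScalars A K L
  have : Algebra.EssFiniteType K L := .of_comp A K L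
  have : Module.Finite K L := Algebra.FormallyUnramified.finite_of_free K L
  have : Algebra.IsAlgebraic A L := (IsFractionRing.comap_isAlgebraic_iff (K := K)).mpr inferInstance
  have : Algebra.IsAlgebraic A B :=
    Algebra.IsAlgebraic.of_injective (IsScalarTower.toAlgHom A B L) (IsFractionRing.injective B L)
  infer_instance

/-- A flat unramified local homomorphism to a discrete valuation ring descends uniformizers. -/
theorem exists_irreducible_map {R S : Type*} [CommRing R] [CommRing S] [IsLocalRing R]
    [IsDomain S] [IsDiscreteValuationRing S] [Algebra R S] [IsLocalHom (algebraMap R S)]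
    [Module.Flat R S] (hm : (IsLocalRing.maximalIdeal R).map (algebraMap R S) =
      IsLocalRing.maximalIdeal S) :
    ∃ g : R, IsLocalRing.maximalIdeal R = Ideal.span {g} ∧ Irreducible (algebraMap R S g) := by
  -- Otherwise the maximal ideal of `S`, being generated from `R`, would be contained in its own
  -- square.
  obtain ⟨g, hg, hg2⟩ : ∃ g ∈ IsLocalRing.maximalIdeal R,
      algebraMap R S g ∉ IsLocalRing.maximalIdeal S ^ 2 := by
    by_contra! h
    have h1 : IsLocalRing.maximalIdeal S ≤ IsLocalRing.maximalIdeal S ^ 2 := by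
      conv_lhs => rw [← hm]
      exact Ideal.map_le_iff_le_comap.mpr h
    obtain ⟨ϖ, hϖ⟩ := IsDiscreteValuationRing.exists_irreducible S
    rw [hϖ.maximalIdeal_eq, Ideal.span_singleton_pow, Ideal.span_singleton_le_span_singleton] at h1
    obtain ⟨c, hc⟩ := h1
    have h2 : ϖ * 1 = ϖ * (ϖ * c) := by rw [mul_one, ← mul_assoc, ← pow_two]; exact hc
    exact hϖ.not_isUnit (.of_mul_eq_one _ (mul_left_cancel₀ hϖ.ne_zero h2).symm)
  have hgm : algebraMap R S g ∈ IsLocalRing.maximalIdeal S := hm ▸ Ideal.mem_map_of_mem _ hg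
  have hirr : Irreducible (algebraMap R S g) := by
    obtain ⟨ϖ, hϖ⟩ := IsDiscreteValuationRing.exists_irreducible S
    rw [hϖ.maximalIdeal_eq] at hgm hg2
    obtain ⟨c, hc⟩ := Ideal.mem_span_singleton.mp hgm
    have hcu : IsUnit c := by
      by_contra hcu
      have hcm : c ∈ IsLocalRing.maximalIdeal S := hcu
      rw [hϖ.maximalIdeal_eq] at hcm
      refine hg2 ?_
      rw [hc, pow_two]
      exact Ideal.mul_mem_mul (Ideal.mem_span_singleton_self _) hcm
    rw [hc]
    exact (irreducible_mul_isUnit hcu).mpr hϖ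
  refine ⟨g, ?_, hirr⟩
  -- The ideal `(g)` and the maximal ideal of `R` have the same extension to `S`; under a faithfully
  -- flat map each is the contraction of its extension.
  have : Module.FaithfullyFlat R S := Module.FaithfullyFlat.of_flat_of_isLocalHom
  rw [← Ideal.comap_map_eq_self_of_faithfullyFlat (B := S) (Ideal.span {g}), Ideal.map_span,
    Set.image_singleton, ← hirr.maximalIdeal_eq, ← hm,
    Ideal.comap_map_eq_self_of_faithfullyFlat]

/-! ### Étale morphisms at codimension-one points: uniformizers, orders and pullback of divisors. -/

section EtalePoints

variable {X Y : Scheme.{u}} [AlgebraicGeometry.IsIntegral X] [AlgebraicGeometry.IsIntegral Y]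
  [IsLocallyNoetherian X] [IsLocallyNoetherian Y] [RegularScheme X] [RegularScheme Y]

omit [AlgebraicGeometry.IsIntegral Y] [IsLocallyNoetherian Y] [RegularScheme Y] in
theorem exists_uniformizer (f : X ⟶ Y) [Etale f] {x : X} (hx : coheight x = 1) :
    ∃ g : Y.presheaf.stalk (f x),
      IsLocalRing.maximalIdeal (Y.presheaf.stalk (f x)) = Ideal.span {g} ∧
        Irreducible (f.stalkMap x g) := by
  have := isDVR_stalk x hx
  algebraize [(f.stalkMap x).hom]
  have : IsLocalHom (algebraMap (Y.presheaf.stalk (f x)) (X.presheaf.stalk x)) :=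
    inferInstanceAs <| IsLocalHom (f.stalkMap x).hom
  have : Algebra.EssFiniteType (Y.presheaf.stalk (f x)) (X.presheaf.stalk x) := by
    rw [← RingHom.essFiniteType_algebraMap, RingHom.algebraMap_toAlgebra]
    exact LocallyOfFiniteType.stalkMap f x
  have : Algebra.FormallyUnramified (Y.presheaf.stalk (f x)) (X.presheaf.stalk x) := by
    rw [← RingHom.formallyUnramified_algebraMap, RingHom.algebraMap_toAlgebra]
    exact FormallyUnramified.stalkMap f x
  have : Module.Flat (Y.presheaf.stalk (f x)) (X.presheaf.stalk x) := Flat.stalkMap f x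
  exact exists_irreducible_map Algebra.FormallyUnramified.map_maximalIdeal

omit [AlgebraicGeometry.IsIntegral Y] [IsLocallyNoetherian Y] in
-- The maximal ideal at `f x` is principal and nonzero, so the regular local ring there has
-- dimension one.
theorem coheight_apply (f : X ⟶ Y) [Etale f] {x : X} (hx : coheight x = 1) :
    coheight (f x) = 1 := by
  obtain ⟨g, hg, hirr⟩ := exists_uniformizer f hx
  have hr := RegularScheme.regular_stalk (f x)
  have hg0 : g ≠ 0 := by
    rintro rfl
    rw [map_zero] at hirr
    exact not_irreducible_zero hirr
  have h1 := hr.spanFinrank_maximalIdeal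
  have h2 : (IsLocalRing.maximalIdeal (Y.presheaf.stalk (f x))).spanFinrank = 1 :=
    (Submodule.spanFinrank_eq_one_iff _).mpr ⟨⟨g, hg⟩, by
      rw [hg]; simpa using hg0⟩
  rw [h2, ringKrullDim_stalk_eq_coheight] at h1
  exact_mod_cast h1.symm

theorem irreducible_of_span {y : Y} (hy : coheight y = 1) {g : Y.presheaf.stalk y}
    (hg : IsLocalRing.maximalIdeal (Y.presheaf.stalk y) = Ideal.span {g}) : Irreducible g := by
  have := isDVR_stalk y hy
  exact (IsDiscreteValuationRing.irreducible_iff_uniformizer g).mpr hg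

omit [IsLocallyNoetherian X] [IsLocallyNoetherian Y] [RegularScheme X] [RegularScheme Y] in
theorem functionFieldMap_algebraMap (f : X ⟶ Y) [IsDominant f] (x : X)
    (a : Y.presheaf.stalk (f x)) :
    functionFieldMap f (algebraMap _ Y.functionField a) =
      algebraMap _ X.functionField (f.stalkMap x a) := by
  have hs : genericPoint X ⤳ x := (genericPoint_spec X).specializes trivial
  have h := Scheme.Hom.stalkSpecializes_stalkMap f _ _ hs
  have h2 : algebraMap _ X.functionField (f.stalkMap x a) =
      f.stalkMap (genericPoint X) (Y.presheaf.stalkSpecializes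
        (hs.map f.continuous) a) :=
    (congrArg (fun m => m.hom a) h).symm
  rw [h2]
  exact congrArg (f.stalkMap (genericPoint X)) (congrArg (fun m => m.hom a)
    (Y.presheaf.stalkSpecializes_comp (specializes_of_eq (map_genericPoint f)) _))

/-- Ramification index one: some uniformizer at `f x` maps to a uniformizer at `x`, so the normal
form of `r` is carried to the normal form of its image. -/
theorem ord_functionFieldMap (f : X ⟶ Y) [Etale f] {x : X} (hx : coheight x = 1)
    {r : Y.functionField} (hr : r ≠ 0) :
    Scheme.ord (functionFieldMap f r) x = Scheme.ord r (f x) := by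
  obtain ⟨g, hg, hirr⟩ := exists_uniformizer f hx
  have hy := coheight_apply f hx
  obtain ⟨u, hu⟩ := exists_eq_unit_smul_zpow hy (irreducible_of_span hy hg) hr
  have h2 : functionFieldMap f r = (Units.map (f.stalkMap x).hom.toMonoidHom u) •
      algebraMap (X.presheaf.stalk x) X.functionField (f.stalkMap x g) ^ Scheme.ord r (f x) := by
    conv_lhs => rw [hu]
    rw [Units.smul_def, Units.smul_def, Algebra.smul_def, Algebra.smul_def, map_mul, map_zpow₀,
      functionFieldMap_algebraMap, functionFieldMap_algebraMap]
    rfl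
  rw [h2, ord_unit_smul_zpow hx hirr]

omit [IsLocallyNoetherian Y] in
-- As `f x` has codimension one, the only prime divisor through it is its own closure. The
-- multiplicity is one because a local equation stays irreducible in the stalk at `x`.
theorem pullback_cycle (f : X ⟶ Y) [Etale f] (D : RDivisor Y) {x : X} (hx : coheight x = 1) :
    (D.pullback f).cycle x = D.cycle (f x) := by
  change pullbackCoeff f D x = _
  have hy := coheight_apply f hx
  rw [pullbackCoeff, if_pos hx, finsum_eq_single _ (f x)]
  · obtain ⟨g, hg, hirr⟩ := exists_uniformizer f hx
    have := isDVR_stalk x hx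
    rw [pullbackMult_eq_ord f x (f x) (specializes_refl _) g (by
      rw [TopCat.Presheaf.stalkSpecializes_refl]; exact hg), Ring.ord_of_irreducible hirr]
    simp
  · intro η hη
    by_cases h0 : D.cycle η = 0
    · rw [h0, zero_mul]
    · rw [pullbackMult, dif_neg, Nat.cast_zero, mul_zero]
      intro hs
      refine hη (eq_of_specializes_of_coheight hy hs fun h => ?_).symm
      have h1 := D.codim_one η h0
      rw [h, coheight_genericPoint] at h1
      exact absurd h1 (by decide)

theorem functionFieldMap_mem_boundAt (f : X ⟶ Y) [Etale f] (D : RDivisor Y) (x : X) {k : ℕ}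
    {r : Y.functionField} (hr : r ∈ boundAt D (f x) k) :
    functionFieldMap f r ∈ boundAt (D.pullback f) x k := by
  intro h hx
  have h0 : r ≠ 0 := fun h1 => h (by rw [h1, map_zero])
  rw [ord_functionFieldMap f hx h0, pullback_cycle f D hx]
  exact hr h0 (coheight_apply f hx)

end EtalePoints

/-! ### Sections of the Witt divisorial sheaf as Witt vectors of rational functions. -/

section AffineSections

variable {X : Scheme.{u}} [AlgebraicGeometry.IsIntegral X] [IsLocallyNoetherian X] [RegularScheme X]

/-- The sections of `𝒪_X(k D)` over `U`, as rational functions. -/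
def divSubmodule (D : RDivisor X) (U : X.Opens) [Nonempty U] (k : ℕ) :
    Submodule Γ(X, U) X.functionField where
  carrier := {r | ∀ x ∈ U, r ∈ boundAt D x k}
  zero_mem' _ _ := zero_mem _
  add_mem' ha hb x hx := add_mem (ha x hx) (hb x hx)
  smul_mem' a r hr x hx := by
    rw [Algebra.smul_def, algebraMap_eq_algebraMap_germ hx]
    have := mul_mem_boundAt D x 0 k _ _
      (algebraMap_mem_boundAt D x (X.presheaf.germ U x hx a)) (hr x hx)
    rwa [zero_add] at this

/-- The multiplicities of the integral part of `k D` at the prime divisors of `U`. -/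
def floorMult (D : RDivisor X) (U : X.Opens) (k : ℕ) (x : PrimeDivisorsOn U) : ℤ :=
  ⌊(k : ℝ) * D.cycle x.1⌋

/-- Orders are integers, so real multiplicities may be rounded down. This brings real divisors
within reach of integer-valued Krull families. -/
theorem mem_divSubmodule_iff (D : RDivisor X) (U : X.Opens) [Nonempty U] (k : ℕ)
    (r : X.functionField) : r ∈ divSubmodule D U k ↔
      (r ≠ 0 → ∀ x : PrimeDivisorsOn U, 0 ≤ Scheme.ord r x.1 + floorMult D U k x) := by
  have key : ∀ (x : PrimeDivisorsOn U), 0 ≤ Scheme.ord r x.1 + floorMult D U k x ↔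
      0 ≤ (Scheme.ord r x.1 : ℝ) + k * D.cycle x.1 := fun x => by
    rw [floorMult, ← Int.floor_intCast_add, Int.floor_nonneg]
  constructor
  · exact fun h hr x => (key x).mpr (h x.1 x.2.1 hr x.2.2)
  · exact fun h x hx hr hx1 => (key ⟨x, hx, hx1⟩).mp (h hr ⟨x, hx, hx1⟩)

omit [IsLocallyNoetherian X] [RegularScheme X] [AlgebraicGeometry.IsIntegral X] in
theorem finite_support_floorMult (D : RDivisor X) {U : X.Opens} (hU : IsAffineOpen U) (k : ℕ) :
    (Function.support (floorMult D U k)).Finite := by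
  choose t ht hfin using fun z => D.cycle.supportLocallyFiniteWithinDomain' z trivial
  obtain ⟨T, -, hT⟩ := hU.isCompact.elim_nhds_subcover t fun x _ => ht x
  have h1 : (⋃ z ∈ T, t z ∩ Function.support D.cycle.toFun).Finite :=
    T.finite_toSet.biUnion fun z _ => hfin z
  refine (h1.preimage Subtype.val_injective.injOn).subset fun x hx => ?_
  obtain ⟨z, hz, hxz⟩ := Set.mem_iUnion₂.mp (hT x.2.1)
  refine Set.mem_iUnion₂.mpr ⟨z, hz, hxz, fun h0 => hx ?_⟩
  have h0' : D.cycle x.1 = 0 := h0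
  rw [floorMult, h0', mul_zero, Int.floor_zero]

omit [IsLocallyNoetherian X] [RegularScheme X] in
theorem genericPoint_mem (U : X.Opens) [h : Nonempty U] : genericPoint X ∈ U :=
  ((genericPoint_spec X).mem_open_set_iff U.isOpen).mpr (by simpa using h)

/-- Opens of an irreducible space are connected, so locally constant sections are constant. -/
theorem wittDivSections_apply_eq {p : ℕ} [Fact p.Prime] {n : ℕ} {D : RDivisor X} {U : X.Opens}
    (s : wittDivSections p n D U) (x y : U) : s.1 x = s.1 y := by
  have h := ((PreirreducibleSpace.isPreirreducible_univ (X := X)).open_subset U.isOpen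
    (Set.subset_univ _)).isPreconnected
  exact s.2.1.apply_eq_of_isPreconnected
    (preconnectedSpace_iff_univ.mp (Subtype.preconnectedSpace h)) trivial trivial

/-- Sections of `W_n 𝒪_X(D)` over a non-empty open subset are Witt vectors of rational functions. -/
def wittRep (p : ℕ) [Fact p.Prime] (n : ℕ) (D : RDivisor X) (U : X.Opens) [Nonempty U] :
    WittRep p n Γ(X, U) (wittDivSections p n D U) fun i => divSubmodule D U (p ^ (i : ℕ)) where
  val :=
    { toFun := fun s => s.1 ⟨genericPoint X, genericPoint_mem U⟩
      map_zero' := rfl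
      map_add' := fun _ _ => rfl }
  injective s t h := Subtype.ext (funext fun x =>
    (wittDivSections_apply_eq s x _).trans (h.trans (wittDivSections_apply_eq t _ x)))
  val_smul a s := by
    refine congrArg (· * s.1 ⟨genericPoint X, genericPoint_mem U⟩)
      (TruncatedWittVector.ext fun i => ?_)
    exact (algebraMap_eq_algebraMap_germ (genericPoint_mem U) _).symm
  coeff_mem s i x hx := by
    have h := s.2.2 ⟨x, hx⟩ i
    rwa [wittDivSections_apply_eq s ⟨x, hx⟩ ⟨genericPoint X, genericPoint_mem U⟩] at h
  surjective w hw := ⟨⟨fun _ => w, IsLocallyConstant.const _, fun x i => hw i x.1 x.2⟩, rfl⟩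

end AffineSections

/-! ### Base change of coordinate modules and extension of maps over affine opens. -/

section AffineLift

variable {X Y : Scheme.{u}} [AlgebraicGeometry.IsIntegral X] [AlgebraicGeometry.IsIntegral Y]
  [IsLocallyNoetherian X] [IsLocallyNoetherian Y] [RegularScheme X] [RegularScheme Y]

/-- The map on sections of the Witt divisorial sheaves induced by `W_n(K(Y)) → W_n(K(X))`. -/
def wittPull (p : ℕ) [Fact p.Prime] (n : ℕ) (f : X ⟶ Y) [Etale f] (D : RDivisor Y) {V : Y.Opens}
    {U : X.Opens} (e : U ≤ f ⁻¹ᵁ V) :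
    wittDivSections p n D V →+ wittDivSections p n (D.pullback f) U where
  toFun s := ⟨fun x => truncMap n (functionFieldMap f) (s.1 ⟨f x.1, e x.2⟩),
    (s.2.1.comp_continuous (f := fun x : U => (⟨f x.1, e x.2⟩ : V))
      ((f.continuous.comp continuous_subtype_val).subtype_mk _)).comp _,
    fun x i => functionFieldMap_mem_boundAt f D x.1 (s.2.2 ⟨f x.1, e x.2⟩ i)⟩
  map_zero' := Subtype.ext (funext fun _ => map_zero _)
  map_add' _ _ := Subtype.ext (funext fun _ => map_add _ _ _)

/-- Choose a finite `J` of rational functions on `Y` whose minimal orders are the rounded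
multiplicities of `k D`. Orders are preserved by `f`, so the image of `J` does the same for the
pullback. Both modules become colons, to which `isBaseChange_integralColon` applies. -/
theorem exists_isBaseChange_divSubmodule (f : X ⟶ Y) [Etale f] (D : RDivisor Y) {V : Y.Opens}
    {U : X.Opens} (hV : IsAffineOpen V) (hU : IsAffineOpen U) (e : U ≤ f ⁻¹ᵁ V)
    [Nonempty V] [Nonempty U]
    [Algebra Γ(Y, V) Γ(X, U)] [Algebra Y.functionField X.functionField]
    [Algebra Γ(Y, V) X.functionField] [IsScalarTower Γ(Y, V) Γ(X, U) X.functionField]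
    [IsScalarTower Γ(Y, V) Y.functionField X.functionField] [Algebra.Etale Γ(Y, V) Γ(X, U)]
    (hφ : algebraMap Y.functionField X.functionField = functionFieldMap f) (k : ℕ) :
    ∃ h : divSubmodule D V k →ₗ[Γ(Y, V)] divSubmodule (D.pullback f) U k,
      IsBaseChange Γ(X, U) h ∧
        ∀ x, (h x : X.functionField) = algebraMap Y.functionField X.functionField x := by
  have := functionField_isFractionRing_of_isAffineOpen Y V hV
  have := functionField_isFractionRing_of_isAffineOpen X U hU
  have hpush := Algebra.IsPushout.of_etale_of_isFractionRing Γ(Y, V) Γ(X, U) Y.functionField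
    X.functionField
  have hkV := krullFamily (X := Y) hV
  have hkU := krullFamily (X := X) hU
  obtain ⟨J, hJ, hJe, hJe'⟩ := hkV.exists_finite _ (finite_support_floorMult D hV k)
  have hM : divSubmodule D V k = integralColon Γ(Y, V) J := by
    ext r
    rw [mem_divSubmodule_iff, KrullFamily.mem_integralColon_iff (fun ξ _ _ => hkV.map_mul ξ)
      (fun ξ _ => hkV.nonneg ξ) (fun _ => hkV.mem_range) hJe hJe']
  let ι : PrimeDivisorsOn U → PrimeDivisorsOn V :=
    fun x => ⟨f x.1, e x.2.1, coheight_apply f x.2.2⟩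
  -- Rounding down commutes with this pullback only because every multiplicity is one.
  have hfl : ∀ x, floorMult (D.pullback f) U k x = floorMult D V k (ι x) := fun x => by
    rw [floorMult, floorMult, pullback_cycle f D x.2.2]
  have hN : divSubmodule (D.pullback f) U k = integralColon Γ(X, U)
      (algebraMap Y.functionField X.functionField '' J) := by
    ext r
    rw [mem_divSubmodule_iff, KrullFamily.mem_integralColon_iff (fun ξ _ _ => hkU.map_mul ξ)
      (fun ξ _ => hkU.nonneg ξ) (fun _ => hkU.mem_range)]
    · rintro _ ⟨y, hy, rfl⟩
      refine ⟨(map_ne_zero _).mpr (hJe y hy).1, fun x => ?_⟩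
      rw [hφ, hfl, ord_functionFieldMap f x.2.2 (hJe y hy).1]
      exact (hJe y hy).2 (ι x)
    · intro x
      obtain ⟨y, hy, hye⟩ := hJe' (ι x)
      refine ⟨_, ⟨y, hy, rfl⟩, ?_⟩
      rw [hφ, hfl, ord_functionFieldMap f x.2.2 (hJe y hy).1]
      exact hye
  have hmem : ∀ r ∈ divSubmodule D V k, algebraMap Y.functionField X.functionField r ∈
      divSubmodule (D.pullback f) U k := fun r hr x hx => by
    rw [hφ]
    exact functionFieldMap_mem_boundAt f D x (hr (f x) (e hx))
  rw [hM, hN] at *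
  let h : integralColon Γ(Y, V) J →ₗ[Γ(Y, V)]
      integralColon Γ(X, U) (algebraMap Y.functionField X.functionField '' J) :=
    { toFun := fun r => ⟨_, hmem r.1 r.2⟩
      map_add' := fun r s => Subtype.ext (map_add _ _ _)
      map_smul' := fun a r => Subtype.ext (by
        change algebraMap Y.functionField X.functionField (a • r.1) = a • algebraMap _ _ r.1
        rw [Algebra.smul_def, Algebra.smul_def, map_mul, ← IsScalarTower.algebraMap_apply]) }
  exact ⟨h, isBaseChange_integralColon hJ h fun _ => rfl, fun _ => rfl⟩

omit [IsLocallyNoetherian X] [IsLocallyNoetherian Y] [RegularScheme X] [RegularScheme Y] in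
theorem functionFieldMap_germ (f : X ⟶ Y) [IsDominant f] {V : Y.Opens} {U : X.Opens}
    (e : U ≤ f ⁻¹ᵁ V) {x : X} (hx : x ∈ U) (a : Γ(Y, V)) :
    functionFieldMap f (algebraMap (Y.presheaf.stalk (f x)) Y.functionField
      (Y.presheaf.germ V (f x) (show f x ∈ V from e hx) a)) =
      algebraMap (X.presheaf.stalk x) X.functionField
        (X.presheaf.germ U x hx (f.appLE V U e a)) := by
  rw [functionFieldMap_algebraMap, Scheme.Hom.germ_stalkMap_apply]
  congr 1
  rw [Scheme.Hom.appLE]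
  exact (X.presheaf.germ_res_apply (homOfLE e) _ hx _).symm

omit [IsLocallyNoetherian X] [IsLocallyNoetherian Y] [RegularScheme X] [RegularScheme Y] in
theorem functionFieldMap_germToFunctionField (f : X ⟶ Y) [IsDominant f] {V : Y.Opens}
    {U : X.Opens} (e : U ≤ f ⁻¹ᵁ V) [Nonempty V] [Nonempty U] (a : Γ(Y, V)) :
    functionFieldMap f (algebraMap Γ(Y, V) Y.functionField a) =
      algebraMap Γ(X, U) X.functionField (f.appLE V U e a) := by
  have hx := genericPoint_mem (X := X) U
  rw [algebraMap_eq_algebraMap_germ (show f (genericPoint X) ∈ V from e hx),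
    functionFieldMap_germ f e hx, algebraMap_eq_algebraMap_germ hx]

theorem exists_affine_lift {p : ℕ} [hp : Fact p.Prime] {n : ℕ} (f : X ⟶ Y) [Etale f]
    (D : RDivisor Y) {V : Y.Opens} {U : X.Opens} (hpV : (p : Γ(Y, V)) = 0)
    (hV : IsAffineOpen V) (hU : IsAffineOpen U) (e : U ≤ f ⁻¹ᵁ V) [hne : Nonempty U]
    {P : Type*} [AddCommGroup P] [Module (TruncatedWittVector p n Γ(X, U)) P]
    (β : wittDivSections p n D V →+ P)
    (hβ : ∀ (a : TruncatedWittVector p n Γ(Y, V)) s,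
      β (a • s) = truncMap n (f.appLE V U e).hom a • β s) :
    Submodule.span (TruncatedWittVector p n Γ(X, U)) (Set.range (wittPull p n f D e)) = ⊤ ∧
    ∃ γ : wittDivSections p n (D.pullback f) U →ₗ[TruncatedWittVector p n Γ(X, U)] P,
      ∀ s, γ (wittPull p n f D e s) = β s := by
  have hneV : Nonempty V := ⟨⟨f hne.some.1, e hne.some.2⟩⟩
  let : Algebra Γ(Y, V) Γ(X, U) := (f.appLE V U e).hom.toAlgebra
  let : Algebra Y.functionField X.functionField := (functionFieldMap f).toAlgebra
  let : Algebra Γ(Y, V) X.functionField :=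
    ((functionFieldMap f).comp (algebraMap Γ(Y, V) Y.functionField)).toAlgebra
  have : IsScalarTower Γ(Y, V) Y.functionField X.functionField :=
    IsScalarTower.of_algebraMap_eq fun _ => rfl
  have : IsScalarTower Γ(Y, V) Γ(X, U) X.functionField :=
    IsScalarTower.of_algebraMap_eq fun a => functionFieldMap_germToFunctionField f e a
  have : Algebra.Etale Γ(Y, V) Γ(X, U) := f.etale_appLE hV hU e
  have : IsNoetherianRing Γ(Y, V) := IsLocallyNoetherian.component_noetherian ⟨V, hV⟩
  have hchar : ∀ (R : Type u) [CommRing R] [Nontrivial R] (_ : Γ(Y, V) →+* R), CharP R p :=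
    fun R _ _ g => (CharP.charP_iff_prime_eq_zero hp.out).mpr (by
      rw [← map_natCast g, hpV, map_zero])
  have := hchar _ (RingHom.id Γ(Y, V))
  have := hchar _ (algebraMap Γ(Y, V) Γ(X, U))
  have := hchar _ (algebraMap Γ(Y, V) Y.functionField)
  have := hchar _ (algebraMap Γ(Y, V) X.functionField)
  choose h hh hval using fun i : Fin n =>
    exists_isBaseChange_divSubmodule f D hV hU e rfl (p ^ (i : ℕ))
  refine (wittRep p n D V).exists_lift (wittPull p n f D e) β (wittRep p n (D.pullback f) U)
    (fun s => ?_) hβ h hh hval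
  exact congrArg (truncMap n (functionFieldMap f)) (wittDivSections_apply_eq s _ _)

end AffineLift

/-! ### Morphisms of sheaves of Witt modules in terms of sections. -/

section ModuleSections

variable {p : ℕ} [hp : Fact p.Prime] {n : ℕ} {X : Scheme.{u}}

/-- The sections of a sheaf of `W_n 𝒪_X`-modules. -/
def ModuleSections (N : SheafOfModules.{u} (wittSheaf p n X)) (U : X.Opens) : Type u :=
  N.val.obj (op U)

namespace ModuleSections

variable (N : SheafOfModules.{u} (wittSheaf p n X))

instance (U : X.Opens) : AddCommGroup (ModuleSections N U) :=
  inferInstanceAs (AddCommGroup (N.val.obj (op U)))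

instance (U : X.Opens) : Module (TruncatedWittVector p n Γ(X, U)) (ModuleSections N U) :=
  inferInstanceAs (Module ((wittSheaf p n X).obj.obj (op U)) (N.val.obj (op U)))

/-- Restriction of sections. -/
def res {U U' : X.Opens} (h : U' ≤ U) : ModuleSections N U →+ ModuleSections N U' :=
  (N.val.presheaf.map (homOfLE h).op).hom

variable {N}

theorem res_smul {U U' : X.Opens} (h : U' ≤ U) (a : TruncatedWittVector p n Γ(X, U))
    (s : ModuleSections N U) :
    res N h (a • s) = truncMap n (X.presheaf.map (homOfLE h).op).hom a • res N h s :=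
  N.val.map_smul (homOfLE h).op a s

theorem res_res {U U' U'' : X.Opens} (h : U' ≤ U) (h' : U'' ≤ U') (s : ModuleSections N U) :
    res N h' (res N h s) = res N (h'.trans h) s :=
  (N.val.map_comp_apply (homOfLE h).op (homOfLE h').op s).symm

theorem eq_of_locally_eq {U : X.Opens} {s t : ModuleSections N U}
    (h : ∀ x ∈ U, ∃ (W : X.Opens) (hW : W ≤ U), x ∈ W ∧ res N hW s = res N hW t) : s = t := by
  choose W hW hx heq using h
  let G : TopCat.Sheaf Ab X := ⟨N.val.presheaf, N.isSheaf⟩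
  refine G.eq_of_locally_eq' (fun x : U => W x.1 x.2) U (fun x => homOfLE (hW x.1 x.2))
    (fun x hxU => Opens.mem_iSup.mpr ⟨⟨x, hxU⟩, hx x hxU⟩) s t fun x => heq x.1 x.2

/-- Compatibility is required only near each point of an overlap, since the intersection of two
affine charts need not be an affine chart. -/
theorem existsUnique_gluing {U : X.Opens} {ι : Type*} (W : ι → X.Opens) (hW : ∀ i, W i ≤ U)
    (hcov : ∀ x ∈ U, ∃ i, x ∈ W i) (t : ∀ i, ModuleSections N (W i))
    (ht : ∀ i j, ∀ x ∈ W i, x ∈ W j → ∃ (V : X.Opens) (hi : V ≤ W i) (hj : V ≤ W j),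
      x ∈ V ∧ res N hi (t i) = res N hj (t j)) :
    ∃! s : ModuleSections N U, ∀ i, res N (hW i) s = t i := by
  let G : TopCat.Sheaf Ab X := ⟨N.val.presheaf, N.isSheaf⟩
  refine G.existsUnique_gluing' W U (fun i => homOfLE (hW i))
    (fun x hxU => Opens.mem_iSup.mpr (hcov x hxU)) t fun i j => ?_
  change res N inf_le_left (t i) = res N inf_le_right (t j)
  refine eq_of_locally_eq fun x hx => ?_
  obtain ⟨V, hi, hj, hxV, h⟩ := ht i j x hx.1 hx.2
  exact ⟨V, le_inf hi hj, hxV, by rw [res_res, res_res]; exact h⟩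

end ModuleSections

variable [AlgebraicGeometry.IsIntegral X] [IsLocallyNoetherian X] [RegularScheme X]
  {N : SheafOfModules.{u} (wittSheaf p n X)} {E : RDivisor X}

/-- The action on sections of a morphism out of a Witt divisorial sheaf. -/
def homSections (γ : wittDivSheaf p n E ⟶ N) (U : X.Opens) :
    wittDivSections p n E U →ₗ[TruncatedWittVector p n Γ(X, U)] ModuleSections N U :=
  (γ.val.app (op U)).hom

theorem homSections_restrict (γ : wittDivSheaf p n E ⟶ N) {U U' : X.Opens} (h : U' ≤ U)
    (s : wittDivSections p n E U) :
    homSections γ U' (wittDivRestrict p n E h s) = ModuleSections.res N h (homSections γ U s) :=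
  PresheafOfModules.naturality_apply γ.val (homOfLE h).op s

theorem hom_ext_sections {γ γ' : wittDivSheaf p n E ⟶ N}
    (h : ∀ U s, homSections γ U s = homSections γ' U s) : γ = γ' :=
  SheafOfModules.hom_ext (PresheafOfModules.hom_ext fun U =>
    ModuleCat.hom_ext (LinearMap.ext fun s => h U.unop s))

/-- A morphism out of a Witt divisorial sheaf from its action on sections. -/
def homOfSections
    (g : ∀ U : X.Opens, wittDivSections p n E U →ₗ[TruncatedWittVector p n Γ(X, U)]
      ModuleSections N U)
    (hg : ∀ {U U' : X.Opens} (h : U' ≤ U) s,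
      g U' (wittDivRestrict p n E h s) = ModuleSections.res N h (g U s)) :
    wittDivSheaf p n E ⟶ N where
  val :=
    { app := fun U => ModuleCat.ofHom (X := (wittDivAbPresheaf p n E).obj U)
        (R := (wittSheaf p n X).obj.obj U) (Y := N.val.obj U) (g U.unop)
      naturality := fun {U U'} i => by
        refine ModuleCat.hom_ext (LinearMap.ext fun s => ?_)
        exact hg i.unop.le s }

end ModuleSections

/-! ### Semilinear descriptions of morphisms into a direct image. -/

section PushforwardSections

variable {p : ℕ} [hp : Fact p.Prime] {n : ℕ} {X Y : Scheme.{u}} [AlgebraicGeometry.IsIntegral Y]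
  [IsLocallyNoetherian Y] [RegularScheme Y] {f : X ⟶ Y}
  {N : SheafOfModules.{u} (wittSheaf p n X)} {D : RDivisor Y}

/-- The action on sections of a morphism from a Witt divisorial sheaf to a direct image. -/
def pushSections (β : wittDivSheaf p n D ⟶ (wittPushforward p n f).obj N) (V : Y.Opens) :
    wittDivSections p n D V →+ ModuleSections N (f ⁻¹ᵁ V) :=
  ((β.val.app (op V)).hom : _ →ₗ[_] _).toAddMonoidHom

theorem pushSections_smul (β : wittDivSheaf p n D ⟶ (wittPushforward p n f).obj N) (V : Y.Opens)
    (a : TruncatedWittVector p n Γ(Y, V)) (s : wittDivSections p n D V) :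
    pushSections β V (a • s) = truncMap n (f.app V).hom a • pushSections β V s :=
  (β.val.app (op V)).hom.map_smul a s

theorem pushSections_restrict (β : wittDivSheaf p n D ⟶ (wittPushforward p n f).obj N)
    {V V' : Y.Opens} (h : V' ≤ V) (s : wittDivSections p n D V) :
    pushSections β V' (wittDivRestrict p n D h s) =
      ModuleSections.res N (f.preimage_mono h) (pushSections β V s) :=
  PresheafOfModules.naturality_apply β.val (homOfLE h).op s

theorem push_ext_sections {β β' : wittDivSheaf p n D ⟶ (wittPushforward p n f).obj N}
    (h : ∀ V s, pushSections β V s = pushSections β' V s) : β = β' :=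
  SheafOfModules.hom_ext (PresheafOfModules.hom_ext fun V =>
    ModuleCat.hom_ext (LinearMap.ext fun s => h V.unop s))

/-- A morphism from a Witt divisorial sheaf to a direct image from its action on sections. -/
def pushOfSections (g : ∀ V : Y.Opens, wittDivSections p n D V →+ ModuleSections N (f ⁻¹ᵁ V))
    (hsmul : ∀ V (a : TruncatedWittVector p n Γ(Y, V)) s,
      g V (a • s) = truncMap n (f.app V).hom a • g V s)
    (hg : ∀ {V V' : Y.Opens} (h : V' ≤ V) s, g V' (wittDivRestrict p n D h s) =
      ModuleSections.res N (f.preimage_mono h) (g V s)) :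
    wittDivSheaf p n D ⟶ (wittPushforward p n f).obj N where
  val :=
    { app := fun V => ModuleCat.ofHom (X := (wittDivAbPresheaf p n D).obj V)
        (R := (wittSheaf p n Y).obj.obj V) (Y := ((wittPushforward p n f).obj N).val.obj V)
        { toFun := g V.unop
          map_add' := (g V.unop).map_add
          map_smul' := hsmul V.unop }
      naturality := fun {V V'} i => by
        refine ModuleCat.hom_ext (LinearMap.ext fun s => ?_)
        exact hg i.unop.le s }

variable [AlgebraicGeometry.IsIntegral X] [IsLocallyNoetherian X] [RegularScheme X]

theorem pushSections_comp_map {E : RDivisor X}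
    (α : wittDivSheaf p n D ⟶ (wittPushforward p n f).obj (wittDivSheaf p n E))
    (γ : wittDivSheaf p n E ⟶ N) (V : Y.Opens) (s : wittDivSections p n D V) :
    pushSections (α ≫ (wittPushforward p n f).map γ) V s =
      homSections γ (f ⁻¹ᵁ V) (show wittDivSections p n E (f ⁻¹ᵁ V) from pushSections α V s) := rfl

end PushforwardSections

/-! ### The natural map and its semilinearity. -/

section NaturalMapConstruction

variable {X Y : Scheme.{u}} [AlgebraicGeometry.IsIntegral X] [AlgebraicGeometry.IsIntegral Y]

variable [IsLocallyNoetherian X] [IsLocallyNoetherian Y] [RegularScheme X] [RegularScheme Y]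
  {p : ℕ} [hp : Fact p.Prime] {n : ℕ}

theorem wittPull_smul (f : X ⟶ Y) [Etale f] (D : RDivisor Y) {V : Y.Opens} {U : X.Opens}
    (e : U ≤ f ⁻¹ᵁ V) (a : TruncatedWittVector p n Γ(Y, V)) (s : wittDivSections p n D V) :
    wittPull p n f D e (a • s) = truncMap n (f.appLE V U e).hom a • wittPull p n f D e s := by
  refine Subtype.ext (funext fun x => ?_)
  change truncMap n (functionFieldMap f) (wittToFunctionField p n ⟨f x.1, e x.2⟩ a * _) =
    wittToFunctionField p n x _ * _
  rw [map_mul]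
  congr 1
  exact TruncatedWittVector.ext fun i => functionFieldMap_germ f e x.2 _

/-- The morphism `W_n 𝒪_Y(D) ⟶ (W_n f)_* W_n 𝒪_X(f^* D)` induced by `W_n(K(Y)) → W_n(K(X))`. -/
def naturalMap (p : ℕ) [Fact p.Prime] (n : ℕ) (f : X ⟶ Y) [Etale f] (D : RDivisor Y) :
    wittDivSheaf p n D ⟶ (wittPushforward p n f).obj (wittDivSheaf p n (D.pullback f)) :=
  pushOfSections (N := wittDivSheaf p n (D.pullback f))
    (fun V => show wittDivSections p n D V →+ wittDivSections p n (D.pullback f) (f ⁻¹ᵁ V) from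
      wittPull p n f D le_rfl)
    (fun V a s => (wittPull_smul f D le_rfl a s).trans (by rw [Scheme.Hom.appLE_eq_app]; rfl))
    fun _ _ => rfl

theorem naturalMap_isNaturalMap (f : X ⟶ Y) [Etale f] (D : RDivisor Y) :
    IsNaturalMap p n f D (D.pullback f) (naturalMap p n f D) :=
  fun _ _ _ => rfl

end NaturalMapConstruction

/-! ### Gluing the affine extensions and the universal property. -/

section Charts

/-- A pair of affine open subsets over which a morphism is given by a map of rings. -/
structure AffineChart {X Y : Scheme.{u}} (f : X ⟶ Y) where
  /-- The open subset of the source. -/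
  dom : X.Opens
  /-- The open subset of the target. -/
  cod : Y.Opens
  affine_dom : IsAffineOpen dom
  affine_cod : IsAffineOpen cod
  nonempty : Nonempty dom
  le : dom ≤ f ⁻¹ᵁ cod

theorem AffineChart.exists_mem {X Y : Scheme.{u}} (f : X ⟶ Y) {x : X} {U : X.Opens} (hx : x ∈ U)
    {V : Y.Opens} (hV : f x ∈ V) :
    ∃ c : AffineChart f, x ∈ c.dom ∧ c.dom ≤ U ∧ c.cod ≤ V := by
  obtain ⟨_, ⟨V', hV', rfl⟩, hxV', hVV'⟩ :=
    Y.isBasis_affineOpens.exists_subset_of_mem_open hV V.isOpen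
  obtain ⟨_, ⟨U', hU', rfl⟩, hxU', hUU'⟩ := X.isBasis_affineOpens.exists_subset_of_mem_open
    (show x ∈ U ⊓ f ⁻¹ᵁ V' from ⟨hx, hxV'⟩) (U ⊓ f ⁻¹ᵁ V').isOpen
  exact ⟨⟨U', V', hU', hV', ⟨⟨x, hxU'⟩⟩, fun y hy => (hUU' hy).2⟩, hxU',
    fun y hy => (hUU' hy).1, hVV'⟩

variable {X Y : Scheme.{u}} [AlgebraicGeometry.IsIntegral X] [AlgebraicGeometry.IsIntegral Y]
  [IsLocallyNoetherian X] [IsLocallyNoetherian Y] [RegularScheme X] [RegularScheme Y]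
  {p : ℕ} [hp : Fact p.Prime] {n : ℕ} {f : X ⟶ Y} [Etale f] {D : RDivisor Y}
  {N : SheafOfModules.{u} (wittSheaf p n X)}

omit [AlgebraicGeometry.IsIntegral Y] [IsLocallyNoetherian Y] [RegularScheme Y] hp in
theorem natCast_eq_zero_of_top (hY : (p : Γ(Y, ⊤)) = 0) (V : Y.Opens) : (p : Γ(Y, V)) = 0 := by
  rw [← map_natCast (Y.presheaf.map (homOfLE (le_top : V ≤ ⊤)).op).hom, hY, map_zero]

theorem exists_chartLift (hY : (p : Γ(Y, ⊤)) = 0)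
    (β : wittDivSheaf p n D ⟶ (wittPushforward p n f).obj N) (c : AffineChart f) :
    Submodule.span (TruncatedWittVector p n Γ(X, c.dom)) (Set.range (wittPull p n f D c.le)) = ⊤ ∧
    ∃ γ : wittDivSections p n (D.pullback f) c.dom →ₗ[TruncatedWittVector p n Γ(X, c.dom)]
        ModuleSections N c.dom,
      ∀ s, γ (wittPull p n f D c.le s) = ModuleSections.res N c.le (pushSections β c.cod s) := by
  have := c.nonempty
  refine exists_affine_lift f D (natCast_eq_zero_of_top hY _) c.affine_cod c.affine_dom c.le
    ((ModuleSections.res N c.le).comp (pushSections β c.cod)) fun a s => ?_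
  change ModuleSections.res N c.le (pushSections β c.cod (a • s)) = _
  rw [pushSections_smul, ModuleSections.res_smul]
  rfl

variable (hY : (p : Γ(Y, ⊤)) = 0) (β : wittDivSheaf p n D ⟶ (wittPushforward p n f).obj N)

/-- The extension over an affine chart of a semilinear map on `W_n 𝒪_Y(D)`. -/
def chartLift (c : AffineChart f) :
    wittDivSections p n (D.pullback f) c.dom →ₗ[TruncatedWittVector p n Γ(X, c.dom)]
      ModuleSections N c.dom :=
  (exists_chartLift hY β c).2.choose

theorem chartLift_wittPull (c : AffineChart f) (s : wittDivSections p n D c.cod) :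
    chartLift hY β c (wittPull p n f D c.le s) =
      ModuleSections.res N c.le (pushSections β c.cod s) :=
  (exists_chartLift hY β c).2.choose_spec s

theorem wittDivRestrict_smul {E : RDivisor X} {U U' : X.Opens} (h : U' ≤ U)
    (a : TruncatedWittVector p n Γ(X, U)) (s : wittDivSections p n E U) :
    wittDivRestrict p n E h (a • s) =
      truncMap n (X.presheaf.map (homOfLE h).op).hom a • wittDivRestrict p n E h s :=
  (wittDivSheaf p n E).val.map_smul (homOfLE h).op a s

/-- Pulled-back sections span over the chart, and on them both sides are restrictions of the given
map. This uniqueness is what makes the chartwise extensions glue. -/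
theorem res_chartLift (c c' : AffineChart f) (hd : c'.dom ≤ c.dom) (hc : c'.cod ≤ c.cod)
    (s : wittDivSections p n (D.pullback f) c.dom) :
    ModuleSections.res N hd (chartLift hY β c s) =
      chartLift hY β c' (wittDivRestrict p n (D.pullback f) hd s) := by
  have hs : s ∈ Submodule.span (TruncatedWittVector p n Γ(X, c.dom))
      (Set.range (wittPull p n f D c.le)) := by
    rw [(exists_chartLift hY β c).1]; trivial
  induction hs using Submodule.span_induction with
  | mem s hs =>
    obtain ⟨s, rfl⟩ := hs
    rw [chartLift_wittPull, ModuleSections.res_res]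
    change _ = chartLift hY β c' (wittPull p n f D c'.le (wittDivRestrict p n D hc s))
    rw [chartLift_wittPull, pushSections_restrict, ModuleSections.res_res]
  | zero => rw [map_zero, map_zero, map_zero, map_zero]
  | add s t _ _ hs ht => rw [map_add, map_add, map_add, map_add, hs, ht]
  | smul a s _ hs =>
    rw [map_smul, ModuleSections.res_smul, hs, wittDivRestrict_smul, map_smul]

theorem existsUnique_lift (U : X.Opens) (s : wittDivSections p n (D.pullback f) U) :
    ∃! t : ModuleSections N U, ∀ (c : AffineChart f) (hc : c.dom ≤ U),
      ModuleSections.res N hc t = chartLift hY β c (wittDivRestrict p n (D.pullback f) hc s) := by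
  have h := ModuleSections.existsUnique_gluing (N := N) (U := U)
    (ι := {c : AffineChart f // c.dom ≤ U}) (fun c => c.1.dom) (fun c => c.2)
    (fun x hx => by
      obtain ⟨c, hxc, hc, -⟩ := AffineChart.exists_mem f hx (V := ⊤) trivial
      exact ⟨⟨c, hc⟩, hxc⟩)
    (fun c => chartLift hY β c.1 (wittDivRestrict p n (D.pullback f) c.2 s))
    fun c c' x hx hx' => by
      obtain ⟨d, hxd, hd, hd'⟩ := AffineChart.exists_mem f (U := c.1.dom ⊓ c'.1.dom) ⟨hx, hx'⟩
        (V := c.1.cod ⊓ c'.1.cod) ⟨c.1.le hx, c'.1.le hx'⟩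
      refine ⟨d.dom, hd.trans inf_le_left, hd.trans inf_le_right, hxd, ?_⟩
      rw [res_chartLift hY β c.1 d _ (hd'.trans inf_le_left),
        res_chartLift hY β c'.1 d _ (hd'.trans inf_le_right)]
      rfl
  simpa only [Subtype.forall] using h

/-- The extension of a semilinear map on `W_n 𝒪_Y(D)` to `W_n 𝒪_X(f^* D)`. -/
def sheafLift : wittDivSheaf p n (D.pullback f) ⟶ N :=
  homOfSections
    (fun U =>
      { toFun := fun s => (existsUnique_lift hY β U s).choose
        map_add' := fun s t => ((existsUnique_lift hY β U (s + t)).choose_spec.2 _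
          fun c hc => by
            rw [map_add, map_add, map_add, (existsUnique_lift hY β U s).choose_spec.1 c hc,
              (existsUnique_lift hY β U t).choose_spec.1 c hc]).symm
        map_smul' := fun a s => ((existsUnique_lift hY β U (a • s)).choose_spec.2 _
          fun c hc => by
            rw [RingHom.id_apply, ModuleSections.res_smul, wittDivRestrict_smul, map_smul,
              (existsUnique_lift hY β U s).choose_spec.1 c hc]).symm })
    fun {U U'} h s => ((existsUnique_lift hY β U' _).choose_spec.2 _ fun c hc => by
      rw [ModuleSections.res_res]
      exact (existsUnique_lift hY β U s).choose_spec.1 c (hc.trans h)).symm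

theorem res_sheafLift {U : X.Opens} (c : AffineChart f) (hc : c.dom ≤ U)
    (s : wittDivSections p n (D.pullback f) U) :
    ModuleSections.res N hc (homSections (sheafLift hY β) U s) =
      chartLift hY β c (wittDivRestrict p n (D.pullback f) hc s) :=
  (existsUnique_lift hY β U s).choose_spec.1 c hc

theorem naturalMap_comp_sheafLift :
    naturalMap p n f D ≫ (wittPushforward p n f).map (sheafLift hY β) = β := by
  refine push_ext_sections fun V s => ModuleSections.eq_of_locally_eq fun x hx => ?_
  obtain ⟨c, hxc, hd, hc⟩ := AffineChart.exists_mem f hx (V := V) hx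
  refine ⟨c.dom, hd, hxc, ?_⟩
  rw [pushSections_comp_map, res_sheafLift]
  change chartLift hY β c (wittPull p n f D c.le (wittDivRestrict p n D hc s)) = _
  rw [chartLift_wittPull, pushSections_restrict, ModuleSections.res_res]

include hY in
theorem hom_ext_naturalMap {γ γ' : wittDivSheaf p n (D.pullback f) ⟶ N}
    (h : naturalMap p n f D ≫ (wittPushforward p n f).map γ =
      naturalMap p n f D ≫ (wittPushforward p n f).map γ') : γ = γ' := by
  refine hom_ext_sections fun U s => ModuleSections.eq_of_locally_eq fun x hx => ?_
  obtain ⟨c, hxc, hd, -⟩ := AffineChart.exists_mem f hx (V := ⊤) trivial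
  refine ⟨c.dom, hd, hxc, ?_⟩
  rw [← homSections_restrict, ← homSections_restrict]
  -- Only the spanning statement is used; it does not involve the map supplied here.
  have hspan := (exists_chartLift hY (naturalMap p n f D ≫ (wittPushforward p n f).map γ) c).1
  refine LinearMap.congr_fun (LinearMap.ext_on_range (v := wittPull p n f D c.le) hspan
    fun t => ?_) _
  have h1 : ∀ δ : wittDivSheaf p n (D.pullback f) ⟶ N,
      homSections δ c.dom (wittPull p n f D c.le t) = ModuleSections.res N c.le
        (pushSections (naturalMap p n f D ≫ (wittPushforward p n f).map δ) c.cod t) := by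
    intro δ
    rw [pushSections_comp_map, ← homSections_restrict]
    rfl
  rw [h1, h1, h]

include hY in
-- The pullback functor enters only through its adjunction. Precomposition with the adjoint map
-- corresponds to `γ ↦ naturalMap ≫ f_* γ`, which is injective by `hom_ext_naturalMap` and
-- surjective by `sheafLift`.
theorem isIso_homEquiv_symm_naturalMap :
    IsIso (((wittAdjunction p n f).homEquiv _ _).symm (naturalMap p n f D)) := by
  refine isIso_of_coyoneda_map_bijective _ fun N => ?_
  have key : ∀ γ : wittDivSheaf p n (D.pullback f) ⟶ N, (wittAdjunction p n f).homEquiv _ _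
      (((wittAdjunction p n f).homEquiv _ _).symm (naturalMap p n f D) ≫ γ) =
        naturalMap p n f D ≫ (wittPushforward p n f).map γ := fun γ => by
    rw [Adjunction.homEquiv_naturality_right, Equiv.apply_symm_apply]
  constructor
  · intro γ γ' h
    refine hom_ext_naturalMap hY ?_
    rw [← key, ← key]
    exact congrArg _ h
  · intro δ
    refine ⟨sheafLift hY ((wittAdjunction p n f).homEquiv _ _ δ), ?_⟩
    refine ((wittAdjunction p n f).homEquiv _ _).injective ?_
    exact (key _).trans (naturalMap_comp_sheafLift hY _)

end Charts

end

end WittDivisorial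

theorem mainTheorem4 (p : ℕ) [Fact p.Prime] (n : ℕ) (hn : 0 < n)
    {X Y : Scheme.{u}} [AlgebraicGeometry.IsIntegral X] [AlgebraicGeometry.IsIntegral Y]
    [IsLocallyNoetherian X] [IsLocallyNoetherian Y]
    [WittDivisorial.RegularScheme X] [WittDivisorial.RegularScheme Y]
    (hY : (p : Γ(Y, ⊤)) = 0) (f : X ⟶ Y) [Etale f] (D : WittDivisorial.RDivisor Y) :
    ∃ α : WittDivisorial.wittDivSheaf p n D ⟶
        (WittDivisorial.wittPushforward p n f).obj
          (WittDivisorial.wittDivSheaf p n (D.pullback f)),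
      WittDivisorial.IsNaturalMap p n f D (D.pullback f) α ∧
      IsIso (((WittDivisorial.wittAdjunction p n f).homEquiv _ _).symm α) :=
  ⟨WittDivisorial.naturalMap p n f D, WittDivisorial.naturalMap_isNaturalMap f D,
    WittDivisorial.isIso_homEquiv_symm_naturalMap hY⟩
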